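/- Let $\hat{\mathbb C}=\mathbb C\cup\{\infty\}$ be the Riemann sphere, let $\mathrm{Rat}_1\cong \mathrm{PSL}_2(\mathbb C)$ be the group of Möbius transformations, and let $\mathrm{Rat}_2$ be the space of rational maps $f:\hat{\mathbb C}\to\hat{\mathbb C}$ of degree two, viewed through its coefficients as an open subset of $\mathbb{CP}^5$. Let $\mathrm{Rat}_2^{\rm fm}\subset \mathrm{Rat}_2\times\hat{\mathbb C}^3$ be the space of all $(f,z_1,z_2,z_3)$ such that $z_1,z_2,z_3$ are the fixed points of $f$, listed with multiplicity, and let $\mathrm{Rat}_2^{\rm tm}\subset \mathrm{Rat}_2\times\hat{\mathbb C}^3\times\hat{\mathbb C}^2$ be the space of all $(f,z_1,z_2,z_3,\omega_1,\omega_2)$ such that moreover $\omega_1\neq\omega_2$ are the two critical points of $f$. Both carry the topology and the holomorphic functions induced from the ambient space (a function is holomorphic if it is locally the restriction of a holomorphic function). The group $\mathrm{Rat}_1$ acts on both by conjugation, $g\cdot(f,z_i,\omega_j)=(g\circ f\circ g^{-1},g(z_i),g(\omega_j))$. Let $\mathcal M_2^{\rm fm}$ and $\mathcal M_2^{\rm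 tm}$ be the quotient spaces, with the quotient topology, where a function is called holomorphic if its pullback to $\mathrm{Rat}_2^{\rm fm}$, respectively $\mathrm{Rat}_2^{\rm tm}$, is holomorphic. Then: 1. $\mathrm{Rat}_2^{\rm fm}$ and $\mathrm{Rat}_2^{\rm tm}$ are smooth complex manifolds of dimension $5$, and the map $\mathrm{Rat}_2^{\rm tm}\to\mathrm{Rat}_2^{\rm fm}$ forgetting $\omega_1,\omega_2$ is an unramified (locally biholomorphic) two-sheeted covering. 2. The action of $\mathrm{Rat}_1$ on $\mathrm{Rat}_2^{\rm tm}$ is free, and the quotient $\mathcal M_2^{\rm tm}$ is a smooth complex manifold of dimension $2$. 3. The action of $\mathrm{Rat}_1$ on $\mathrm{Rat}_2^{\rm fm}$ has exactly one non-free orbit, namely that of $(f_0,\infty,\infty,\infty)$, where $f_0(z)=z+z^{-1}$ has a triple fixed point at infinity. 4. The space $\mathcal M_2^{\rm fm}$ is Hausdorff and second countable and has exactly one singular point, namely the class $m_0$ of $(f_0,\infty,\infty,\infty)$: every point other than $m_0$ has a neighborhood biholomorphic to an open subset of $\mathbb C^2$, while $m_0$ has no such neighborhood. The singularity at $m_0$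 is of type $(2,2,2)$: a neighborhood of $m_0$ is biholomorphic to a neighborhood of the origin in the surface $\{z_1^2+z_2^2+z_3^2=0\}\subset\mathbb C^3$, with $m_0$ corresponding to the origin. -/

import Mathlib

open scoped Topology Manifold ContDiff OnePoint

noncomputable section

namespace QuadRat

/-! ### The Riemann sphere `OnePoint ℂ` in homogeneous coordinates -/

/-- The point `[v 0 : v 1]`, that is `v 0 / v 1`, of the Riemann sphere (meaningful for `v ≠ 0`). -/
def proj (v : Fin 2 → ℂ) : OnePoint ℂ := if v 1 = 0 then ∞ else ((v 0 / v 1 : ℂ) : OnePoint ℂ)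

/-- The standard homogeneous coordinates: `[z : 1]` for `z ∈ ℂ` and `[1 : 0]` for `∞`. -/
def hc (z : OnePoint ℂ) : Fin 2 → ℂ := z.elim ![1, 0] (fun t => ![t, 1])

/-- `v` is a vector of homogeneous coordinates of `z`. -/
def IsHom (v : Fin 2 → ℂ) (z : OnePoint ℂ) : Prop := v ≠ 0 ∧ proj v = z

/-- The area form on `ℂ²`; for a fixed `w ≠ 0`, the linear form `v ↦ wedge v w` vanishes exactly
at the multiples of `w`. -/
def wedge (v w : Fin 2 → ℂ) : ℂ := v 0 * w 1 - v 1 * w 0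

/-- The group of Möbius transformations, as a group of permutations of the Riemann sphere. -/
def Rat1 : Subgroup (Equiv.Perm (OnePoint ℂ)) :=
  (MulAction.toPermHom (GL (Fin 2) ℂ) (OnePoint ℂ)).range

/-! ### Quadratic rational maps -/

/-- The coefficients of a pair of binary quadratic forms. -/
abbrev Coef := Fin 2 → Fin 3 → ℂ

/-- The homogeneous quadratic map of `ℂ²` with coefficients `c`. -/
def quadForm (c : Coef) (v : Fin 2 → ℂ) : Fin 2 → ℂ :=
  fun i => c i 0 * v 0 ^ 2 + c i 1 * (v 0 * v 1) + c i 2 * v 1 ^ 2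

/-- The two quadratic forms have no common zero on the Riemann sphere, so that their quotient is
a rational map of degree exactly two. -/
def Nondeg (c : Coef) : Prop := ∀ v, v ≠ 0 → quadForm c v ≠ 0

/-- The self-map `z ↦ (c₀₀ z² + c₀₁ z + c₀₂) / (c₁₀ z² + c₁₁ z + c₁₂)` of the Riemann sphere. -/
def ratMap (c : Coef) (z : OnePoint ℂ) : OnePoint ℂ := proj (quadForm c (hc z))

/-- `c` is a vector of homogeneous coordinates (coefficients) of the quadratic rational map `f`. -/
def Represents (c : Coef) (f : OnePoint ℂ → OnePoint ℂ) : Prop := Nondeg c ∧ ratMap c = f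

/-- The space of quadratic rational maps of the Riemann sphere. -/
def Rat2 := {f : OnePoint ℂ → OnePoint ℂ // ∃ c, Represents c f}

/-- The quadratic rational map with coefficients `c`. -/
def Rat2.ofCoef (c : {c : Coef // Nondeg c}) : Rat2 := ⟨ratMap c.1, c.1, c.2, rfl⟩

/-- The topology of `Rat2` is the quotient topology from the coefficients, that is, the topology
of an open subset of complex projective 5-space. -/
instance : TopologicalSpace Rat2 := TopologicalSpace.coinduced Rat2.ofCoef inferInstance

/-- `z 0, z 1, z 2` is the list of the fixed points of `f`, each repeated according to its
multiplicity: the binary cubic form `v ↦ wedge v (F v)` (for a homogeneous lift `F` of `f`), whose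
zeros are the fixed points, is a nonzero multiple of the product of the linear forms
vanishing at the `z i`. -/
def IsFixedMarking (f : OnePoint ℂ → OnePoint ℂ) (z : Fin 3 → OnePoint ℂ) : Prop :=
  ∃ c, Represents c f ∧ ∃ k : ℂ, k ≠ 0 ∧
    ∀ v, wedge v (quadForm c v) = k * ∏ i, wedge v (hc (z i))

/-- `p` is a critical point of `f`: the differential at `p` of a homogeneous lift of `f` to `ℂ²` is
singular. (A lift `F` satisfies `DF_v v = 2 F v ≠ 0`, so this says that the induced map from
`ℂ² / ℂ v` to `ℂ² / ℂ (F v)`, which is the derivative of `f` up to a nonzero factor, is zero.) -/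
def IsCritical (f : OnePoint ℂ → OnePoint ℂ) (p : OnePoint ℂ) : Prop :=
  ∃ c, Represents c f ∧ (fderiv ℂ (quadForm c) (hc p)).det = 0

/-- `w 0` and `w 1` are the two distinct critical points of `f`. -/
def IsCriticalMarking (f : OnePoint ℂ → OnePoint ℂ) (w : Fin 2 → OnePoint ℂ) : Prop :=
  w 0 ≠ w 1 ∧ ∀ p, IsCritical f p ↔ p = w 0 ∨ p = w 1

/-- The space of fixed point marked quadratic rational maps `(f, z₁, z₂, z₃)`, with the
subspace topology. -/
abbrev Rat2fm := {x : Rat2 × (Fin 3 → OnePoint ℂ) // IsFixedMarking x.1.1 x.2}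

/-- The space of totally marked quadratic rational maps `(f, z₁, z₂, z₃, ω₁, ω₂)`, with the
subspace topology. -/
abbrev Rat2tm := {x : Rat2 × (Fin 3 → OnePoint ℂ) × (Fin 2 → OnePoint ℂ) //
  IsFixedMarking x.1.1 x.2.1 ∧ IsCriticalMarking x.1.1 x.2.2}

/-- The projection forgetting the marking of the critical points. -/
def forget (x : Rat2tm) : Rat2fm := ⟨(x.1.1, x.1.2.1), x.2.1⟩

/-! ### Conjugation by Möbius transformations -/

lemma hc_ne_zero (z : OnePoint ℂ) : hc z ≠ 0 := by
  intro h
  induction z using OnePoint.rec with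
  | infty => simpa [hc] using congrFun h 0
  | coe t => simpa [hc] using congrFun h 1

lemma proj_hc (z : OnePoint ℂ) : proj (hc z) = z := by
  induction z using OnePoint.rec <;> simp [hc, proj]

lemma proj_smul {a : ℂ} (ha : a ≠ 0) (v : Fin 2 → ℂ) : proj (a • v) = proj v := by
  simp only [proj, Pi.smul_apply, smul_eq_mul, mul_eq_zero, ha, false_or, mul_div_mul_left _ _ ha]

lemma exists_smul_hc {v : Fin 2 → ℂ} (hv : v ≠ 0) : ∃ a : ℂ, a ≠ 0 ∧ v = a • hc (proj v) := by
  by_cases h : v 1 = 0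
  · refine ⟨v 0, fun h0 => hv ?_, ?_⟩
    · ext i; fin_cases i <;> simp [h, h0]
    · ext i; fin_cases i <;> simp [hc, proj, h]
  · refine ⟨v 1, h, ?_⟩
    ext i
    fin_cases i
    · simp [hc, proj, h]; field_simp
    · simp [hc, proj, h]

lemma mulVec_ne_zero (g : GL (Fin 2) ℂ) {v : Fin 2 → ℂ} (hv : v ≠ 0) :
    g.1.mulVec v ≠ 0 := by
  intro h
  apply hv
  have : (g⁻¹).1.mulVec (g.1.mulVec v) = v := by
    rw [Matrix.mulVec_mulVec, ← Units.val_mul, inv_mul_cancel, Units.val_one, Matrix.one_mulVec]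
  rw [← this, h, Matrix.mulVec_zero]

lemma smul_eq_proj (g : GL (Fin 2) ℂ) (z : OnePoint ℂ) : g • z = proj (g.1.mulVec (hc z)) := by
  induction z using OnePoint.rec with
  | infty => simp [OnePoint.smul_infty_eq_ite, proj, hc]
  | coe t => simp [OnePoint.smul_some_eq_ite, proj, hc]

lemma smul_proj (g : GL (Fin 2) ℂ) {v : Fin 2 → ℂ} (hv : v ≠ 0) :
    g • proj v = proj (g.1.mulVec v) := by
  obtain ⟨a, ha, h⟩ := exists_smul_hc hv
  conv_rhs => rw [h, Matrix.mulVec_smul, proj_smul ha]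
  rw [smul_eq_proj]

lemma quadForm_smul (c : Coef) (a : ℂ) (v : Fin 2 → ℂ) :
    quadForm c (a • v) = a ^ 2 • quadForm c v := by
  ext i; simp [quadForm]; ring

lemma ratMap_proj (c : Coef) {v : Fin 2 → ℂ} (hv : v ≠ 0) :
    ratMap c (proj v) = proj (quadForm c v) := by
  obtain ⟨a, ha, h⟩ := exists_smul_hc hv
  conv_rhs => rw [h, quadForm_smul, proj_smul (pow_ne_zero 2 ha)]
  rfl

/-- The coefficients of `A ∘ F ∘ B`, where `F` has coefficients `c`. -/
def conjCoef (A B : Matrix (Fin 2) (Fin 2) ℂ) (c : Coef) : Coef := fun j =>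
  ![∑ i, A j i * (c i 0 * B 0 0 ^ 2 + c i 1 * (B 0 0 * B 1 0) + c i 2 * B 1 0 ^ 2),
    ∑ i, A j i * (2 * c i 0 * (B 0 0 * B 0 1) + c i 1 * (B 0 0 * B 1 1 + B 0 1 * B 1 0)
      + 2 * c i 2 * (B 1 0 * B 1 1)),
    ∑ i, A j i * (c i 0 * B 0 1 ^ 2 + c i 1 * (B 0 1 * B 1 1) + c i 2 * B 1 1 ^ 2)]

lemma quadForm_conjCoef (A B : Matrix (Fin 2) (Fin 2) ℂ) (c : Coef) (v : Fin 2 → ℂ) :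
    quadForm (conjCoef A B c) v = A.mulVec (quadForm c (B.mulVec v)) := by
  ext i
  fin_cases i <;> simp [quadForm, conjCoef] <;> ring

lemma represents_conj (g : GL (Fin 2) ℂ) {c : Coef} {f : OnePoint ℂ → OnePoint ℂ}
    (h : Represents c f) :
    Represents (conjCoef g.1 (g⁻¹).1 c) (fun z => g • f (g⁻¹ • z)) := by
  refine ⟨fun v hv => ?_, funext fun z => ?_⟩
  · rw [quadForm_conjCoef]
    exact mulVec_ne_zero g (h.1 _ (mulVec_ne_zero _ hv))
  · have h1 := mulVec_ne_zero g⁻¹ (hc_ne_zero z)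
    rw [ratMap, quadForm_conjCoef, ← h.2, smul_eq_proj g⁻¹ z, ratMap_proj c h1,
      smul_proj g (h.1 _ h1)]

lemma wedge_mulVec (A : Matrix (Fin 2) (Fin 2) ℂ) (v w : Fin 2 → ℂ) :
    wedge (A.mulVec v) (A.mulVec w) = A.det * wedge v w := by
  simp [wedge, Matrix.det_fin_two]; ring

lemma exists_smul_hc_smul (g : GL (Fin 2) ℂ) (z : OnePoint ℂ) :
    ∃ a : ℂ, a ≠ 0 ∧ g.1.mulVec (hc z) = a • hc (g • z) := by
  rw [smul_eq_proj]
  exact exists_smul_hc (mulVec_ne_zero g (hc_ne_zero z))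

lemma wedge_smul_right (v w : Fin 2 → ℂ) (a : ℂ) : wedge v (a • w) = a * wedge v w := by
  simp [wedge]; ring

lemma isFixedMarking_conj (g : GL (Fin 2) ℂ) {f : OnePoint ℂ → OnePoint ℂ}
    {z : Fin 3 → OnePoint ℂ} (h : IsFixedMarking f z) :
    IsFixedMarking (fun x => g • f (g⁻¹ • x)) (fun i => g • z i) := by
  obtain ⟨c, hc', k, hk, hkv⟩ := h
  choose a ha haz using fun i => exists_smul_hc_smul g (z i)
  have hd : g.1.det ≠ 0 := g.det_ne_zero
  have hd' : (g⁻¹).1.det ≠ 0 := (g⁻¹).det_ne_zero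
  refine ⟨_, represents_conj g hc', g.1.det * k * ∏ i, ((g⁻¹).1.det * a i), ?_, fun v => ?_⟩
  · exact mul_ne_zero (mul_ne_zero hd hk)
      (Finset.prod_ne_zero_iff.2 fun i _ => mul_ne_zero hd' (ha i))
  · have hv : v = g.1.mulVec ((g⁻¹).1.mulVec v) := by
      rw [Matrix.mulVec_mulVec, ← Units.val_mul, mul_inv_cancel, Units.val_one, Matrix.one_mulVec]
    have hz : ∀ i, wedge ((g⁻¹).1.mulVec v) (hc (z i)) =
        (g⁻¹).1.det * a i * wedge v (hc (g • z i)) := fun i => by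
      have : hc (z i) = (g⁻¹).1.mulVec (a i • hc (g • z i)) := by
        rw [← haz i, Matrix.mulVec_mulVec, ← Units.val_mul, inv_mul_cancel, Units.val_one,
          Matrix.one_mulVec]
      rw [this, wedge_mulVec, wedge_smul_right, mul_assoc]
    rw [quadForm_conjCoef]
    conv_lhs => rw [hv]
    rw [wedge_mulVec, ← hv, hkv]
    simp_rw [hz]
    rw [Finset.prod_mul_distrib]
    ring

lemma det_fderiv_quadForm (c : Coef) (v : Fin 2 → ℂ) :
    (fderiv ℂ (quadForm c) v).det =
      (2 * c 0 0 * v 0 + c 0 1 * v 1) * (c 1 1 * v 0 + 2 * c 1 2 * v 1) -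
      (c 0 1 * v 0 + 2 * c 0 2 * v 1) * (2 * c 1 0 * v 0 + c 1 1 * v 1) := by
  have hd : HasFDerivAt (quadForm c)
      (LinearMap.toContinuousLinearMap (Matrix.toLin'
        !![2 * c 0 0 * v 0 + c 0 1 * v 1, c 0 1 * v 0 + 2 * c 0 2 * v 1;
           2 * c 1 0 * v 0 + c 1 1 * v 1, c 1 1 * v 0 + 2 * c 1 2 * v 1])) v := by
    rw [hasFDerivAt_pi']
    intro i
    have h0 : HasFDerivAt (fun v : Fin 2 → ℂ => v 0)
      (ContinuousLinearMap.proj 0 : (Fin 2 → ℂ) →L[ℂ] ℂ) v := hasFDerivAt_apply 0 v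
    have h1 : HasFDerivAt (fun v : Fin 2 → ℂ => v 1)
      (ContinuousLinearMap.proj 1 : (Fin 2 → ℂ) →L[ℂ] ℂ) v := hasFDerivAt_apply 1 v
    have := ((((h0.mul h0).const_mul (c i 0)).add ((h0.mul h1).const_mul (c i 1))).add
      ((h1.mul h1).const_mul (c i 2)))
    convert this using 1
    · funext w; simp [quadForm]; ring
    · ext w; fin_cases i <;> simp [Matrix.vecHead, Matrix.vecTail] <;> ring
  rw [hd.fderiv, ContinuousLinearMap.det, LinearMap.coe_toContinuousLinearMap,
    LinearMap.det_toLin', Matrix.det_fin_two_of]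

lemma isCritical_conj (g : GL (Fin 2) ℂ) {f : OnePoint ℂ → OnePoint ℂ}
    {p : OnePoint ℂ} (h : IsCritical f p) :
    IsCritical (fun x => g • f (g⁻¹ • x)) (g • p) := by
  obtain ⟨c, hr, hdet⟩ := h
  obtain ⟨a, ha, hap⟩ := exists_smul_hc_smul g p
  refine ⟨_, represents_conj g hr, ?_⟩
  have hp : hc (g • p) = a⁻¹ • g.1.mulVec (hc p) := by
    rw [hap, smul_smul, inv_mul_cancel₀ ha, one_smul]
  have hB : (g⁻¹).1.mulVec (hc (g • p)) = a⁻¹ • hc p := by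
    rw [hp, Matrix.mulVec_smul, Matrix.mulVec_mulVec, ← Units.val_mul, inv_mul_cancel,
      Units.val_one, Matrix.one_mulVec]
  have key : ∀ (A B : Matrix (Fin 2) (Fin 2) ℂ) (v : Fin 2 → ℂ),
      (fderiv ℂ (quadForm (conjCoef A B c)) v).det =
        A.det * B.det * (fderiv ℂ (quadForm c) (B.mulVec v)).det := by
    intro A B v
    simp [det_fderiv_quadForm, conjCoef, Matrix.det_fin_two]
    ring
  have hs : (fderiv ℂ (quadForm c) (a⁻¹ • hc p)).det =
      a⁻¹ ^ 2 * (fderiv ℂ (quadForm c) (hc p)).det := by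
    simp only [det_fderiv_quadForm, Pi.smul_apply, smul_eq_mul]
    ring
  rw [key, hB, hs, hdet]
  ring

lemma isCriticalMarking_conj (g : GL (Fin 2) ℂ) {f : OnePoint ℂ → OnePoint ℂ}
    {w : Fin 2 → OnePoint ℂ} (h : IsCriticalMarking f w) :
    IsCriticalMarking (fun x => g • f (g⁻¹ • x)) (fun i => g • w i) := by
  refine ⟨fun h' => h.1 (MulAction.injective g h'), fun p => ?_⟩
  have : IsCritical (fun x => g • f (g⁻¹ • x)) p ↔ IsCritical f (g⁻¹ • p) := by
    constructor
    · intro hp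
      simpa using isCritical_conj g⁻¹ hp
    · intro hp
      simpa using isCritical_conj g hp
  rw [this, h.2, inv_smul_eq_iff, inv_smul_eq_iff]

/-- Möbius transformations act on quadratic rational maps by `g • f = g ∘ f ∘ g⁻¹`. -/
instance : MulAction Rat1 Rat2 where
  smul g f := ⟨fun z => g.1 (f.1 (g.1⁻¹ z)), by
    obtain ⟨_, g, rfl⟩ := g
    obtain ⟨f, c, hf⟩ := f
    exact ⟨_, represents_conj g hf⟩⟩
  one_smul _ := rfl
  mul_smul _ _ _ := rfl

/-- The conjugation action `g • (f, z) = (g ∘ f ∘ g⁻¹, g z)` on fixed point marked maps. -/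
instance : MulAction Rat1 Rat2fm where
  smul g x := ⟨(g • x.1.1, fun i => g.1 (x.1.2 i)), by
    obtain ⟨_, g, rfl⟩ := g
    obtain ⟨x, hx⟩ := x
    exact isFixedMarking_conj g hx⟩
  one_smul _ := rfl
  mul_smul _ _ _ := rfl

/-- The conjugation action `g • (f, z, ω) = (g ∘ f ∘ g⁻¹, g z, g ω)` on totally marked maps. -/
instance : MulAction Rat1 Rat2tm where
  smul g x := ⟨(g • x.1.1, fun i => g.1 (x.1.2.1 i), fun j => g.1 (x.1.2.2 j)), by
    obtain ⟨_, g, rfl⟩ := g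
    obtain ⟨x, hx⟩ := x
    exact ⟨isFixedMarking_conj g hx.1, isCriticalMarking_conj g hx.2⟩⟩
  one_smul _ := rfl
  mul_smul _ _ _ := rfl

/-- The moduli space of fixed point marked maps, with the quotient topology. -/
abbrev M2fm := Quotient (MulAction.orbitRel Rat1 Rat2fm)

/-- The moduli space of totally marked maps, with the quotient topology. -/
abbrev M2tm := Quotient (MulAction.orbitRel Rat1 Rat2tm)

/-- The class of a fixed point marked map in the moduli space. -/
def Rat2fm.toModuli (x : Rat2fm) : M2fm := Quotient.mk _ x

/-- The class of a totally marked map in the moduli space. -/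
def Rat2tm.toModuli (x : Rat2tm) : M2tm := Quotient.mk _ x

/-! ### The map `z + 1/z` -/

/-- The self-map `z ↦ z + 1/z` of the Riemann sphere. -/
def zAddInv (z : OnePoint ℂ) : OnePoint ℂ :=
  z.elim ∞ (fun t => if t = 0 then ∞ else ((t + t⁻¹ : ℂ) : OnePoint ℂ))

lemma represents_zAddInv : Represents ![![1, 0, 1], ![0, 1, 0]] zAddInv := by
  refine ⟨fun v hv h => hv ?_, funext fun z => ?_⟩
  · have h0 := congrFun h 0
    have h1 := congrFun h 1
    simp [quadForm] at h0 h1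
    ext i
    rcases h1 with h1 | h1 <;> simp [h1] at h0 <;> fin_cases i <;> simp [h0, h1]
  · induction z using OnePoint.rec with
    | infty => simp [ratMap, quadForm, hc, proj, zAddInv]
    | coe t =>
      by_cases ht : t = 0
      · simp [ratMap, quadForm, hc, proj, zAddInv, ht]
      · simp [ratMap, quadForm, hc, proj, zAddInv, ht]
        field_simp

/-- The map `z ↦ z + 1/z`, with its triple fixed point at infinity listed three times. -/
def tripleFixed : Rat2fm := ⟨(⟨zAddInv, _, represents_zAddInv⟩, fun _ => ∞), by
  refine ⟨_, represents_zAddInv, 1, one_ne_zero, fun v => ?_⟩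
  simp [wedge, quadForm, hc]
  ring⟩

/-! ### Holomorphic functions

A complex structure on a topological space `X` is recorded by its holomorphic functions, as a
predicate `H g x`: the function `g : X → ℂ` is holomorphic near the point `x`. -/

/-- `(c, w)` is a system of homogeneous coordinates of the marked map `(f, z)`. -/
def Rat2fm.IsLift (p : Coef × (Fin 3 → Fin 2 → ℂ)) (x : Rat2fm) : Prop :=
  Represents p.1 x.1.1.1 ∧ ∀ i, IsHom (p.2 i) (x.1.2 i)

/-- The complex structure of `Rat2fm` as a subset of `ℂP⁵ × (ℂP¹)³`: a function is holomorphic near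
`x` if, in homogeneous coordinates, it is locally the restriction of an analytic function. -/
def Rat2fm.HolAt (g : Rat2fm → ℂ) (x : Rat2fm) : Prop :=
  ∀ p, Rat2fm.IsLift p x → ∃ G : Coef × (Fin 3 → Fin 2 → ℂ) → ℂ,
    AnalyticAt ℂ G p ∧ ∀ᶠ q in 𝓝 p, ∀ y, Rat2fm.IsLift q y → g y = G q

/-- `(c, w, u)` is a system of homogeneous coordinates of the marked map `(f, z, ω)`. -/
def Rat2tm.IsLift (p : Coef × (Fin 3 → Fin 2 → ℂ) × (Fin 2 → Fin 2 → ℂ)) (x : Rat2tm) : Prop :=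
  Represents p.1 x.1.1.1 ∧ (∀ i, IsHom (p.2.1 i) (x.1.2.1 i)) ∧ ∀ j, IsHom (p.2.2 j) (x.1.2.2 j)

/-- The complex structure of `Rat2tm` as a subset of `ℂP⁵ × (ℂP¹)³ × (ℂP¹)²`: a function is
holomorphic near `x` if, in homogeneous coordinates, it is locally the restriction of an
analytic function. -/
def Rat2tm.HolAt (g : Rat2tm → ℂ) (x : Rat2tm) : Prop :=
  ∀ p, Rat2tm.IsLift p x → ∃ G : Coef × (Fin 3 → Fin 2 → ℂ) × (Fin 2 → Fin 2 → ℂ) → ℂ,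
    AnalyticAt ℂ G p ∧ ∀ᶠ q in 𝓝 p, ∀ y, Rat2tm.IsLift q y → g y = G q

/-- The quotient complex structure: a function on the moduli space is holomorphic if its pullback
to the space of marked maps is. -/
def M2fm.HolAt (g : M2fm → ℂ) (m : M2fm) : Prop :=
  ∀ x, Rat2fm.toModuli x = m → Rat2fm.HolAt (g ∘ Rat2fm.toModuli) x

/-- The quotient complex structure: a function on the moduli space is holomorphic if its pullback
to the space of marked maps is. -/
def M2tm.HolAt (g : M2tm → ℂ) (m : M2tm) : Prop :=
  ∀ x, Rat2tm.toModuli x = m → Rat2tm.HolAt (g ∘ Rat2tm.toModuli) x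

/-- The surface `z₁ ^ p + z₂ ^ q + z₃ ^ r = 0` in `ℂ³`. -/
abbrev Brieskorn (p q r : ℕ) := {z : Fin 3 → ℂ // z 0 ^ p + z 1 ^ q + z 2 ^ r = 0}

/-- The holomorphic functions on the surface `z₁ ^ p + z₂ ^ q + z₃ ^ r = 0` are the local
restrictions of analytic functions on `ℂ³`. -/
def Brieskorn.HolAt (p q r : ℕ) (g : Brieskorn p q r → ℂ) (y : Brieskorn p q r) : Prop :=
  ∃ G : (Fin 3 → ℂ) → ℂ, AnalyticAt ℂ G y.1 ∧ ∀ᶠ z in 𝓝 y, g z = G z.1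

section Generic

variable {X Y : Type} [TopologicalSpace X] [TopologicalSpace Y]

/-- The homeomorphism `e` between open subsets of `X` and `Y` identifies the
holomorphic functions. -/
def IsBiholomorphic (HX : (X → ℂ) → X → Prop) (HY : (Y → ℂ) → Y → Prop)
    (e : OpenPartialHomeomorph X Y) : Prop :=
  ∀ x ∈ e.source, ∀ g : Y → ℂ, HY g (e x) ↔ HX (g ∘ e) x

/-- `X` is a (Hausdorff, second countable) smooth complex `n`-manifold whose holomorphic functions
are those given by `H`. -/
def IsComplexManifold (n : ℕ) (H : (X → ℂ) → X → Prop) : Prop :=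
  T2Space X ∧ SecondCountableTopology X ∧
    ∃ _ : ChartedSpace (EuclideanSpace ℂ (Fin n)) X,
      IsManifold 𝓘(ℂ, EuclideanSpace ℂ (Fin n)) ω X ∧
        ∀ (g : X → ℂ) (x : X),
          H g x ↔ ContMDiffAt 𝓘(ℂ, EuclideanSpace ℂ (Fin n)) 𝓘(ℂ) ω g x

/-- Near `x`, the space `X` is biholomorphic to an open subset of `ℂⁿ`. -/
def IsSmoothPoint (n : ℕ) (H : (X → ℂ) → X → Prop) (x : X) : Prop :=
  ∃ e : OpenPartialHomeomorph X (EuclideanSpace ℂ (Fin n)),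
    x ∈ e.source ∧ IsBiholomorphic H (fun g y => AnalyticAt ℂ g y) e

/-- Near `x`, the space `X` is biholomorphic to a neighbourhood of the origin in the surface
`z₁ ^ p + z₂ ^ q + z₃ ^ r = 0`, with `x` corresponding to the origin. -/
def HasSingularityType (p q r : ℕ) (H : (X → ℂ) → X → Prop) (x : X) : Prop :=
  ∃ e : OpenPartialHomeomorph X (Brieskorn p q r),
    x ∈ e.source ∧ (e x).1 = 0 ∧ IsBiholomorphic H (Brieskorn.HolAt p q r) e

/-- `π` is an unramified holomorphic covering with `d` sheets: a covering map whose fibres have `d`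
elements and which is locally biholomorphic. -/
def IsUnramifiedCover (d : ℕ) (HX : (X → ℂ) → X → Prop) (HY : (Y → ℂ) → Y → Prop)
    (π : X → Y) : Prop :=
  IsCoveringMap π ∧ (∀ y, Nat.card (π ⁻¹' {y}) = d) ∧
    ∀ x, ∃ e : OpenPartialHomeomorph X Y,
      x ∈ e.source ∧ Set.EqOn e π e.source ∧ IsBiholomorphic HX HY e

end Generic

end QuadRat

end

open QuadRat

/-!
A totally marked map can be conjugated so that its critical points are `0` and `∞`; it is then
`z ↦ (a z² + b) / (c z² + d)`, and it is determined up to conjugation by the ratios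
`ρᵢⱼ = (zᵢ - zⱼ) / (zᵢ + zⱼ)` of its fixed points. For a fixed point `zᵢ` that is not critical, the
two numbers `ρᵢⱼ` with `j ≠ i` are coordinates on the moduli space, and such a fixed point always
exists. Exchanging the critical points replaces `ρ` by `-ρ`, so that the moduli space of fixed point
marked maps is the quotient of the moduli space of totally marked maps by this involution, whose
only fixed point `ρ = 0` is the class of the maps with a triple fixed point. Near it the quotient is
`ℂ² / ±1`, which is the quadratic cone because an even analytic function is an analytic function of
the quadratic monomials. The cone is not smooth at its vertex: the differential of the inverse of a
chart there would map `ℂ²` injectively into the cone, which contains no plane.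
-/

noncomputable section

namespace QuadRat

/-! ### Spaces described by analytic lifts -/

section Lifts

/-- The relation `L` behaves like a continuous open surjection from a subset of `E` onto `X`.
Every space below is of this kind, `L p x` meaning that `p` is a system of homogeneous coordinates
of `x`. -/
structure IsLiftSystem {E X : Type*} [TopologicalSpace E] [TopologicalSpace X]
    (L : E → X → Prop) : Prop where
  exists_lift : ∀ x, ∃ p, L p x
  eventually_mem : ∀ {p x}, L p x → ∀ {U : Set X}, U ∈ 𝓝 x → ∀ᶠ q in 𝓝 p, ∀ y, L q y → y ∈ U
  eventually_exists : ∀ {p x}, L p x → ∀ {W : Set E}, W ∈ 𝓝 p → ∀ᶠ y in 𝓝 x, ∃ q ∈ W, L q y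

namespace IsLiftSystem

variable {E E' X Y : Type*} [TopologicalSpace E] [TopologicalSpace E'] [TopologicalSpace X]
  [TopologicalSpace Y] {L : E → X → Prop} {L' : E' → Y → Prop}

lemma eq : IsLiftSystem (@Eq E) where
  exists_lift x := ⟨x, rfl⟩
  eventually_mem := by
    rintro p _ rfl U hU
    filter_upwards [hU] with q hq y hy
    exact hy ▸ hq
  eventually_exists := by
    rintro p _ rfl W hW
    filter_upwards [hW] with q hq
    exact ⟨q, hq, rfl⟩

lemma prod (hL : IsLiftSystem L) (hL' : IsLiftSystem L') :
    IsLiftSystem (fun (p : E × E') (x : X × Y) => L p.1 x.1 ∧ L' p.2 x.2) where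
  exists_lift x := by
    obtain ⟨p, hp⟩ := hL.exists_lift x.1
    obtain ⟨q, hq⟩ := hL'.exists_lift x.2
    exact ⟨(p, q), hp, hq⟩
  eventually_mem := by
    rintro ⟨p, p'⟩ ⟨x, x'⟩ ⟨hp, hp'⟩ U hU
    rw [nhds_prod_eq, Filter.mem_prod_iff] at hU
    obtain ⟨A, hA, B, hB, hAB⟩ := hU
    rw [nhds_prod_eq]
    filter_upwards [Filter.prod_mem_prod (hL.eventually_mem hp hA) (hL'.eventually_mem hp' hB)]
      with q hq y hy
    exact hAB ⟨hq.1 _ hy.1, hq.2 _ hy.2⟩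
  eventually_exists := by
    rintro ⟨p, p'⟩ ⟨x, x'⟩ ⟨hp, hp'⟩ W hW
    rw [nhds_prod_eq, Filter.mem_prod_iff] at hW
    obtain ⟨A, hA, B, hB, hAB⟩ := hW
    rw [nhds_prod_eq]
    filter_upwards [Filter.prod_mem_prod (hL.eventually_exists hp hA)
      (hL'.eventually_exists hp' hB)] with y ⟨⟨q, hq, hqy⟩, q', hq', hqy'⟩
    exact ⟨(q, q'), hAB ⟨hq, hq'⟩, hqy, hqy'⟩

lemma pi {ι : Type*} [Finite ι] (hL : IsLiftSystem L) :
    IsLiftSystem (fun (p : ι → E) (x : ι → X) => ∀ i, L (p i) (x i)) where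
  exists_lift x := by
    choose p hp using fun i => hL.exists_lift (x i)
    exact ⟨p, hp⟩
  eventually_mem := by
    intro p x hp U hU
    rw [nhds_pi, Filter.mem_pi'] at hU
    obtain ⟨I, t, ht, hU⟩ := hU
    have h : ∀ i, ∀ᶠ q in 𝓝 p, ∀ y, L (q i) y → y ∈ t i := fun i =>
      (continuous_apply i).continuousAt.eventually (hL.eventually_mem (hp i) (ht i))
    filter_upwards [Filter.eventually_all.2 h] with q hq y hy
    exact hU fun i _ => hq i _ (hy i)
  eventually_exists := by
    intro p x hp W hW
    rw [nhds_pi, Filter.mem_pi'] at hW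
    obtain ⟨I, t, ht, hW⟩ := hW
    have h : ∀ i, ∀ᶠ y in 𝓝 x, ∃ q ∈ t i, L q (y i) := fun i =>
      (continuous_apply i).continuousAt.eventually (hL.eventually_exists (hp i) (ht i))
    filter_upwards [Filter.eventually_all.2 h] with y hy
    choose q hq hqy using hy
    exact ⟨q, hW fun i _ => hq i, hqy⟩

lemma subtype (hL : IsLiftSystem L) (P : X → Prop) :
    IsLiftSystem (fun (p : E) (x : {x // P x}) => L p x.1) where
  exists_lift x := hL.exists_lift x.1
  eventually_mem := by
    intro p x hp U hU
    obtain ⟨V, hV, hVU⟩ := mem_nhds_subtype _ _ _ |>.1 hU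
    filter_upwards [hL.eventually_mem hp hV] with q hq y hy
    exact hVU (hq _ hy)
  eventually_exists := by
    intro p x hp W hW
    exact continuous_subtype_val.continuousAt.eventually (hL.eventually_exists hp hW)

lemma quotient (hL : IsLiftSystem L) {π : X → Y} (hπ : IsOpenQuotientMap π) :
    IsLiftSystem (fun (p : E) (m : Y) => ∃ x, L p x ∧ π x = m) where
  exists_lift m := by
    obtain ⟨x, rfl⟩ := hπ.surjective m
    obtain ⟨p, hp⟩ := hL.exists_lift x
    exact ⟨p, x, hp, rfl⟩
  eventually_mem := by
    rintro p _ ⟨x, hp, rfl⟩ U hU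
    filter_upwards [hL.eventually_mem hp (hπ.continuous.continuousAt hU)] with q hq
    rintro _ ⟨x, hx, rfl⟩
    exact hq x hx
  eventually_exists := by
    rintro p _ ⟨x, hp, rfl⟩ W hW
    filter_upwards [hπ.isOpenMap.image_mem_nhds (hL.eventually_exists hp hW)]
    rintro _ ⟨y, ⟨q, hq, hy⟩, rfl⟩
    exact ⟨q, hq, y, hy, rfl⟩

lemma isOpen_setOf_exists (hL : IsLiftSystem L) {W : Set E} (hW : IsOpen W) :
    IsOpen {x | ∃ p ∈ W, L p x} := by
  rw [isOpen_iff_mem_nhds]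
  rintro x ⟨p, hpW, hp⟩
  exact hL.eventually_exists hp (hW.mem_nhds hpW)

lemma secondCountableTopology [SecondCountableTopology E] (hL : IsLiftSystem L) :
    SecondCountableTopology X := by
  have hE := TopologicalSpace.isBasis_countableBasis E
  have hX : TopologicalSpace.IsTopologicalBasis
      ((fun W : Set E => {x | ∃ p ∈ W, L p x}) '' TopologicalSpace.countableBasis E) := by
    refine TopologicalSpace.isTopologicalBasis_of_isOpen_of_nhds ?_ fun x U hx hU => ?_
    · rintro _ ⟨W, hW, rfl⟩
      exact hL.isOpen_setOf_exists (hE.isOpen hW)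
    · obtain ⟨p, hp⟩ := hL.exists_lift x
      obtain ⟨W, hW, hpW, hWU⟩ := hE.mem_nhds_iff.1 (hL.eventually_mem hp (hU.mem_nhds hx))
      refine ⟨_, ⟨W, hW, rfl⟩, ⟨p, hpW, hp⟩, ?_⟩
      rintro y ⟨q, hq, hqy⟩
      exact hWU hq y hqy
  exact hX.secondCountableTopology ((TopologicalSpace.countable_countableBasis E).image _)

end IsLiftSystem

variable {E E' V : Type*} [NormedAddCommGroup E] [NormedSpace ℂ E] [NormedAddCommGroup E']
  [NormedSpace ℂ E'] [NormedAddCommGroup V] [NormedSpace ℂ V] {X Y : Type*}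

/-- The function `g` is near `x`, in terms of the lifts given by the relation `L`, the restriction
of an analytic function. This is the common shape of `Rat2fm.HolAt` and `Rat2tm.HolAt`. -/
def LiftHolAt (L : E → X → Prop) (g : X → ℂ) (x : X) : Prop :=
  ∀ p, L p x → ∃ G : E → ℂ, AnalyticAt ℂ G p ∧ ∀ᶠ q in 𝓝 p, ∀ y, L q y → g y = G q

/-- The map `f` is holomorphic near `x`: at every lift of `x` it is covered by an analytic map
between lifts. -/
def HasAnalyticLiftAt (L : E → X → Prop) (L' : E' → Y → Prop) (f : X → Y) (x : X) : Prop :=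
  ∀ p, L p x → ∃ Φ : E → E', AnalyticAt ℂ Φ p ∧ ∀ᶠ q in 𝓝 p, ∀ y, L q y → L' (Φ q) (f y)

/-- Whether `g` is holomorphic near `x` only depends on the germ of `g` at `x`. -/
def DependsOnGerm [TopologicalSpace X] (H : (X → ℂ) → X → Prop) : Prop :=
  ∀ ⦃g g' : X → ℂ⦄ ⦃x : X⦄, g =ᶠ[𝓝 x] g' → H g x → H g' x

lemma IsLiftSystem.dependsOnGerm [TopologicalSpace X] {L : E → X → Prop} (hL : IsLiftSystem L) :
    DependsOnGerm (LiftHolAt L) := by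
  intro g g' x h hg p hp
  obtain ⟨G, hG, hgG⟩ := hg p hp
  refine ⟨G, hG, ?_⟩
  filter_upwards [hgG, hL.eventually_mem hp h] with q hq hq' y hy
  rw [← hq y hy, hq' y hy]

lemma liftHolAt_eq {g : E → ℂ} {x : E} : LiftHolAt Eq g x ↔ AnalyticAt ℂ g x := by
  constructor
  · intro h
    obtain ⟨G, hG, hgG⟩ := h x rfl
    exact hG.congr (hgG.mono fun q hq => (hq q rfl).symm)
  · rintro h p rfl
    refine ⟨g, h, Filter.Eventually.of_forall ?_⟩
    rintro q _ rfl
    rfl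

lemma liftHolAt_quotient {L : E → X → Prop} {π : X → Y} {g : Y → ℂ} {m : Y} :
    LiftHolAt (fun (p : E) (m : Y) => ∃ x, L p x ∧ π x = m) g m ↔
      ∀ x, π x = m → LiftHolAt L (g ∘ π) x := by
  constructor
  · rintro h x rfl p hp
    obtain ⟨G, hG, hgG⟩ := h p ⟨x, hp, rfl⟩
    exact ⟨G, hG, hgG.mono fun q hq y hy => hq _ ⟨y, hy, rfl⟩⟩
  · rintro h p ⟨x, hp, hx⟩
    obtain ⟨G, hG, hgG⟩ := h x hx p hp
    refine ⟨G, hG, hgG.mono ?_⟩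
    rintro q hq _ ⟨y, hy, rfl⟩
    exact hq y hy

namespace HasAnalyticLiftAt

variable {L : E → X → Prop} {L' : E' → Y → Prop} {f : X → Y} {x : X}

lemma of_forall {f : X → V} {Φ : E → V} (hΦf : ∀ q y, L q y → Φ q = f y)
    (hΦ : ∀ q, L q x → AnalyticAt ℂ Φ q) : HasAnalyticLiftAt L Eq f x :=
  fun p hp => ⟨Φ, hΦ p hp, Filter.Eventually.of_forall fun q y hy => hΦf q y hy⟩

lemma liftHolAt_comp (hf : HasAnalyticLiftAt L L' f x) {g : Y → ℂ}
    (hg : LiftHolAt L' g (f x)) : LiftHolAt L (g ∘ f) x := by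
  intro p hp
  obtain ⟨Φ, hΦ, hΦf⟩ := hf p hp
  obtain ⟨G, hG, hgG⟩ := hg (Φ p) (hΦf.self_of_nhds x hp)
  refine ⟨G ∘ Φ, hG.comp hΦ, ?_⟩
  filter_upwards [hΦf, hΦ.continuousAt.eventually hgG] with q hq hq' y hy
  exact hq' _ (hq y hy)

lemma continuousAt [TopologicalSpace X] [TopologicalSpace Y] (hL : IsLiftSystem L)
    (hL' : IsLiftSystem L') (hf : HasAnalyticLiftAt L L' f x) : ContinuousAt f x := by
  intro U hU
  rw [Filter.mem_map]
  obtain ⟨p, hp⟩ := hL.exists_lift x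
  obtain ⟨Φ, hΦ, hΦf⟩ := hf p hp
  have hΦU := hΦ.continuousAt.eventually (hL'.eventually_mem (hΦf.self_of_nhds x hp) hU)
  filter_upwards [hL.eventually_exists hp (hΦf.and hΦU)] with y ⟨q, hq, hy⟩
  exact hq.2 _ (hq.1 y hy)

end HasAnalyticLiftAt

/-- `σ` is an analytic choice of lifts of the points of `S` with coordinates `χ` near `t₀`. -/
def IsAnalyticSectionAt (L : E → X → Prop) (χ : X → V) (S : Set X) (σ : V → E) (t₀ : V) : Prop :=
  AnalyticAt ℂ σ t₀ ∧ ∀ᶠ t in 𝓝 t₀, ∃ y ∈ S, L (σ t) y ∧ χ y = t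

section Section

variable {L : E → X → Prop} {χ : X → V} {S : Set X}

lemma IsAnalyticSectionAt.isLift {σ : V → E} {x : X} (hσ : IsAnalyticSectionAt L χ S σ (χ x))
    (hinj : Set.InjOn χ S) (hx : x ∈ S) : L (σ (χ x)) x := by
  obtain ⟨y, hyS, hy, hyx⟩ := hσ.2.self_of_nhds
  exact hinj hyS hx hyx ▸ hy

lemma isOpen_image_of_section [TopologicalSpace X] (hL : IsLiftSystem L) (hinj : Set.InjOn χ S)
    (hσ : ∀ x ∈ S, ∃ σ, IsAnalyticSectionAt L χ S σ (χ x)) {U : Set X} (hUS : U ⊆ S)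
    (hU : IsOpen U) : IsOpen (χ '' U) := by
  rw [isOpen_iff_mem_nhds]
  rintro _ ⟨x, hx, rfl⟩
  obtain ⟨σ, hσx⟩ := hσ x (hUS hx)
  filter_upwards [hσx.2, hσx.1.continuousAt.eventually
    (hL.eventually_mem (hσx.isLift hinj (hUS hx)) (hU.mem_nhds hx))] with t ⟨y, _, hy, hyt⟩ ht
  exact ⟨y, ht y hy, hyt⟩

end Section

end Lifts

/-! ### Charts and manifolds -/

section Charts

lemma exists_openPartialHomeomorph {X Y : Type*} [TopologicalSpace X] [TopologicalSpace Y]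
    [Nonempty X] {f : X → Y} {S : Set X} (hS : IsOpen S) (hf : ContinuousOn f S)
    (hinj : Set.InjOn f S) (hopen : ∀ U ⊆ S, IsOpen U → IsOpen (f '' U)) :
    ∃ e : OpenPartialHomeomorph X Y, e.source = S ∧ (e : X → Y) = f := by
  refine ⟨OpenPartialHomeomorph.ofContinuousOpenRestrict hinj.toPartialEquiv hf ?_ hS, rfl, rfl⟩
  intro U hU
  have hfU := hopen (Subtype.val '' U) (Subtype.coe_image_subset S U)
    (hS.isOpenMap_subtype_val U hU)
  rwa [Set.image_image] at hfU

variable {X Y Z : Type} [TopologicalSpace X] [TopologicalSpace Y] [TopologicalSpace Z]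
  {HX : (X → ℂ) → X → Prop} {HY : (Y → ℂ) → Y → Prop} {HZ : (Z → ℂ) → Z → Prop}

lemma IsBiholomorphic.trans {e : OpenPartialHomeomorph X Y} {e' : OpenPartialHomeomorph Y Z}
    (he : IsBiholomorphic HX HY e) (he' : IsBiholomorphic HY HZ e') :
    IsBiholomorphic HX HZ (e.trans e') := by
  intro x hx g
  rw [OpenPartialHomeomorph.trans_source] at hx
  rw [OpenPartialHomeomorph.coe_trans, Function.comp_apply, he' _ hx.2, he _ hx.1]
  rfl

lemma IsBiholomorphic.symm (hX : DependsOnGerm HX) {e : OpenPartialHomeomorph X Y}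
    (he : IsBiholomorphic HX HY e) : IsBiholomorphic HY HX e.symm := by
  intro y hy g
  have hx : e.symm y ∈ e.source := e.map_target hy
  have hsymm : (g ∘ e.symm) ∘ e =ᶠ[𝓝 (e.symm y)] g := by
    filter_upwards [e.open_source.mem_nhds hx] with x hx
    simp only [Function.comp_apply, e.left_inv hx]
  have h := he _ hx (g ∘ e.symm)
  rw [e.right_inv hy] at h
  exact ⟨fun hg => h.2 (hX hsymm.symm hg), fun hg => hX hsymm (h.1 hg)⟩

lemma IsSmoothPoint.of_isBiholomorphic {n : ℕ} {e : OpenPartialHomeomorph X Y}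
    (he : IsBiholomorphic HX HY e) {x : X} (hx : x ∈ e.source) (h : IsSmoothPoint n HY (e x)) :
    IsSmoothPoint n HX x := by
  obtain ⟨f, hxf, hf⟩ := h
  exact ⟨e.trans f, by simp [hx, hxf], he.trans hf⟩

lemma isBiholomorphic_of_hasAnalyticLiftAt {E E' : Type*} [NormedAddCommGroup E]
    [NormedSpace ℂ E] [NormedAddCommGroup E'] [NormedSpace ℂ E'] {L : E → X → Prop}
    {L' : E' → Y → Prop} {e : X ≃ₜ Y} (he : ∀ x, HasAnalyticLiftAt L L' e x)
    (he' : ∀ y, HasAnalyticLiftAt L' L e.symm y) :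
    IsBiholomorphic (LiftHolAt L) (LiftHolAt L') e.toOpenPartialHomeomorph := by
  refine fun x _ g => ⟨(he x).liftHolAt_comp, fun hg => ?_⟩
  have h := (he' (e x)).liftHolAt_comp (g := g ∘ e) (by rwa [e.symm_apply_apply])
  rwa [Function.comp_assoc, e.self_comp_symm, Function.comp_id] at h

section Section

variable {E : Type*} {V : Type} [NormedAddCommGroup E] [NormedSpace ℂ E] [NormedAddCommGroup V]
  [NormedSpace ℂ V] {L : E → X → Prop} {χ : X → V} {S : Set X}

lemma exists_chart_of_section [Nonempty X] (hL : IsLiftSystem L) (hS : IsOpen S)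
    (hinj : Set.InjOn χ S) (hχ : ∀ x ∈ S, HasAnalyticLiftAt L Eq χ x)
    (hσ : ∀ x ∈ S, ∃ σ, IsAnalyticSectionAt L χ S σ (χ x)) :
    ∃ e : OpenPartialHomeomorph X V, e.source = S ∧ (e : X → V) = χ ∧
      IsBiholomorphic (LiftHolAt L) (AnalyticAt ℂ) e := by
  have hcont : ContinuousOn χ S := fun x hx =>
    ((hχ x hx).continuousAt hL IsLiftSystem.eq).continuousWithinAt
  obtain ⟨e, he, heχ⟩ := exists_openPartialHomeomorph hS hcont hinj
    fun U hUS hU => isOpen_image_of_section hL hinj hσ hUS hU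
  refine ⟨e, he, heχ, fun x hx g => ?_⟩
  rw [he] at hx
  rw [heχ]
  refine ⟨fun hg => (hχ x hx).liftHolAt_comp (liftHolAt_eq.2 hg), fun hg => ?_⟩
  obtain ⟨σ, hσx⟩ := hσ x hx
  obtain ⟨G, hG, hgG⟩ := hg (σ (χ x)) (hσx.isLift hinj hx)
  refine (hG.comp hσx.1).congr ?_
  filter_upwards [hσx.2, hσx.1.continuousAt.eventually hgG] with t ⟨y, _, hy, hyt⟩ ht
  rw [Function.comp_apply, ← ht y hy, Function.comp_apply, hyt]

end Section

section Manifold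

variable {n : ℕ} {e e' : OpenPartialHomeomorph X (EuclideanSpace ℂ (Fin n))}

lemma IsBiholomorphic.analyticAt_comp_symm (hX : DependsOnGerm HX)
    (he : IsBiholomorphic HX (AnalyticAt ℂ) e) (he' : IsBiholomorphic HX (AnalyticAt ℂ) e')
    {y : EuclideanSpace ℂ (Fin n)} (hy : y ∈ e.target) (hy' : e.symm y ∈ e'.source) :
    AnalyticAt ℂ (e' ∘ e.symm) y := by
  have hcoord : ∀ i, AnalyticAt ℂ (fun z => (e' (e.symm z)) i) y := by
    intro i
    have hproj : AnalyticAt ℂ (fun z : EuclideanSpace ℂ (Fin n) => z i) (e' (e.symm y)) :=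
      (EuclideanSpace.proj i : EuclideanSpace ℂ (Fin n) →L[ℂ] ℂ).analyticAt _
    exact (he.symm hX y hy _).1 ((he' _ hy' _).1 hproj)
  exact ((EuclideanSpace.equiv (Fin n) ℂ).symm.toContinuousLinearMap.analyticAt _).comp
    (AnalyticAt.pi hcoord)

/-- The charted space whose atlas consists of one chosen chart around each point. -/
abbrev chartedSpaceOfCharts {M : Type*} [TopologicalSpace M]
    (e : X → OpenPartialHomeomorph X M) (he : ∀ x, x ∈ (e x).source) : ChartedSpace M X where
  atlas := Set.range e
  chartAt := e
  mem_chart_source := he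
  chart_mem_atlas x := ⟨x, rfl⟩

lemma contMDiffAt_iff_analyticAt {M : Type*} [TopologicalSpace M]
    [ChartedSpace (EuclideanSpace ℂ (Fin n)) M] (g : M → ℂ) (x : M) :
    ContMDiffAt 𝓘(ℂ, EuclideanSpace ℂ (Fin n)) 𝓘(ℂ) ω g x ↔
      AnalyticAt ℂ (g ∘ (chartAt (EuclideanSpace ℂ (Fin n)) x).symm)
        (chartAt (EuclideanSpace ℂ (Fin n)) x x) := by
  set e := chartAt (EuclideanSpace ℂ (Fin n)) x
  have hx : x ∈ e.source := mem_chart_source _ x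
  have hcoord : ContDiffWithinAt ℂ ω (extChartAt 𝓘(ℂ) (g x) ∘ g ∘
      (extChartAt 𝓘(ℂ, EuclideanSpace ℂ (Fin n)) x).symm)
      (Set.range 𝓘(ℂ, EuclideanSpace ℂ (Fin n)))
      (extChartAt 𝓘(ℂ, EuclideanSpace ℂ (Fin n)) x x) ↔ AnalyticAt ℂ (g ∘ e.symm) (e x) := by
    simp only [extChartAt, modelWithCornersSelf_coe, Set.range_id, contDiffWithinAt_univ]
    exact ⟨fun h => h.analyticAt, fun h => h.contDiffAt⟩
  rw [contMDiffAt_iff, hcoord, and_iff_right_iff_imp]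
  intro hg
  have hcont : ContinuousAt ((g ∘ e.symm) ∘ e) x := hg.continuousAt.comp (e.continuousAt hx)
  refine hcont.congr ?_
  filter_upwards [e.open_source.mem_nhds hx] with y hy
  simp only [Function.comp_apply, e.left_inv hy]

lemma isComplexManifold_of_isSmoothPoint [T2Space X] [SecondCountableTopology X]
    (hX : DependsOnGerm HX) (h : ∀ x, IsSmoothPoint n HX x) : IsComplexManifold n HX := by
  refine ⟨inferInstance, inferInstance, ?_⟩
  choose e hxe he using h
  let := chartedSpaceOfCharts e hxe
  refine ⟨this, isManifold_of_contDiffOn _ _ _ ?_, fun g x => ?_⟩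
  · rintro _ _ ⟨a, rfl⟩ ⟨b, rfl⟩ y hy
    simp only [modelWithCornersSelf_coe, modelWithCornersSelf_coe_symm, Set.range_id,
      Set.inter_univ, Set.preimage_id, OpenPartialHomeomorph.trans_source,
      OpenPartialHomeomorph.symm_source] at hy
    exact ((he a).analyticAt_comp_symm hX (he b) hy.1 hy.2).contDiffAt.contDiffWithinAt
  · have hchart := (he x).symm hX (e x x) ((e x).map_source (hxe x)) g
    rw [(e x).left_inv (hxe x)] at hchart
    rw [hchart, contMDiffAt_iff_analyticAt]
    rfl

end Manifold

end Charts

/-! ### Homogeneous coordinates on the sphere -/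

lemma ne_zero_iff (v : Fin 2 → ℂ) : v ≠ 0 ↔ v 0 ≠ 0 ∨ v 1 ≠ 0 := by
  rw [Ne, funext_iff, Fin.forall_fin_two, not_and_or, Pi.zero_apply, Pi.zero_apply]

lemma isHom_proj {v : Fin 2 → ℂ} (hv : v ≠ 0) : IsHom v (proj v) := ⟨hv, rfl⟩

lemma isHom_hc (z : OnePoint ℂ) : IsHom (hc z) z := ⟨hc_ne_zero z, proj_hc z⟩

lemma proj_of_snd_eq_zero {v : Fin 2 → ℂ} (h : v 1 = 0) : proj v = OnePoint.infty := if_pos h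

lemma proj_of_snd_ne_zero {v : Fin 2 → ℂ} (h : v 1 ≠ 0) :
    proj v = ((v 0 / v 1 : ℂ) : OnePoint ℂ) := if_neg h

lemma proj_eq_iff {v w : Fin 2 → ℂ} (hv : v ≠ 0) (hw : w ≠ 0) :
    proj v = proj w ↔ wedge v w = 0 := by
  rw [ne_zero_iff] at hv hw
  unfold proj wedge
  split_ifs with h1 h2 h2
  · simp [h1, h2]
  · simp only [h1, ne_eq, not_true_eq_false, or_false] at hv
    simp [h1, h2, hv]
  · simp only [h2, ne_eq, not_true_eq_false, or_false] at hw
    simp [h1, h2, hw]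
  · rw [OnePoint.coe_eq_coe, div_eq_div_iff h1 h2, sub_eq_zero, mul_comm (v 1)]

lemma wedge_self (v : Fin 2 → ℂ) : wedge v v = 0 := by
  rw [wedge, mul_comm, sub_self]

lemma wedge_swap (v w : Fin 2 → ℂ) : wedge v w = -wedge w v := by
  unfold wedge; ring

lemma ne_zero_of_wedge {v w : Fin 2 → ℂ} (h : wedge v w ≠ 0) : v ≠ 0 ∧ w ≠ 0 := by
  constructor <;> rintro rfl <;> simp [wedge] at h

namespace IsHom

variable {v w : Fin 2 → ℂ} {x y : OnePoint ℂ}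

lemma exists_smul (h : IsHom v x) : ∃ a : ℂ, a ≠ 0 ∧ v = a • hc x := by
  obtain ⟨hv, rfl⟩ := h
  exact exists_smul_hc hv

lemma eq_iff_wedge (hv : IsHom v x) (hw : IsHom w y) : x = y ↔ wedge v w = 0 := by
  obtain ⟨hv, rfl⟩ := hv
  obtain ⟨hw, rfl⟩ := hw
  exact proj_eq_iff hv hw

lemma mulVec (g : GL (Fin 2) ℂ) (h : IsHom v x) : IsHom (g.1.mulVec v) (g • x) := by
  obtain ⟨hv, rfl⟩ := h
  exact ⟨mulVec_ne_zero g hv, (smul_proj g hv).symm⟩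

end IsHom

lemma continuousAt_proj_of_snd_ne_zero {v : Fin 2 → ℂ} (h : v 1 ≠ 0) : ContinuousAt proj v := by
  have hdiv : ContinuousAt (fun w : Fin 2 → ℂ => w 0 / w 1) v :=
    (continuous_apply 0).continuousAt.div (continuous_apply 1).continuousAt h
  refine (OnePoint.continuous_coe.continuousAt.comp hdiv).congr ?_
  filter_upwards [(continuous_apply 1).continuousAt.eventually_ne h] with w hw
  exact (proj_of_snd_ne_zero hw).symm

lemma continuousAt_proj_of_snd_eq_zero {v : Fin 2 → ℂ} (hv : v ≠ 0) (h : v 1 = 0) :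
    ContinuousAt proj v := by
  have h0 : v 0 ≠ 0 := ((ne_zero_iff v).1 hv).resolve_right (not_not.2 h)
  rw [ContinuousAt, proj_of_snd_eq_zero h, OnePoint.hasBasis_nhds_infty.tendsto_right_iff]
  rintro s ⟨-, hs⟩
  obtain ⟨R, hR⟩ := hs.isBounded.exists_norm_le
  have hlarge : ∀ᶠ w : Fin 2 → ℂ in 𝓝 v, R * ‖w 1‖ < ‖w 0‖ := by
    refine ContinuousAt.eventually_lt
      (continuous_const.mul (continuous_apply 1).norm).continuousAt
      (continuous_apply 0).norm.continuousAt ?_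
    simpa [h] using h0
  filter_upwards [hlarge] with w hw
  by_cases hw1 : w 1 = 0
  · exact Or.inr (proj_of_snd_eq_zero hw1)
  · refine Or.inl ⟨w 0 / w 1, fun hmem => ?_, (proj_of_snd_ne_zero hw1).symm⟩
    have hle := hR _ hmem
    rw [norm_div, div_le_iff₀ (norm_pos_iff.2 hw1)] at hle
    exact hle.not_gt hw

lemma continuousAt_proj {v : Fin 2 → ℂ} (hv : v ≠ 0) : ContinuousAt proj v := by
  by_cases h : v 1 = 0
  · exact continuousAt_proj_of_snd_eq_zero hv h
  · exact continuousAt_proj_of_snd_ne_zero h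

lemma exists_section_coe {v : Fin 2 → ℂ} (h : v 1 ≠ 0) :
    ∃ q : OnePoint ℂ → Fin 2 → ℂ, ContinuousAt q (proj v) ∧ q (proj v) = v ∧
      ∀ᶠ z in 𝓝 (proj v), IsHom (q z) z := by
  rw [proj_of_snd_ne_zero h]
  refine ⟨fun z => z.elim v fun t => ![t * v 1, v 1], ?_, ?_, ?_⟩
  · rw [OnePoint.continuousAt_coe]
    change ContinuousAt (fun t : ℂ => ![t * v 1, v 1]) (v 0 / v 1)
    fun_prop
  · ext i; fin_cases i <;> simp [h]
  · rw [OnePoint.nhds_coe_eq, Filter.eventually_map]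
    refine Filter.Eventually.of_forall fun t => ⟨(ne_zero_iff _).2 (Or.inr (by simpa using h)), ?_⟩
    change proj ![t * v 1, v 1] = t
    rw [proj_of_snd_ne_zero (by simpa using h)]
    simp [h]

lemma exists_section_infty {v : Fin 2 → ℂ} (h0 : v 0 ≠ 0) (h1 : v 1 = 0) :
    ∃ q : OnePoint ℂ → Fin 2 → ℂ, ContinuousAt q OnePoint.infty ∧
      q OnePoint.infty = v ∧ ∀ᶠ z in 𝓝 OnePoint.infty, IsHom (q z) z := by
  refine ⟨fun z => z.elim v fun t => ![v 0, v 0 * t⁻¹], ?_, rfl, ?_⟩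
  · rw [OnePoint.continuousAt_infty', Filter.coclosedCompact_eq_cocompact,
      ← Metric.cobounded_eq_cocompact]
    have hlim : Filter.Tendsto (fun t : ℂ => ![v 0, v 0 * t⁻¹]) (Bornology.cobounded ℂ) (𝓝 v) := by
      rw [tendsto_pi_nhds, Fin.forall_fin_two, h1]
      refine ⟨tendsto_const_nhds, ?_⟩
      simpa using Filter.tendsto_inv₀_cobounded.const_mul (v 0)
    exact hlim
  · filter_upwards [eventually_ne_nhds (OnePoint.infty_ne_coe (0 : ℂ))] with z hz
    induction z using OnePoint.rec with
    | infty => exact ⟨(ne_zero_iff v).2 (Or.inl h0), proj_of_snd_eq_zero h1⟩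
    | coe t =>
      have ht : t ≠ 0 := fun h => hz (by rw [h])
      refine ⟨(ne_zero_iff _).2 (Or.inl (by simpa using h0)), ?_⟩
      change proj ![v 0, v 0 * t⁻¹] = t
      rw [proj_of_snd_ne_zero (by simp [h0, ht]), OnePoint.coe_eq_coe]
      simp [field]

lemma isLiftSystem_isHom : IsLiftSystem IsHom where
  exists_lift z := ⟨_, isHom_hc z⟩
  eventually_mem := by
    rintro v _ ⟨hv, rfl⟩ U hU
    filter_upwards [continuousAt_proj hv hU] with w hw
    rintro _ ⟨-, rfl⟩
    exact hw
  eventually_exists := by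
    rintro v _ ⟨hv, rfl⟩ W hW
    have hsection : ∃ q : OnePoint ℂ → Fin 2 → ℂ, ContinuousAt q (proj v) ∧ q (proj v) = v ∧
        ∀ᶠ z in 𝓝 (proj v), IsHom (q z) z := by
      by_cases h1 : v 1 = 0
      · rw [proj_of_snd_eq_zero h1]
        exact exists_section_infty (((ne_zero_iff v).1 hv).resolve_right (not_not.2 h1)) h1
      · exact exists_section_coe h1
    obtain ⟨q, hq, hqv, hqz⟩ := hsection
    filter_upwards [hq (hqv.symm ▸ hW), hqz] with z hzW hz
    exact ⟨q z, hzW, hz⟩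

/-! ### Resultant and Jacobian -/

/-- The minors of the coefficient matrix, in terms of which the resultant and the Jacobian of the
two quadratic forms are expressed. -/
def minor (c : Coef) (i j : Fin 3) : ℂ := c 0 i * c 1 j - c 0 j * c 1 i

/-- The resultant of the two quadratic forms with coefficients `c`. -/
def res (c : Coef) : ℂ := minor c 0 2 ^ 2 - minor c 0 1 * minor c 1 2

/-- The Jacobian determinant of `quadForm c`. -/
def jac (c : Coef) (v : Fin 2 → ℂ) : ℂ :=
  2 * minor c 0 1 * v 0 ^ 2 + 4 * minor c 0 2 * (v 0 * v 1) + 2 * minor c 1 2 * v 1 ^ 2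

lemma det_fderiv_eq_jac (c : Coef) (v : Fin 2 → ℂ) :
    (fderiv ℂ (quadForm c) v).det = jac c v := by
  rw [det_fderiv_quadForm, jac, minor, minor, minor]; ring

lemma continuous_res : Continuous res := by unfold res minor; fun_prop

lemma quadForm_smul_coef (k : ℂ) (c : Coef) (v : Fin 2 → ℂ) :
    quadForm (k • c) v = k • quadForm c v := by
  ext i; simp [quadForm]; ring

lemma jac_smul_coef (k : ℂ) (c : Coef) (v : Fin 2 → ℂ) : jac (k • c) v = k ^ 2 * jac c v := by
  simp only [jac, minor, Pi.smul_apply, smul_eq_mul]; ring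

lemma jac_smul (c : Coef) (k : ℂ) (v : Fin 2 → ℂ) : jac c (k • v) = k ^ 2 * jac c v := by
  simp only [jac, Pi.smul_apply, smul_eq_mul]; ring

/-- A binary quadratic form is a product `wedge v r * wedge v s` of linear forms, here in terms of
its coefficients. -/
lemma exists_linear_factors (q : Fin 3 → ℂ) : ∃ r s : Fin 2 → ℂ,
    q 0 = r 1 * s 1 ∧ q 1 = -(r 1 * s 0 + r 0 * s 1) ∧ q 2 = r 0 * s 0 := by
  by_cases h : q 0 = 0
  · exact ⟨![-1, 0], ![-q 2, q 1], by simp [h], by simp, by simp⟩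
  · obtain ⟨d, hd⟩ :=
      IsAlgClosed.exists_pow_nat_eq (q 1 ^ 2 - 4 * q 0 * q 2) (Nat.zero_lt_two)
    refine ⟨![(-q 1 + d) / (2 * q 0), 1], ![(-q 1 - d) / 2, q 0], by simp, ?_, ?_⟩
    · simp only [Matrix.cons_val_zero, Matrix.cons_val_one]
      field_simp
      ring
    · simp only [Matrix.cons_val_zero]
      field_simp
      linear_combination hd

lemma exists_quadForm_apply_eq_zero (c : Coef) (i : Fin 2) : ∃ v, v ≠ 0 ∧ quadForm c v i = 0 := by
  obtain ⟨r, s, h0, h1, h2⟩ := exists_linear_factors (c i)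
  by_cases hr : r = 0
  · exact ⟨![1, 0], (ne_zero_iff _).2 (by simp), by simp [quadForm, h0, hr]⟩
  · exact ⟨r, hr, by rw [quadForm, h0, h1, h2]; ring⟩

/-- The resultant is the product of the values of the second form at the zeros of the first. -/
lemma Nondeg.res_ne_zero {c : Coef} (hc : Nondeg c) : res c ≠ 0 := by
  intro hres
  have hcommon : ∀ v, v ≠ 0 → quadForm c v 0 = 0 → quadForm c v 1 = 0 → False :=
    fun v hv h0 h1 => hc v hv (funext (Fin.forall_fin_two.2 ⟨h0, h1⟩))
  obtain ⟨r, s, h0, h1, h2⟩ := exists_linear_factors (c 0)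
  have hfirst : ∃ v, v ≠ 0 ∧ quadForm c v 1 = 0 := exists_quadForm_apply_eq_zero c 1
  have hzero : ∀ v, c 0 0 = 0 → c 0 1 = 0 → c 0 2 = 0 → quadForm c v 0 = 0 := by
    intro v h0 h1 h2
    simp [quadForm, h0, h1, h2]
  obtain ⟨v, hv, hv1⟩ := hfirst
  by_cases hr : r = 0
  · exact hcommon v hv (hzero v (by simp [h0, hr]) (by simp [h1, hr]) (by simp [h2, hr])) hv1
  by_cases hs : s = 0
  · exact hcommon v hv (hzero v (by simp [h0, hs]) (by simp [h1, hs]) (by simp [h2, hs])) hv1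
  have hprod : quadForm c r 1 * quadForm c s 1 = 0 := by
    rw [← hres, res, minor, minor, minor, h0, h1, h2, quadForm, quadForm]
    ring
  rcases mul_eq_zero.1 hprod with h | h
  · exact hcommon r hr (by rw [quadForm, h0, h1, h2]; ring) h
  · exact hcommon s hs (by rw [quadForm, h0, h1, h2]; ring) h

lemma res_mul_fst_pow (c : Coef) (v : Fin 2 → ℂ) : res c * v 0 ^ 3 =
    ((minor c 0 2 * c 1 2 - minor c 1 2 * c 1 1) * v 0 - minor c 1 2 * c 1 2 * v 1) *
        quadForm c v 0 +
      ((minor c 1 2 * c 0 1 - minor c 0 2 * c 0 2) * v 0 + minor c 1 2 * c 0 2 * v 1) *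
        quadForm c v 1 := by
  simp only [res, minor, quadForm]
  ring

lemma res_mul_snd_pow (c : Coef) (v : Fin 2 → ℂ) : res c * v 1 ^ 3 =
    ((minor c 0 1 * c 1 1 - minor c 0 2 * c 1 0) * v 1 + minor c 0 1 * c 1 0 * v 0) *
        quadForm c v 0 +
      ((minor c 0 2 * c 0 0 - minor c 0 1 * c 0 1) * v 1 - minor c 0 1 * c 0 0 * v 0) *
        quadForm c v 1 := by
  simp only [res, minor, quadForm]
  ring

lemma nondeg_iff (c : Coef) : Nondeg c ↔ res c ≠ 0 := by
  refine ⟨Nondeg.res_ne_zero, fun h v hv hF => ?_⟩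
  have hv0 := res_mul_fst_pow c v
  have hv1 := res_mul_snd_pow c v
  simp only [hF, Pi.zero_apply, mul_zero, add_zero] at hv0 hv1
  rcases (ne_zero_iff v).1 hv with hne | hne
  · exact mul_ne_zero h (pow_ne_zero 3 hne) hv0
  · exact mul_ne_zero h (pow_ne_zero 3 hne) hv1

/-! ### Coefficients of a quadratic rational map -/

/-- The Sylvester matrix of the two quadratic forms, acting on the linear forms with which they are
multiplied. -/
def sylvester (c : Coef) : Matrix (Fin 4) (Fin 4) ℂ :=
  !![-c 1 0, 0, c 0 0, 0;
     -c 1 1, -c 1 0, c 0 1, c 0 0;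
     -c 1 2, -c 1 1, c 0 2, c 0 1;
     0, -c 1 2, 0, c 0 2]

lemma det_sylvester (c : Coef) : (sylvester c).det = res c := by
  simp [sylvester, Matrix.det_succ_row_zero, Fin.sum_univ_succ, Fin.succAbove, res, minor]
  ring

lemma sylvester_mulVec_eq_zero {c d : Coef} (h0 : d 0 0 = 0) (h1 : d 1 0 = 0)
    (h : ∀ v, wedge (quadForm c v) (quadForm d v) = 0) :
    (sylvester c).mulVec ![d 0 1, d 0 2, d 1 1, d 1 2] = 0 := by
  have e1 := h ![1, 1]
  have e2 := h ![1, -1]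
  have e3 := h ![1, 2]
  have e4 := h ![0, 1]
  simp only [wedge, quadForm, h0, h1, Matrix.cons_val_zero, Matrix.cons_val_one] at e1 e2 e3 e4
  ext i
  fin_cases i <;>
    simp only [sylvester, Matrix.mulVec, dotProduct, Fin.sum_univ_succ, Fin.zero_eta, Fin.mk_one,
      Fin.reduceFinMk, Fin.succ_zero_eq_one, Fin.succ_one_eq_two, Fin.reduceSucc,
      Matrix.of_apply, Matrix.cons_val, Finset.univ_eq_empty, Finset.sum_empty, Pi.zero_apply]
  · linear_combination 2 * e4 + e1 - (1 / 6 : ℂ) * e3 - (1 / 3) * e2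
  · linear_combination (1 / 2 : ℂ) * e1 + (1 / 2) * e2 - e4
  · linear_combination -2 * e4 - (1 / 2 : ℂ) * e1 + (1 / 6 : ℂ) * e3 - (1 / 6 : ℂ) * e2
  · linear_combination e4

lemma eq_zero_of_wedge_quadForm_eq_zero {c d : Coef} (hc : Nondeg c) (h0 : d 0 0 = 0)
    (h1 : d 1 0 = 0) (h : ∀ v, wedge (quadForm c v) (quadForm d v) = 0) : d = 0 := by
  have hdet : (sylvester c).det ≠ 0 := by rw [det_sylvester]; exact hc.res_ne_zero
  have hd := Matrix.eq_zero_of_mulVec_eq_zero hdet (sylvester_mulVec_eq_zero h0 h1 h)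
  have h01 : d 0 1 = 0 := congrFun hd 0
  have h02 : d 0 2 = 0 := congrFun hd 1
  have h11 : d 1 1 = 0 := congrFun hd 2
  have h12 : d 1 2 = 0 := congrFun hd 3
  ext i j
  fin_cases i <;> fin_cases j <;> assumption

lemma exists_eq_smul_of_wedge_eq_zero {v w : Fin 2 → ℂ} (hv : v ≠ 0) (h : wedge v w = 0) :
    ∃ k : ℂ, w = k • v := by
  rw [wedge] at h
  rcases (ne_zero_iff v).1 hv with h0 | h0
  · refine ⟨w 0 / v 0, funext (Fin.forall_fin_two.2 ⟨by simp [h0], ?_⟩)⟩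
    simp only [Pi.smul_apply, smul_eq_mul]
    field_simp
    linear_combination h
  · refine ⟨w 1 / v 1, funext (Fin.forall_fin_two.2 ⟨?_, by simp [h0]⟩)⟩
    simp only [Pi.smul_apply, smul_eq_mul]
    field_simp
    linear_combination -h

namespace Represents

variable {c d : Coef} {f : OnePoint ℂ → OnePoint ℂ}

lemma smul (h : Represents c f) {k : ℂ} (hk : k ≠ 0) : Represents (k • c) f := by
  refine ⟨fun v hv => ?_, ?_⟩
  · rw [quadForm_smul_coef]
    exact smul_ne_zero hk (h.1 v hv)
  · rw [← h.2]
    funext z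
    rw [ratMap, quadForm_smul_coef, proj_smul hk, ratMap]

lemma wedge_quadForm_eq_zero (hc : Represents c f) (hd : Represents d f) (v : Fin 2 → ℂ) :
    wedge (quadForm c v) (quadForm d v) = 0 := by
  by_cases hv : v = 0
  · simp [hv, quadForm, wedge]
  · rw [← proj_eq_iff (hc.1 v hv) (hd.1 v hv), ← ratMap_proj c hv, ← ratMap_proj d hv, hc.2, hd.2]

lemma exists_smul (hc : Represents c f) (hd : Represents d f) : ∃ k : ℂ, k ≠ 0 ∧ d = k • c := by
  have h10 : (![1, 0] : Fin 2 → ℂ) ≠ 0 := (ne_zero_iff _).2 (by simp)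
  obtain ⟨k, hk⟩ := exists_eq_smul_of_wedge_eq_zero (hc.1 _ h10)
    (hc.wedge_quadForm_eq_zero hd ![1, 0])
  have hdk : d - k • c = 0 := by
    refine eq_zero_of_wedge_quadForm_eq_zero hc.1 ?_ ?_ fun v => ?_
    · simpa [quadForm, sub_eq_zero] using congrFun hk 0
    · simpa [quadForm, sub_eq_zero] using congrFun hk 1
    · have hw := hc.wedge_quadForm_eq_zero hd v
      simp only [wedge, quadForm, Pi.sub_apply, Pi.smul_apply, smul_eq_mul] at hw ⊢
      linear_combination hw
  rw [sub_eq_zero] at hdk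
  refine ⟨k, fun h => hd.1 _ h10 ?_, hdk⟩
  rw [hdk, h, quadForm_smul_coef, zero_smul]

end Represents

/-! ### The space of quadratic rational maps -/

lemma isOpenMap_ofCoef : IsOpenMap Rat2.ofCoef := by
  intro U hU
  let scale (k : {k : ℂ // k ≠ 0}) (c : {c : Coef // Nondeg c}) : {c : Coef // Nondeg c} :=
    ⟨k.1 • c.1, (Represents.smul ⟨c.2, rfl⟩ k.2).1⟩
  have hscale : ∀ k, Continuous (scale k) := fun k =>
    (continuous_subtype_val.const_smul k.1).subtype_mk _
  have hsat : Rat2.ofCoef ⁻¹' (Rat2.ofCoef '' U) = ⋃ k, scale k ⁻¹' U := by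
    ext c
    simp only [Set.mem_preimage, Set.mem_image, Set.mem_iUnion]
    constructor
    · rintro ⟨d, hd, h⟩
      obtain ⟨k, hk, hdk⟩ := Represents.exists_smul (c := c.1) (d := d.1) ⟨c.2, rfl⟩
        ⟨d.2, congrArg Subtype.val h⟩
      refine ⟨⟨k, hk⟩, ?_⟩
      rwa [← (Subtype.ext hdk : d = scale ⟨k, hk⟩ c)]
    · rintro ⟨k, hk⟩
      exact ⟨_, hk, Subtype.ext (Represents.smul ⟨c.2, rfl⟩ k.2).2⟩
  change IsOpen (Rat2.ofCoef ⁻¹' (Rat2.ofCoef '' U))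
  rw [hsat]
  exact isOpen_iUnion fun k => hU.preimage (hscale k)

lemma isOpenQuotientMap_ofCoef : IsOpenQuotientMap Rat2.ofCoef where
  surjective := by
    rintro ⟨f, c, hf⟩
    exact ⟨⟨c, hf.1⟩, Subtype.ext hf.2⟩
  continuous := continuous_coinduced_rng
  isOpenMap := isOpenMap_ofCoef

lemma continuous_eval (z : OnePoint ℂ) : Continuous fun f : Rat2 => f.1 z := by
  refine continuous_coinduced_dom.2 (continuous_iff_continuousAt.2 fun c => ?_)
  have hval : Continuous fun c : {c : Coef // Nondeg c} => quadForm c.1 (hc z) := by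
    have hcoef : ∀ i j, Continuous fun c : {c : Coef // Nondeg c} => c.1 i j := fun i j =>
      (continuous_apply_apply i j).comp continuous_subtype_val
    exact continuous_pi fun i => (((hcoef i 0).mul continuous_const).add
      ((hcoef i 1).mul continuous_const)).add ((hcoef i 2).mul continuous_const)
  exact ContinuousAt.comp (f := fun c : {c : Coef // Nondeg c} => quadForm c.1 (hc z)) (g := proj)
    (continuousAt_proj (c.2 _ (hc_ne_zero z))) hval.continuousAt

instance : T2Space Rat2 :=
  T2Space.of_injective_continuous (f := fun f : Rat2 => f.1) Subtype.val_injective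
    (continuous_pi continuous_eval)

lemma isLiftSystem_rat2 : IsLiftSystem (fun (c : Coef) (f : Rat2) => Represents c f.1) := by
  have hrel : (fun (c : Coef) (f : Rat2) => Represents c f.1) =
      fun c f => ∃ x : {c // Nondeg c}, c = x.1 ∧ Rat2.ofCoef x = f := by
    funext c f
    refine propext ⟨fun h => ⟨⟨c, h.1⟩, rfl, Subtype.ext h.2⟩, ?_⟩
    rintro ⟨x, rfl, rfl⟩
    exact ⟨x.2, rfl⟩
  rw [hrel]
  exact (IsLiftSystem.eq.subtype Nondeg).quotient isOpenQuotientMap_ofCoef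

lemma isLiftSystem_fm : IsLiftSystem Rat2fm.IsLift :=
  (isLiftSystem_rat2.prod isLiftSystem_isHom.pi).subtype _

lemma isLiftSystem_tm : IsLiftSystem Rat2tm.IsLift :=
  (isLiftSystem_rat2.prod (isLiftSystem_isHom.pi.prod isLiftSystem_isHom.pi)).subtype _

/-! ### Markings in terms of lifts -/

/-- The fixed points of `quadForm c` are the lines spanned by the `w i`, with multiplicity: the
version of `IsFixedMarking` for homogeneous coordinates. -/
def FixedBy (c : Coef) (w : Fin 3 → Fin 2 → ℂ) : Prop :=
  ∃ k : ℂ, k ≠ 0 ∧ ∀ v, wedge v (quadForm c v) = k * ∏ i, wedge v (w i)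

/-- The symmetric bilinear form with `jacPolar c v v = 2 * jac c v`. -/
def jacPolar (c : Coef) (u v : Fin 2 → ℂ) : ℂ :=
  4 * (minor c 0 1 * (u 0 * v 0) + minor c 0 2 * (u 0 * v 1 + u 1 * v 0) +
    minor c 1 2 * (u 1 * v 1))

lemma jacPolar_sq (c : Coef) (u v : Fin 2 → ℂ) :
    jacPolar c u v ^ 2 = 16 * res c * wedge u v ^ 2 + 4 * jac c u * jac c v := by
  simp only [jacPolar, res, wedge, jac]; ring

lemma jac_mul_wedge_sq (c : Coef) (u u' v : Fin 2 → ℂ) :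
    jac c v * wedge u u' ^ 2 = jac c u * wedge v u' ^ 2 + jac c u' * wedge v u ^ 2 -
      jacPolar c u u' * (wedge v u * wedge v u') := by
  simp only [jacPolar, wedge, jac]; ring

lemma jac_eq_zero_iff {c : Coef} (hres : res c ≠ 0) {u : Fin 2 → Fin 2 → ℂ}
    (hu : wedge (u 0) (u 1) ≠ 0) (h : ∀ j, jac c (u j) = 0) (v : Fin 2 → ℂ) :
    jac c v = 0 ↔ wedge v (u 0) = 0 ∨ wedge v (u 1) = 0 := by
  have hpolar : jacPolar c (u 0) (u 1) ≠ 0 := by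
    have hsq := jacPolar_sq c (u 0) (u 1)
    rw [h 0, h 1, mul_zero, add_zero] at hsq
    rw [← sq_eq_zero_iff.ne, hsq]
    exact mul_ne_zero (mul_ne_zero (by norm_num) hres) (pow_ne_zero 2 hu)
  have hjac := jac_mul_wedge_sq c (u 0) (u 1) v
  rw [h 0, h 1, zero_mul, zero_mul, zero_add, zero_sub] at hjac
  rw [← mul_eq_zero, ← mul_eq_zero_iff_right (pow_ne_zero 2 hu), hjac, neg_eq_zero,
    mul_eq_zero_iff_left hpolar]

lemma exists_critical {c : Coef} (hres : res c ≠ 0) :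
    ∃ u : Fin 2 → Fin 2 → ℂ, wedge (u 0) (u 1) ≠ 0 ∧ ∀ j, jac c (u j) = 0 := by
  obtain ⟨r, s, h0, h1, h2⟩ :=
    exists_linear_factors ![2 * minor c 0 1, 4 * minor c 0 2, 2 * minor c 1 2]
  simp only [Matrix.cons_val] at h0 h1 h2
  refine ⟨![r, s], fun hw => hres ?_, Fin.forall_fin_two.2 ⟨?_, ?_⟩⟩
  · have hdisc : 16 * res c = 0 :=
      calc 16 * res c
          = (4 * minor c 0 2) ^ 2 - 4 * (2 * minor c 0 1) * (2 * minor c 1 2) := by rw [res]; ring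
        _ = wedge r s ^ 2 := by rw [h0, h1, h2, wedge]; ring
        _ = 0 := by rw [show wedge r s = 0 from hw, zero_pow two_ne_zero]
    exact (mul_eq_zero.1 hdisc).resolve_left (by norm_num)
  · rw [jac, h0, h1, h2]
    change r 1 * s 1 * r 0 ^ 2 + _ * (r 0 * r 1) + _ * r 1 ^ 2 = 0
    ring
  · rw [jac, h0, h1, h2]
    change r 1 * s 1 * s 0 ^ 2 + _ * (s 0 * s 1) + _ * s 1 ^ 2 = 0
    ring

section Markings

variable {c : Coef} {f : OnePoint ℂ → OnePoint ℂ}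

lemma isFixedMarking_iff {z : Fin 3 → OnePoint ℂ} {w : Fin 3 → Fin 2 → ℂ} (hf : Represents c f)
    (hw : ∀ i, IsHom (w i) (z i)) : IsFixedMarking f z ↔ FixedBy c w := by
  choose a ha haw using fun i => (hw i).exists_smul
  have hprod : ∀ v, ∏ i, wedge v (w i) = (∏ i, a i) * ∏ i, wedge v (hc (z i)) := by
    intro v
    simp only [haw, wedge_smul_right, Finset.prod_mul_distrib]
  have hA : ∏ i, a i ≠ 0 := Finset.prod_ne_zero_iff.2 fun i _ => ha i
  constructor
  · rintro ⟨d, hd, k, hk, h⟩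
    obtain ⟨l, hl, rfl⟩ := hd.exists_smul hf
    refine ⟨l * k * (∏ i, a i)⁻¹, mul_ne_zero (mul_ne_zero hl hk) (inv_ne_zero hA), fun v => ?_⟩
    rw [quadForm_smul_coef, wedge_smul_right, h, hprod]
    field_simp
  · rintro ⟨k, hk, h⟩
    refine ⟨c, hf, k * ∏ i, a i, mul_ne_zero hk hA, fun v => ?_⟩
    rw [h, hprod, mul_assoc]

lemma isCritical_iff {p : OnePoint ℂ} {u : Fin 2 → ℂ} (hf : Represents c f) (hu : IsHom u p) :
    IsCritical f p ↔ jac c u = 0 := by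
  obtain ⟨a, ha, rfl⟩ := hu.exists_smul
  rw [jac_smul, mul_eq_zero, or_iff_right (pow_ne_zero 2 ha)]
  constructor
  · rintro ⟨d, hd, h⟩
    obtain ⟨l, -, rfl⟩ := hd.exists_smul hf
    rw [jac_smul_coef, ← det_fderiv_eq_jac, h, mul_zero]
  · intro h
    exact ⟨c, hf, by rw [det_fderiv_eq_jac, h]⟩

lemma isCriticalMarking_iff {m : Fin 2 → OnePoint ℂ} {u : Fin 2 → Fin 2 → ℂ}
    (hf : Represents c f) (hu : ∀ j, IsHom (u j) (m j)) :
    IsCriticalMarking f m ↔ wedge (u 0) (u 1) ≠ 0 ∧ ∀ j, jac c (u j) = 0 := by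
  rw [IsCriticalMarking, Ne, (hu 0).eq_iff_wedge (hu 1)]
  refine and_congr_right fun hw => ?_
  constructor
  · intro h
    simp only [← isCritical_iff hf (hu _), h, Fin.forall_fin_two, true_or, or_true, and_self]
  · intro h p
    rw [isCritical_iff hf (isHom_hc p), jac_eq_zero_iff ((nondeg_iff c).1 hf.1) hw h,
      (isHom_hc p).eq_iff_wedge (hu 0), (isHom_hc p).eq_iff_wedge (hu 1)]

end Markings

lemma Rat2fm.exists_isLift {c : Coef} {w : Fin 3 → Fin 2 → ℂ} (hres : res c ≠ 0)
    (hw : ∀ i, w i ≠ 0) (h : FixedBy c w) : ∃ x, Rat2fm.IsLift (c, w) x := by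
  have hr : Represents c (ratMap c) := ⟨(nondeg_iff c).2 hres, rfl⟩
  exact ⟨⟨(⟨ratMap c, c, hr⟩, fun i => proj (w i)),
    (isFixedMarking_iff hr fun i => isHom_proj (hw i)).2 h⟩, hr, fun i => isHom_proj (hw i)⟩

namespace Rat2fm.IsLift

variable {p : Coef × (Fin 3 → Fin 2 → ℂ)} {x y : Rat2fm}

lemma fixedBy (h : Rat2fm.IsLift p x) : FixedBy p.1 p.2 :=
  (isFixedMarking_iff h.1 h.2).1 x.2

lemma eq (hx : Rat2fm.IsLift p x) (hy : Rat2fm.IsLift p y) : x = y := by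
  refine Subtype.ext (Prod.ext (Subtype.ext ?_) (funext fun i => ?_))
  · rw [← hx.1.2, ← hy.1.2]
  · rw [← (hx.2 i).2, ← (hy.2 i).2]

lemma exists_tm (h : Rat2fm.IsLift p x) {u : Fin 2 → Fin 2 → ℂ} (hu : wedge (u 0) (u 1) ≠ 0)
    (hj : ∀ j, jac p.1 (u j) = 0) : ∃ y, Rat2tm.IsLift (p.1, p.2, u) y ∧ forget y = x := by
  have hu0 : ∀ j, u j ≠ 0 := Fin.forall_fin_two.2 (ne_zero_of_wedge hu)
  exact ⟨⟨(x.1.1, x.1.2, fun j => proj (u j)), x.2,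
    (isCriticalMarking_iff h.1 fun j => isHom_proj (hu0 j)).2 ⟨hu, hj⟩⟩,
    ⟨h.1, h.2, fun j => isHom_proj (hu0 j)⟩, rfl⟩

end Rat2fm.IsLift

namespace Rat2tm.IsLift

variable {p : Coef × (Fin 3 → Fin 2 → ℂ) × (Fin 2 → Fin 2 → ℂ)} {x y : Rat2tm}

lemma forget (h : Rat2tm.IsLift p x) : Rat2fm.IsLift (p.1, p.2.1) (forget x) :=
  ⟨h.1, h.2.1⟩

lemma critical (h : Rat2tm.IsLift p x) :
    wedge (p.2.2 0) (p.2.2 1) ≠ 0 ∧ ∀ j, jac p.1 (p.2.2 j) = 0 :=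
  (isCriticalMarking_iff h.1 h.2.2).1 x.2.2

lemma eq (hx : Rat2tm.IsLift p x) (hy : Rat2tm.IsLift p y) : x = y := by
  refine Subtype.ext (Prod.ext (Subtype.ext ?_) (Prod.ext (funext fun i => ?_)
    (funext fun j => ?_)))
  · rw [← hx.1.2, ← hy.1.2]
  · rw [← (hx.2.1 i).2, ← (hy.2.1 i).2]
  · rw [← (hx.2.2 j).2, ← (hy.2.2 j).2]

end Rat2tm.IsLift

lemma surjective_forget : Function.Surjective forget := by
  intro y
  obtain ⟨p, h⟩ := isLiftSystem_fm.exists_lift y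
  obtain ⟨u, hu, hj⟩ := exists_critical h.1.1.res_ne_zero
  obtain ⟨x, -, hx⟩ := h.exists_tm hu hj
  exact ⟨x, hx⟩

/-! ### The action of Möbius transformations -/

/-- The Möbius transformation given by an invertible matrix. -/
def mobius (g : GL (Fin 2) ℂ) : Rat1 := ⟨MulAction.toPermHom (GL (Fin 2) ℂ) (OnePoint ℂ) g, g, rfl⟩

lemma surjective_mobius : Function.Surjective mobius := by
  rintro ⟨_, A, rfl⟩
  exact ⟨A, rfl⟩

lemma Rat2fm.IsLift.mobius (g : GL (Fin 2) ℂ) {p : Coef × (Fin 3 → Fin 2 → ℂ)} {x : Rat2fm}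
    (h : Rat2fm.IsLift p x) :
    Rat2fm.IsLift (conjCoef g.1 (g⁻¹).1 p.1, fun i => g.1.mulVec (p.2 i)) (mobius g • x) :=
  ⟨represents_conj g h.1, fun i => (h.2 i).mulVec g⟩

lemma Rat2tm.IsLift.mobius (g : GL (Fin 2) ℂ)
    {p : Coef × (Fin 3 → Fin 2 → ℂ) × (Fin 2 → Fin 2 → ℂ)} {x : Rat2tm}
    (h : Rat2tm.IsLift p x) :
    Rat2tm.IsLift (conjCoef g.1 (g⁻¹).1 p.1, fun i => g.1.mulVec (p.2.1 i),
      fun j => g.1.mulVec (p.2.2 j)) (mobius g • x) :=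
  ⟨represents_conj g h.1, fun i => (h.2.1 i).mulVec g, fun j => (h.2.2 j).mulVec g⟩

lemma analyticAt_of_contDiff {E F : Type*} [NormedAddCommGroup E] [NormedSpace ℂ E]
    [NormedAddCommGroup F] [NormedSpace ℂ F] {f : E → F} (h : ContDiff ℂ ω f) (x : E) :
    AnalyticAt ℂ f x :=
  h.contDiffAt.analyticAt

lemma contDiff_mulVec (A : Matrix (Fin 2) (Fin 2) ℂ) :
    ContDiff ℂ ω (fun v : Fin 2 → ℂ => A.mulVec v) :=
  (Matrix.mulVecLin A).toContinuousLinearMap.contDiff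

lemma contDiff_conjCoef (A B : Matrix (Fin 2) (Fin 2) ℂ) : ContDiff ℂ ω (conjCoef A B) := by
  refine contDiff_pi.2 fun i => contDiff_pi.2 fun j => ?_
  fin_cases j <;>
    simp only [conjCoef, Fin.sum_univ_two, Fin.zero_eta, Fin.mk_one, Fin.reduceFinMk,
      Matrix.cons_val] <;>
    fun_prop

lemma hasAnalyticLiftAt_fm_smul (g : Rat1) (x : Rat2fm) :
    HasAnalyticLiftAt Rat2fm.IsLift Rat2fm.IsLift (fun y => g • y) x := by
  obtain ⟨A, rfl⟩ := surjective_mobius g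
  intro p _
  refine ⟨fun q => (conjCoef A.1 (A⁻¹).1 q.1, fun i => A.1.mulVec (q.2 i)),
    analyticAt_of_contDiff ?_ p, Filter.Eventually.of_forall fun q y hy => hy.mobius A⟩
  refine ((contDiff_conjCoef _ _).comp contDiff_fst).prodMk (contDiff_pi.2 fun i => ?_)
  exact (contDiff_mulVec A.1).comp ((contDiff_apply ℂ _ i).comp contDiff_snd)

lemma hasAnalyticLiftAt_tm_smul (g : Rat1) (x : Rat2tm) :
    HasAnalyticLiftAt Rat2tm.IsLift Rat2tm.IsLift (fun y => g • y) x := by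
  obtain ⟨A, rfl⟩ := surjective_mobius g
  intro p _
  refine ⟨fun q => (conjCoef A.1 (A⁻¹).1 q.1, fun i => A.1.mulVec (q.2.1 i),
    fun j => A.1.mulVec (q.2.2 j)),
    analyticAt_of_contDiff ?_ p, Filter.Eventually.of_forall fun q y hy => hy.mobius A⟩
  refine ((contDiff_conjCoef _ _).comp contDiff_fst).prodMk
    ((contDiff_pi.2 fun i => ?_).prodMk (contDiff_pi.2 fun i => ?_))
  · exact (contDiff_mulVec A.1).comp ((contDiff_apply ℂ _ i).comp (contDiff_fst.comp contDiff_snd))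
  · exact (contDiff_mulVec A.1).comp ((contDiff_apply ℂ _ i).comp (contDiff_snd.comp contDiff_snd))

instance : ContinuousConstSMul Rat1 Rat2fm where
  continuous_const_smul g := continuous_iff_continuousAt.2 fun x =>
    (hasAnalyticLiftAt_fm_smul g x).continuousAt isLiftSystem_fm isLiftSystem_fm

instance : ContinuousConstSMul Rat1 Rat2tm where
  continuous_const_smul g := continuous_iff_continuousAt.2 fun x =>
    (hasAnalyticLiftAt_tm_smul g x).continuousAt isLiftSystem_tm isLiftSystem_tm

lemma isBiholomorphic_fm_smul (g : Rat1) : IsBiholomorphic Rat2fm.HolAt Rat2fm.HolAt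
    (Homeomorph.smul g : Rat2fm ≃ₜ Rat2fm).toOpenPartialHomeomorph :=
  isBiholomorphic_of_hasAnalyticLiftAt (hasAnalyticLiftAt_fm_smul g)
    (hasAnalyticLiftAt_fm_smul g⁻¹)

lemma isOpenQuotientMap_toModuli_fm : IsOpenQuotientMap Rat2fm.toModuli :=
  MulAction.isOpenQuotientMap_quotientMk

lemma isOpenQuotientMap_toModuli_tm : IsOpenQuotientMap Rat2tm.toModuli :=
  MulAction.isOpenQuotientMap_quotientMk

/-! ### Fixed point marked maps -/

section FixedMarking

/-- In the chart of `Rat2fm` around the maps that do not fix infinity, the coordinates of a marked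
map are its three fixed points and the coefficients of its monic denominator. -/
def fmCoord (p : Coef × (Fin 3 → Fin 2 → ℂ)) : EuclideanSpace ℂ (Fin 5) :=
  !₂[p.2 0 0 / p.2 0 1, p.2 1 0 / p.2 1 1, p.2 2 0 / p.2 2 1, p.1 1 1 / p.1 1 0,
    p.1 1 2 / p.1 1 0]

/-- The inverse of `fmCoord`: homogeneous coordinates of the marked map with the given three fixed
points and monic denominator. -/
def fmSection (t : EuclideanSpace ℂ (Fin 5)) : Coef × (Fin 3 → Fin 2 → ℂ) :=
  (![![t 3 + (t 0 + t 1 + t 2), t 4 - (t 0 * t 1 + t 0 * t 2 + t 1 * t 2), t 0 * t 1 * t 2],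
    ![1, t 3, t 4]], ![![t 0, 1], ![t 1, 1], ![t 2, 1]])

lemma fixedBy_fmSection (t : EuclideanSpace ℂ (Fin 5)) :
    FixedBy (fmSection t).1 (fmSection t).2 := by
  refine ⟨1, one_ne_zero, fun v => ?_⟩
  simp only [wedge, quadForm, fmSection, Fin.prod_univ_three, Matrix.cons_val_zero,
    Matrix.cons_val_one, Matrix.cons_val]
  ring

lemma fmCoord_fmSection (t : EuclideanSpace ℂ (Fin 5)) : fmCoord (fmSection t) = t := by
  ext i
  fin_cases i <;> simp [fmCoord, fmSection]

lemma contDiff_fmSection : ContDiff ℂ ω fmSection := by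
  refine ContDiff.prodMk (contDiff_pi.2 fun i => contDiff_pi.2 fun j => ?_)
    (contDiff_pi.2 fun i => contDiff_pi.2 fun j => ?_) <;>
    fin_cases i <;> fin_cases j <;>
    simp only [Fin.zero_eta, Fin.mk_one, Fin.reduceFinMk, Matrix.cons_val] <;> fun_prop

lemma FixedBy.eq_fmSection {c : Coef} {w : Fin 3 → Fin 2 → ℂ} (h : FixedBy c w)
    (hc1 : c 1 0 = 1) (hw : ∀ i, w i 1 = 1) : (c, w) = fmSection (fmCoord (c, w)) := by
  obtain ⟨k, -, h⟩ := h
  obtain rfl : k = 1 := by simpa [wedge, quadForm, hw, hc1] using (h ![1, 0]).symm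
  have e1 := h ![0, 1]
  have e2 := h ![1, 1]
  have e3 := h ![1, -1]
  simp only [Fin.prod_univ_three, wedge, quadForm, hw, hc1, Matrix.cons_val_zero,
    Matrix.cons_val_one] at e1 e2 e3
  have h02 : c 0 2 = w 0 0 * w 1 0 * w 2 0 := by linear_combination -e1
  have h00 : c 0 0 = c 1 1 + (w 0 0 + w 1 0 + w 2 0) := by
    linear_combination (-1 / 2 : ℂ) * e2 + (1 / 2 : ℂ) * e3 - h02
  have h01 : c 0 1 = c 1 2 - (w 0 0 * w 1 0 + w 0 0 * w 2 0 + w 1 0 * w 2 0) := by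
    linear_combination -e2 - h00 - h02
  refine Prod.ext (funext fun i => funext fun j => ?_) (funext fun i => funext fun j => ?_)
  · fin_cases i <;> fin_cases j <;> simp [fmSection, fmCoord, hw, hc1, h00, h01, h02]
  · fin_cases i <;> fin_cases j <;> simp [fmSection, fmCoord, hw]

lemma FixedBy.apply_one_ne_zero {c : Coef} {w : Fin 3 → Fin 2 → ℂ} (h : FixedBy c w)
    (hc1 : c 1 0 ≠ 0) (i : Fin 3) : w i 1 ≠ 0 := by
  obtain ⟨k, -, h⟩ := h
  have hinfty : c 1 0 = k * ∏ i, w i 1 := by simpa [wedge, quadForm] using h ![1, 0]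
  rw [hinfty] at hc1
  exact Finset.prod_ne_zero_iff.1 (right_ne_zero_of_mul hc1) i (Finset.mem_univ i)

lemma fmCoord_smul (c : Coef) (w : Fin 3 → Fin 2 → ℂ) {k : ℂ} (hk : k ≠ 0) {a : Fin 3 → ℂ}
    (ha : ∀ i, a i ≠ 0) : fmCoord (k • c, fun i => a i • w i) = fmCoord (c, w) := by
  ext i
  fin_cases i <;> simp [fmCoord, mul_div_mul_left, hk, ha]

lemma analyticAt_fmCoord {p : Coef × (Fin 3 → Fin 2 → ℂ)} (hc : p.1 1 0 ≠ 0)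
    (hw : ∀ i, p.2 i 1 ≠ 0) : AnalyticAt ℂ fmCoord p := by
  have h1 : ∀ i j, AnalyticAt ℂ (fun q : Coef × (Fin 3 → Fin 2 → ℂ) => q.1 i j) p :=
    fun i j => analyticAt_of_contDiff (by fun_prop) p
  have h2 : ∀ i j, AnalyticAt ℂ (fun q : Coef × (Fin 3 → Fin 2 → ℂ) => q.2 i j) p :=
    fun i j => analyticAt_of_contDiff (by fun_prop) p
  have hcoord : AnalyticAt ℂ (fun q i => fmCoord q i) p := by
    refine AnalyticAt.pi fun i => ?_
    fin_cases i
    · exact (h2 0 0).div (h2 0 1) (hw 0)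
    · exact (h2 1 0).div (h2 1 1) (hw 1)
    · exact (h2 2 0).div (h2 2 1) (hw 2)
    · exact (h1 1 1).div (h1 1 0) hc
    · exact (h1 1 2).div (h1 1 0) hc
  exact ((EuclideanSpace.equiv (Fin 5) ℂ).symm.toContinuousLinearMap.analyticAt _).comp hcoord

namespace Rat2fm.IsLift

variable {c : Coef} {w : Fin 3 → Fin 2 → ℂ} {p q : Coef × (Fin 3 → Fin 2 → ℂ)} {x : Rat2fm}

lemma smul (h : Rat2fm.IsLift (c, w) x) {k : ℂ} (hk : k ≠ 0) {a : Fin 3 → ℂ}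
    (ha : ∀ i, a i ≠ 0) : Rat2fm.IsLift (k • c, fun i => a i • w i) x :=
  ⟨h.1.smul hk, fun i => ⟨smul_ne_zero (ha i) (h.2 i).1, by rw [proj_smul (ha i)]; exact (h.2 i).2⟩⟩

lemma fmCoord_eq (hp : Rat2fm.IsLift p x) (hq : Rat2fm.IsLift q x) : fmCoord p = fmCoord q := by
  obtain ⟨k, hk, hqp⟩ := hp.1.exists_smul hq.1
  choose a ha haw using fun i => (hp.2 i).exists_smul
  choose b hb hbw using fun i => (hq.2 i).exists_smul
  have hw : q.2 = fun i => (b i * (a i)⁻¹) • p.2 i := by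
    ext1 i
    rw [haw, hbw, smul_smul, inv_mul_cancel_right₀ (ha i)]
  rw [← Prod.mk.eta (p := q), hqp, hw, fmCoord_smul _ _ hk]
  exact fun i => mul_ne_zero (hb i) (inv_ne_zero (ha i))

lemma map_infty_ne_iff (h : Rat2fm.IsLift p x) :
    x.1.1.1 OnePoint.infty ≠ OnePoint.infty ↔ p.1 1 0 ≠ 0 := by
  have hmap : x.1.1.1 OnePoint.infty = proj (quadForm p.1 ![1, 0]) := by
    rw [← h.1.2]; rfl
  rw [hmap, proj]
  simp [quadForm]

lemma fmSection (h : Rat2fm.IsLift p x) (hx : x.1.1.1 OnePoint.infty ≠ OnePoint.infty) :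
    Rat2fm.IsLift (fmSection (fmCoord p)) x := by
  obtain ⟨c, w⟩ := p
  have hc1 : c 1 0 ≠ 0 := h.map_infty_ne_iff.1 hx
  have hw : ∀ i, w i 1 ≠ 0 := h.fixedBy.apply_one_ne_zero hc1
  have hw' : ∀ i, (w i 1)⁻¹ ≠ 0 := fun i => inv_ne_zero (hw i)
  have h' := h.smul (inv_ne_zero hc1) hw'
  have he := h'.fixedBy.eq_fmSection (by simp [hc1]) (by simp [hw])
  rw [fmCoord_smul c w (inv_ne_zero hc1) hw'] at he
  rwa [he] at h'

end Rat2fm.IsLift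

lemma exists_isLift_fmSection {t : EuclideanSpace ℂ (Fin 5)} (ht : res (fmSection t).1 ≠ 0) :
    ∃ y : Rat2fm, y.1.1.1 OnePoint.infty ≠ OnePoint.infty ∧ Rat2fm.IsLift (fmSection t) y := by
  have hw : ∀ i, (fmSection t).2 i ≠ 0 := fun i => by
    rw [ne_zero_iff]
    right
    fin_cases i <;> simp [fmSection]
  obtain ⟨y, hy⟩ := Rat2fm.exists_isLift ht hw (fixedBy_fmSection t)
  exact ⟨y, hy.map_infty_ne_iff.2 (by simp [fmSection]), hy⟩

lemma isSmoothPoint_fm_of_map_infty_ne {x : Rat2fm}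
    (hx : x.1.1.1 OnePoint.infty ≠ OnePoint.infty) : IsSmoothPoint 5 Rat2fm.HolAt x := by
  choose ℓ hℓ using isLiftSystem_fm.exists_lift
  let S : Set Rat2fm := {y | y.1.1.1 OnePoint.infty ≠ OnePoint.infty}
  have hS : IsOpen S := isOpen_ne.preimage
    ((continuous_eval OnePoint.infty).comp (continuous_fst.comp continuous_subtype_val))
  have hinj : Set.InjOn (fun y => fmCoord (ℓ y)) S := fun y hy y' hy' h => by
    have hys := (hℓ y).fmSection hy
    simp only at h
    rw [h] at hys
    exact hys.eq ((hℓ y').fmSection hy')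
  have hχ : ∀ y ∈ S, HasAnalyticLiftAt Rat2fm.IsLift Eq (fun y => fmCoord (ℓ y)) y := fun y hy =>
    .of_forall (fun q z hq => hq.fmCoord_eq (hℓ z)) fun q hq =>
      have hc1 := hq.map_infty_ne_iff.1 hy
      analyticAt_fmCoord hc1 (hq.fixedBy.apply_one_ne_zero hc1)
  have hT : IsOpen {t | res (fmSection t).1 ≠ 0} := isOpen_ne.preimage
    (continuous_res.comp (continuous_fst.comp contDiff_fmSection.continuous))
  have hσ : ∀ y ∈ S, IsAnalyticSectionAt Rat2fm.IsLift (fun y => fmCoord (ℓ y)) S fmSection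
      (fmCoord (ℓ y)) := fun y hy => by
    refine ⟨analyticAt_of_contDiff contDiff_fmSection _, ?_⟩
    filter_upwards [hT.mem_nhds ((nondeg_iff _).1 ((hℓ y).fmSection hy).1.1)] with t ht
    obtain ⟨z, hzS, hz⟩ := exists_isLift_fmSection ht
    exact ⟨z, hzS, hz, by rw [(hℓ z).fmCoord_eq hz, fmCoord_fmSection]⟩
  have : Nonempty Rat2fm := ⟨x⟩
  obtain ⟨e, he, -, he'⟩ :=
    exists_chart_of_section isLiftSystem_fm hS hinj hχ fun y hy => ⟨fmSection, hσ y hy⟩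
  exact ⟨e, he ▸ hx, he'⟩

lemma exists_smul_eq_infty (q : OnePoint ℂ) : ∃ g : GL (Fin 2) ℂ, g • q = OnePoint.infty := by
  induction q using OnePoint.rec with
  | infty => exact ⟨1, one_smul _ _⟩
  | coe t =>
    refine ⟨Matrix.GeneralLinearGroup.mkOfDetNeZero !![0, 1; 1, -t] (by simp), ?_⟩
    rw [smul_eq_proj]
    simp [proj, hc, Matrix.GeneralLinearGroup.mkOfDetNeZero]

lemma IsFixedMarking.map_ne_self {f : OnePoint ℂ → OnePoint ℂ} {z : Fin 3 → OnePoint ℂ}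
    (h : IsFixedMarking f z) {q : OnePoint ℂ} (hq : q ∉ Set.range z) : f q ≠ q := by
  obtain ⟨c, hr, k, hk, h⟩ := h
  have hne : wedge (hc q) (quadForm c (hc q)) ≠ 0 := by
    rw [h]
    refine mul_ne_zero hk (Finset.prod_ne_zero_iff.2 fun i _ => ?_)
    rw [Ne, ← (isHom_hc q).eq_iff_wedge (isHom_hc (z i))]
    exact fun hqz => hq ⟨i, hqz.symm⟩
  rw [Ne, ← (isHom_hc q).eq_iff_wedge (isHom_proj (hr.1 _ (hc_ne_zero q)))] at hne
  rw [← hr.2]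
  exact fun hfq => hne hfq.symm

/-- Conjugation moves any point that is not fixed to infinity. -/
lemma isSmoothPoint_fm (x : Rat2fm) : IsSmoothPoint 5 Rat2fm.HolAt x := by
  obtain ⟨q, hq⟩ : ∃ q, q ∉ Set.range x.1.2 := (Set.finite_range x.1.2).exists_notMem
  obtain ⟨g, hg⟩ := exists_smul_eq_infty q
  refine (isSmoothPoint_fm_of_map_infty_ne (x := mobius g • x) ?_).of_isBiholomorphic
    (isBiholomorphic_fm_smul (mobius g)) (Set.mem_univ x)
  intro hinfty
  have hg' : g • x.1.1.1 (g⁻¹ • OnePoint.infty) = OnePoint.infty := hinfty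
  rw [← hg, inv_smul_smul] at hg'
  exact x.2.map_ne_self hq (MulAction.injective g hg')

instance : SecondCountableTopology Rat2fm := isLiftSystem_fm.secondCountableTopology

instance : SecondCountableTopology Rat2tm := isLiftSystem_tm.secondCountableTopology

lemma isComplexManifold_fm : IsComplexManifold 5 Rat2fm.HolAt :=
  isComplexManifold_of_isSmoothPoint isLiftSystem_fm.dependsOnGerm isSmoothPoint_fm

end FixedMarking

/-! ### The covering forgetting the critical points -/

section AnalyticSection

variable {E E' X Y : Type*} [NormedAddCommGroup E] [NormedSpace ℂ E] [NormedAddCommGroup E']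
  [NormedSpace ℂ E'] {L : E → X → Prop} {L' : E' → Y → Prop} {f : X → Y} {x : X}

/-- Near `f x`, analytic functions of the lifts of a point give lifts of its preimages under
`f`, and of `x` itself at `f x`. -/
def HasAnalyticSectionAt (L : E → X → Prop) (L' : E' → Y → Prop) (f : X → Y) (x : X) : Prop :=
  ∀ p, L' p (f x) → ∃ Θ : E' → E, AnalyticAt ℂ Θ p ∧ L (Θ p) x ∧
    ∀ᶠ q in 𝓝 p, ∀ y, L' q y → ∃ x', L (Θ q) x' ∧ f x' = y

namespace HasAnalyticSectionAt

lemma nhds_le_map [TopologicalSpace X] [TopologicalSpace Y] (hL : IsLiftSystem L)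
    (hL' : IsLiftSystem L') (hf : HasAnalyticSectionAt L L' f x) :
    𝓝 (f x) ≤ Filter.map f (𝓝 x) := by
  intro N hN
  obtain ⟨p, hp⟩ := hL'.exists_lift (f x)
  obtain ⟨Θ, hΘ, hΘx, hΘf⟩ := hf p hp
  have hΘN := hΘ.continuousAt.eventually (hL.eventually_mem hΘx (Filter.mem_map.1 hN))
  filter_upwards [hL'.eventually_exists hp (hΘN.and hΘf)] with y ⟨q, ⟨hqN, hq⟩, hqy⟩
  obtain ⟨x', hx', rfl⟩ := hq y hqy
  exact hqN x' hx'

lemma liftHolAt (hf : HasAnalyticSectionAt L L' f x) {g : Y → ℂ}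
    (hg : LiftHolAt L (g ∘ f) x) : LiftHolAt L' g (f x) := by
  intro p hp
  obtain ⟨Θ, hΘ, hΘx, hΘf⟩ := hf p hp
  obtain ⟨G, hG, hgG⟩ := hg (Θ p) hΘx
  refine ⟨G ∘ Θ, hG.comp hΘ, ?_⟩
  filter_upwards [hΘf, hΘ.continuousAt.eventually hgG] with q hq hqG y hy
  obtain ⟨x', hx', rfl⟩ := hq y hy
  exact hqG x' hx'

end HasAnalyticSectionAt

end AnalyticSection

section Covering

lemma exists_wedge_ne_zero {u : Fin 2 → ℂ} (hu : u ≠ 0) : ∃ n, wedge u n ≠ 0 := by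
  rcases (ne_zero_iff u).1 hu with h | h
  · exact ⟨![0, 1], by simpa [wedge] using h⟩
  · exact ⟨![1, 0], by simpa [wedge] using h⟩

lemma jac_add_smul (c : Coef) (u n : Fin 2 → ℂ) (t : ℂ) :
    jac c (u + t • n) = jac c u + t * jacPolar c u n + t ^ 2 * jac c n := by
  simp only [jac, jacPolar, minor, Pi.add_apply, Pi.smul_apply, smul_eq_mul]
  ring

lemma jacPolar_ne_zero {c : Coef} (hres : res c ≠ 0) {u n : Fin 2 → ℂ} (h : jac c u = 0)
    (hun : wedge u n ≠ 0) : jacPolar c u n ≠ 0 := by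
  intro hpol
  have hsq := jacPolar_sq c u n
  rw [hpol, h] at hsq
  have hne : 16 * res c * wedge u n ^ 2 ≠ 0 :=
    mul_ne_zero (mul_ne_zero (by norm_num) hres) (pow_ne_zero 2 hun)
  exact hne (by linear_combination -hsq)

lemma exists_analyticAt_sq_eq {E : Type*} [NormedAddCommGroup E] [NormedSpace ℂ E] {D : E → ℂ}
    {x : E} (hD : AnalyticAt ℂ D x) {b : ℂ} (hb : b ≠ 0) (hx : D x = b ^ 2) :
    ∃ s : E → ℂ, AnalyticAt ℂ s x ∧ s x = b ∧ ∀ᶠ y in 𝓝 x, s y ^ 2 = D y := by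
  have hb2 : b ^ 2 ≠ 0 := pow_ne_zero 2 hb
  have hquot : AnalyticAt ℂ (fun y => D y / b ^ 2) x := hD.div analyticAt_const hb2
  have hx1 : D x / b ^ 2 = 1 := by rw [hx, div_self hb2]
  refine ⟨fun y => b * Complex.exp (Complex.log (D y / b ^ 2) / 2), ?_, by simp [hx1], ?_⟩
  · have hlog := hquot.clog (by rw [hx1]; exact Complex.one_mem_slitPlane)
    exact analyticAt_const.mul (hlog.div analyticAt_const two_ne_zero).cexp
  · filter_upwards [hquot.continuousAt.eventually_ne (by rw [hx1]; exact one_ne_zero)] with y hy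
    rw [mul_pow, ← Complex.exp_nat_mul, Nat.cast_ofNat, mul_div_cancel₀ _ two_ne_zero,
      Complex.exp_log hy, mul_div_cancel₀ _ hb2]

/-- Restricted to a line through `u`, the form `jac d` is a quadratic polynomial; its root near
`u` is an analytic function of `d` because the discriminant does not vanish. -/
lemma exists_analyticAt_jac_eq_zero {c : Coef} (hres : res c ≠ 0) {u : Fin 2 → ℂ} (hu : u ≠ 0)
    (h : jac c u = 0) : ∃ U : Coef → Fin 2 → ℂ, AnalyticAt ℂ U c ∧ U c = u ∧
      ∀ᶠ d in 𝓝 c, jac d (U d) = 0 := by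
  obtain ⟨n, hn⟩ := exists_wedge_ne_zero hu
  have hjac : ∀ v, AnalyticAt ℂ (fun d => jac d v) c := fun v =>
    analyticAt_of_contDiff (by unfold jac minor; fun_prop) c
  have hpol : AnalyticAt ℂ (fun d => jacPolar d u n) c :=
    analyticAt_of_contDiff (by unfold jacPolar minor; fun_prop) c
  have hpol0 : jacPolar c u n ≠ 0 := jacPolar_ne_zero hres h hn
  have hD : AnalyticAt ℂ (fun d => jacPolar d u n ^ 2 - 4 * jac d u * jac d n) c :=
    (hpol.pow 2).sub ((analyticAt_const.mul (hjac u)).mul (hjac n))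
  obtain ⟨s, hs, hs0, hs2⟩ := exists_analyticAt_sq_eq hD hpol0 (by simp [h])
  have hden : AnalyticAt ℂ (fun d => jacPolar d u n + s d) c := hpol.add hs
  have hden0 : jacPolar c u n + s c ≠ 0 := by
    rw [hs0, ← two_mul]
    exact mul_ne_zero two_ne_zero hpol0
  -- the root vanishing with `jac d u` of `jac d n * t ^ 2 + jacPolar d u n * t + jac d u`
  refine ⟨fun d => u + (-2 * jac d u / (jacPolar d u n + s d)) • n, ?_, by simp [h], ?_⟩
  · exact analyticAt_const.add
      (((analyticAt_const.mul (hjac u)).div hden hden0).smul analyticAt_const)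
  · filter_upwards [hs2, hden.continuousAt.eventually_ne hden0] with d h2 hd
    rw [jac_add_smul]
    field_simp
    linear_combination jac d u * h2

lemma hasAnalyticSectionAt_forget (x : Rat2tm) :
    HasAnalyticSectionAt Rat2tm.IsLift Rat2fm.IsLift forget x := by
  rintro ⟨c, w⟩ hp
  obtain ⟨p', hp'⟩ := isLiftSystem_tm.exists_lift x
  have hx : Rat2tm.IsLift (c, w, p'.2.2) x := ⟨hp.1, hp.2, hp'.2.2⟩
  have hres : res c ≠ 0 := (nondeg_iff c).1 hp.1.1
  choose U hU hUc hUj using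
    fun j => exists_analyticAt_jac_eq_zero hres (hp'.2.2 j).1 (hx.critical.2 j)
  have hUfst : ∀ j, AnalyticAt ℂ (fun q : Coef × (Fin 3 → Fin 2 → ℂ) => U j q.1) (c, w) :=
    fun j => (hU j).fun_comp analyticAt_fst
  have hwedge : ∀ᶠ d in 𝓝 c, wedge (U 0 d) (U 1 d) ≠ 0 := by
    have hUi := fun j i => (continuous_apply i).continuousAt.comp (hU j).continuousAt
    have hcont : ContinuousAt (fun d => wedge (U 0 d) (U 1 d)) c :=
      ((hUi 0 0).mul (hUi 1 1)).sub ((hUi 0 1).mul (hUi 1 0))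
    refine hcont.eventually_ne ?_
    rw [hUc, hUc]
    exact hx.critical.1
  refine ⟨fun q => (q.1, q.2, fun j => U j q.1),
    analyticAt_fst.prod (analyticAt_snd.prod (AnalyticAt.pi hUfst)), ?_, ?_⟩
  · simpa only [hUc] using hx
  · filter_upwards [continuousAt_fst.eventually (hwedge.and (Filter.eventually_all.2 hUj))]
      with q ⟨hq, hqj⟩ y hy
    exact hy.exists_tm hq hqj

lemma hasAnalyticLiftAt_forget (x : Rat2tm) :
    HasAnalyticLiftAt Rat2tm.IsLift Rat2fm.IsLift forget x := fun p _ =>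
  ⟨fun q => (q.1, q.2.1), analyticAt_of_contDiff (by fun_prop) p,
    Filter.Eventually.of_forall fun _ _ hy => ⟨hy.1, hy.2.1⟩⟩

lemma continuous_forget : Continuous forget := continuous_iff_continuousAt.2 fun x =>
  (hasAnalyticLiftAt_forget x).continuousAt isLiftSystem_tm isLiftSystem_fm

lemma isOpenMap_forget : IsOpenMap forget := isOpenMap_iff_nhds_le.2 fun x =>
  (hasAnalyticSectionAt_forget x).nhds_le_map isLiftSystem_tm isLiftSystem_fm

lemma holAt_forget_iff (g : Rat2fm → ℂ) (x : Rat2tm) :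
    Rat2fm.HolAt g (forget x) ↔ Rat2tm.HolAt (g ∘ forget) x :=
  ⟨(hasAnalyticLiftAt_forget x).liftHolAt_comp, (hasAnalyticSectionAt_forget x).liftHolAt⟩

lemma exists_perm_of_range_eq {ι α : Type*} {m m' : ι → α} (hm : Function.Injective m)
    (hm' : Function.Injective m') (h : Set.range m = Set.range m') :
    ∃ σ : Equiv.Perm ι, m' ∘ σ = m := by
  refine ⟨(Equiv.ofInjective m hm).trans
    ((Equiv.setCongr h).trans (Equiv.ofInjective m' hm').symm), funext fun i => ?_⟩
  simp only [Function.comp_apply, Equiv.trans_apply, Equiv.apply_ofInjective_symm hm',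
    Equiv.setCongr_apply, Equiv.ofInjective_apply]

lemma isCriticalMarking_iff_range {f : OnePoint ℂ → OnePoint ℂ} {m : Fin 2 → OnePoint ℂ} :
    IsCriticalMarking f m ↔ Function.Injective m ∧ Set.range m = {p | IsCritical f p} := by
  have hinj : m 0 ≠ m 1 ↔ Function.Injective m := by
    refine ⟨fun h i j hij => ?_, fun h h' => absurd (h h') zero_ne_one⟩
    fin_cases i <;> fin_cases j <;> simp_all
  simp only [IsCriticalMarking, hinj, Set.ext_iff, Set.mem_range, Fin.exists_fin_two,
    Set.mem_ofPred_eq, @eq_comm _ _ (m _), @Iff.comm (IsCritical f _)]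

/-- Permutations of the two critical points act on totally marked maps. -/
instance : MulAction (Equiv.Perm (Fin 2)) Rat2tm where
  smul σ x := ⟨(x.1.1, x.1.2.1, x.1.2.2 ∘ σ.symm), x.2.1, by
    have h := isCriticalMarking_iff_range.1 x.2.2
    exact isCriticalMarking_iff_range.2
      ⟨h.1.comp σ.symm.injective, (σ.symm.surjective.range_comp _).trans h.2⟩⟩
  one_smul _ := rfl
  mul_smul _ _ _ := rfl

lemma forget_eq_iff {x y : Rat2tm} :
    forget x = forget y ↔ ∃ σ : Equiv.Perm (Fin 2), σ • y = x := by
  refine ⟨fun h => ?_, fun ⟨σ, hσ⟩ => hσ ▸ rfl⟩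
  have hmap : x.1.1 = y.1.1 := congrArg (fun t : Rat2fm => t.1.1) h
  have hfix : x.1.2.1 = y.1.2.1 := congrArg (fun t : Rat2fm => t.1.2) h
  have hx := isCriticalMarking_iff_range.1 x.2.2
  have hy := isCriticalMarking_iff_range.1 y.2.2
  rw [hmap] at hx
  obtain ⟨σ, hσ⟩ := exists_perm_of_range_eq hx.1 hy.1 (hx.2.trans hy.2.symm)
  exact ⟨σ.symm, Subtype.ext (Prod.ext hmap.symm (Prod.ext hfix.symm hσ))⟩

lemma continuous_criticalMarking : Continuous fun x : Rat2tm => x.1.2.2 :=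
  continuous_snd.comp (continuous_snd.comp continuous_subtype_val)

lemma eq_one_or_eq_swap : ∀ σ : Equiv.Perm (Fin 2), σ = 1 ∨ σ = Equiv.swap 0 1 := by
  decide

lemma isQuotientCoveringMap_forget : IsQuotientCoveringMap forget (Equiv.Perm (Fin 2)) where
  toIsQuotientMap := isOpenMap_forget.isQuotientMap continuous_forget surjective_forget
  continuous_const_smul σ := by
    refine Continuous.subtype_mk (Continuous.prodMk ?_ (Continuous.prodMk ?_ ?_)) _
    · exact continuous_fst.comp continuous_subtype_val
    · exact continuous_fst.comp (continuous_snd.comp continuous_subtype_val)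
    · exact continuous_pi fun j => (continuous_apply _).comp continuous_criticalMarking
  apply_eq_iff_mem_orbit := forget_eq_iff
  disjoint x := by
    obtain ⟨A, B, hA, hB, h0, h1, hAB⟩ := t2_separation x.2.2.1
    have hcont : ∀ j, Continuous fun y : Rat2tm => y.1.2.2 j := fun j =>
      (continuous_apply j).comp continuous_criticalMarking
    refine ⟨(fun y : Rat2tm => y.1.2.2 0) ⁻¹' A ∩ (fun y : Rat2tm => y.1.2.2 1) ⁻¹' B,
      ((hA.preimage (hcont 0)).inter (hB.preimage (hcont 1))).mem_nhds ⟨h0, h1⟩, ?_⟩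
    rintro σ ⟨_, ⟨y, hy, rfl⟩, hσy⟩
    rcases eq_one_or_eq_swap σ with rfl | rfl
    · rfl
    · exact (Set.disjoint_left.1 hAB (show y.1.2.2 1 ∈ A from hσy.1) hy.2).elim

lemma isUnramifiedCover_forget : IsUnramifiedCover 2 Rat2tm.HolAt Rat2fm.HolAt forget := by
  have hcov := isQuotientCoveringMap_forget.isCoveringMap
  refine ⟨hcov, fun y => ?_, fun x => ?_⟩
  · obtain ⟨x, hx⟩ := surjective_forget y
    rw [Nat.card_congr (isQuotientCoveringMap_forget.fiberEquivGroup ⟨x, hx⟩),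
      Nat.card_eq_fintype_card, Fintype.card_perm, Fintype.card_fin, Nat.factorial_two]
  · obtain ⟨e, hx, he⟩ := hcov.isLocalHomeomorph x
    refine ⟨e, hx, fun y _ => by rw [he], fun y _ g => ?_⟩
    rw [← he]
    exact holAt_forget_iff g y

lemma isComplexManifold_tm : IsComplexManifold 5 Rat2tm.HolAt :=
  isComplexManifold_of_isSmoothPoint isLiftSystem_tm.dependsOnGerm fun x =>
    have ⟨e, hx, _, he⟩ := isUnramifiedCover_forget.2.2 x
    (isSmoothPoint_fm (e x)).of_isBiholomorphic he hx

end Covering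

/-! ### Charts of the moduli space of totally marked maps -/

/-- The homogeneous coordinates of totally marked maps. -/
abbrev TmLift := Coef × (Fin 3 → Fin 2 → ℂ) × (Fin 2 → Fin 2 → ℂ)

/-- The numerator of the conjugacy invariant `liftRatio`. -/
def ratioNum (p : TmLift) (i j : Fin 3) : ℂ :=
  wedge (p.2.1 i) (p.2.2 0) * wedge (p.2.1 j) (p.2.2 1) -
    wedge (p.2.1 j) (p.2.2 0) * wedge (p.2.1 i) (p.2.2 1)

/-- The denominator of the conjugacy invariant `liftRatio`. -/
def ratioDen (p : TmLift) (i j : Fin 3) : ℂ :=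
  wedge (p.2.1 i) (p.2.2 0) * wedge (p.2.1 j) (p.2.2 1) +
    wedge (p.2.1 j) (p.2.2 0) * wedge (p.2.1 i) (p.2.2 1)

/-- The conjugacy invariants `(zᵢ - zⱼ) / (zᵢ + zⱼ)` of the fixed points `zᵢ`, in a coordinate in
which the critical points are `0` and `∞`. -/
def liftRatio (p : TmLift) (i j : Fin 3) : ℂ := ratioNum p i j / ratioDen p i j

/-- The quadratic map with critical points `0`, `∞` and given fixed points. -/
def coefOfFixed (w : Fin 3 → Fin 2 → ℂ) : Coef :=
  ![![w 0 0 * w 1 1 * w 2 1 + w 0 1 * w 1 0 * w 2 1 + w 0 1 * w 1 1 * w 2 0, 0,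
      w 0 0 * w 1 0 * w 2 0],
    ![w 0 1 * w 1 1 * w 2 1, 0,
      w 0 0 * w 1 0 * w 2 1 + w 0 0 * w 1 1 * w 2 0 + w 0 1 * w 1 0 * w 2 0]]

/-- Homogeneous coordinates of the points `0` and `∞`. -/
def stdCrit : Fin 2 → Fin 2 → ℂ := ![![0, 1], ![1, 0]]

/-- The totally marked map with critical points `0`, `∞` and given fixed points. -/
def normalForm (w : Fin 3 → Fin 2 → ℂ) : TmLift := (coefOfFixed w, w, stdCrit)

section NormalForm

variable {c : Coef} {w : Fin 3 → Fin 2 → ℂ}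

lemma fixedBy_coefOfFixed (w : Fin 3 → Fin 2 → ℂ) : FixedBy (coefOfFixed w) w := by
  refine ⟨1, one_ne_zero, fun v => ?_⟩
  simp only [coefOfFixed, Fin.prod_univ_three, wedge, quadForm, Matrix.cons_val]
  ring

lemma jac_coefOfFixed (w : Fin 3 → Fin 2 → ℂ) (j : Fin 2) :
    jac (coefOfFixed w) (stdCrit j) = 0 := by
  fin_cases j <;> simp [coefOfFixed, jac, minor, stdCrit]

lemma ratioDen_normalForm (w : Fin 3 → Fin 2 → ℂ) (i j : Fin 3) :
    ratioDen (normalForm w) i j = -(w i 0 * w j 1 + w j 0 * w i 1) := by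
  simp only [ratioDen, normalForm, stdCrit, wedge, Matrix.cons_val]
  ring

lemma ratioDen_comm (p : TmLift) (i j : Fin 3) : ratioDen p i j = ratioDen p j i := by
  simp only [ratioDen]; ring

lemma res_coefOfFixed_ne_zero_iff :
    res (coefOfFixed w) ≠ 0 ↔ ∀ i j, i ≠ j → ratioDen (normalForm w) i j ≠ 0 := by
  have hres : res (coefOfFixed w) = (ratioDen (normalForm w) 0 1 * ratioDen (normalForm w) 0 2 *
      ratioDen (normalForm w) 1 2) ^ 2 := by
    simp only [ratioDen_normalForm, coefOfFixed, res, minor, Matrix.cons_val]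
    ring
  have h10 := ratioDen_comm (normalForm w) 1 0
  have h20 := ratioDen_comm (normalForm w) 2 0
  have h21 := ratioDen_comm (normalForm w) 2 1
  simp only [hres, Fin.forall_fin_succ, ne_eq, pow_eq_zero_iff two_ne_zero, mul_eq_zero]
  simp [h10, h20, h21]
  tauto

lemma apply_one_eq_zero_of_jac_stdCrit (hres : res c ≠ 0) (hj : ∀ j, jac c (stdCrit j) = 0)
    (i : Fin 2) : c i 1 = 0 := by
  have h12 : minor c 1 2 = 0 := by simpa [jac, stdCrit] using hj 0
  have h01 : minor c 0 1 = 0 := by simpa [jac, stdCrit] using hj 1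
  have h02 : minor c 0 2 ≠ 0 := fun h02 => hres (by simp [res, h12, h02])
  have hcramer : c i 1 * minor c 0 2 = c i 0 * minor c 1 2 + c i 2 * minor c 0 1 := by
    fin_cases i <;> simp only [minor, Fin.zero_eta, Fin.mk_one] <;> ring
  rw [h12, h01, mul_zero, mul_zero, add_zero] at hcramer
  exact (mul_eq_zero.1 hcramer).resolve_right h02

lemma FixedBy.exists_eq_smul_coefOfFixed (h : FixedBy c w) (hc : ∀ i, c i 1 = 0) :
    ∃ k : ℂ, k ≠ 0 ∧ c = k • coefOfFixed w := by
  obtain ⟨k, hk, h⟩ := h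
  have e0 := h ![1, 0]
  have e1 := h ![0, 1]
  have e2 := h ![1, 1]
  have e3 := h ![1, -1]
  simp only [Fin.prod_univ_three, wedge, quadForm, hc, Matrix.cons_val_zero,
    Matrix.cons_val_one] at e0 e1 e2 e3
  refine ⟨k, hk, funext fun i => funext fun j => ?_⟩
  fin_cases i <;> fin_cases j <;>
    simp only [coefOfFixed, hc, Fin.zero_eta, Fin.mk_one, Fin.reduceFinMk, Pi.smul_apply,
      smul_eq_mul, Matrix.cons_val, mul_zero]
  · linear_combination (-1 / 2 : ℂ) * e2 + (1 / 2 : ℂ) * e3 + e1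
  · linear_combination -e1
  · linear_combination e0
  · linear_combination (1 / 2 : ℂ) * e2 + (1 / 2 : ℂ) * e3 - e0

lemma exists_isLift_normalForm (h : ∀ i j, i ≠ j → ratioDen (normalForm w) i j ≠ 0) :
    ∃ x, Rat2tm.IsLift (normalForm w) x := by
  have hw : ∀ i, w i ≠ 0 := fun i hi => by
    obtain ⟨j, hj⟩ := exists_ne i
    exact h i j hj.symm (by simp [ratioDen_normalForm, hi])
  obtain ⟨y, hy⟩ :=
    Rat2fm.exists_isLift (res_coefOfFixed_ne_zero_iff.2 h) hw (fixedBy_coefOfFixed w)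
  obtain ⟨x, hx, -⟩ := hy.exists_tm (u := stdCrit) (by simp [stdCrit, wedge]) (jac_coefOfFixed w)
  exact ⟨x, hx⟩

end NormalForm

lemma toModuli_tm_eq_iff {x y : Rat2tm} : x.toModuli = y.toModuli ↔ ∃ g : Rat1, g • y = x :=
  Quotient.eq

lemma exists_mulVec_eq_wedge {u : Fin 2 → Fin 2 → ℂ} (hu : wedge (u 0) (u 1) ≠ 0) {s t : ℂ}
    (hs : s ≠ 0) (ht : t ≠ 0) : ∃ g : GL (Fin 2) ℂ,
      ∀ v, g.1.mulVec v = ![s * wedge v (u 0), t * wedge v (u 1)] := by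
  have hdet : (!![s * u 0 1, -(s * u 0 0); t * u 1 1, -(t * u 1 0)]).det ≠ 0 := by
    have : (!![s * u 0 1, -(s * u 0 0); t * u 1 1, -(t * u 1 0)]).det =
        s * t * wedge (u 0) (u 1) := by
      rw [Matrix.det_fin_two_of, wedge]; ring
    rw [this]
    exact mul_ne_zero (mul_ne_zero hs ht) hu
  refine ⟨Matrix.GeneralLinearGroup.mkOfDetNeZero _ hdet, fun v => ?_⟩
  ext i
  fin_cases i <;>
    simp [Matrix.GeneralLinearGroup.mkOfDetNeZero, wedge, Matrix.vecHead, Matrix.vecTail] <;> ring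

lemma wedge_smul_smul (v w : Fin 2 → ℂ) (a b : ℂ) :
    wedge (a • v) (b • w) = a * b * wedge v w := by
  simp only [wedge, Pi.smul_apply, smul_eq_mul]; ring

namespace Rat2tm.IsLift

variable {c : Coef} {w : Fin 3 → Fin 2 → ℂ} {u : Fin 2 → Fin 2 → ℂ} {x : Rat2tm}

lemma smul (h : Rat2tm.IsLift (c, w, u) x) {k : ℂ} (hk : k ≠ 0) {a : Fin 3 → ℂ}
    (ha : ∀ i, a i ≠ 0) {b : Fin 2 → ℂ} (hb : ∀ j, b j ≠ 0) :
    Rat2tm.IsLift (k • c, fun i => a i • w i, fun j => b j • u j) x :=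
  ⟨h.1.smul hk,
    fun i => ⟨smul_ne_zero (ha i) (h.2.1 i).1, by rw [proj_smul (ha i)]; exact (h.2.1 i).2⟩,
    fun j => ⟨smul_ne_zero (hb j) (h.2.2 j).1, by rw [proj_smul (hb j)]; exact (h.2.2 j).2⟩⟩

lemma normalForm_of_stdCrit (h : Rat2tm.IsLift (c, w, stdCrit) x) :
    Rat2tm.IsLift (normalForm w) x := by
  have hcol := apply_one_eq_zero_of_jac_stdCrit ((nondeg_iff _).1 h.1.1) h.critical.2
  have hfix : FixedBy c w := h.forget.fixedBy
  obtain ⟨k, hk, rfl⟩ := hfix.exists_eq_smul_coefOfFixed hcol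
  simpa [QuadRat.normalForm, smul_smul, inv_mul_cancel₀ hk] using
    h.smul (inv_ne_zero hk) (a := 1) (by simp) (b := 1) (by simp)

lemma ratioDen_normalForm_ne_zero (h : Rat2tm.IsLift (normalForm w) x) {i j : Fin 3}
    (hij : i ≠ j) : ratioDen (normalForm w) i j ≠ 0 :=
  res_coefOfFixed_ne_zero_iff.1 ((nondeg_iff _).1 h.1.1) i j hij

end Rat2tm.IsLift

/-- The homogeneous coordinates of the maps in a conjugacy class. -/
def M2tm.IsLift (p : TmLift) (m : M2tm) : Prop := ∃ x, Rat2tm.IsLift p x ∧ x.toModuli = m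

lemma isLiftSystem_m2tm : IsLiftSystem M2tm.IsLift :=
  isLiftSystem_tm.quotient isOpenQuotientMap_toModuli_tm

lemma m2tm_holAt_eq : M2tm.HolAt = LiftHolAt M2tm.IsLift :=
  funext₂ fun _ _ => propext liftHolAt_quotient.symm

namespace M2tm.IsLift

variable {p q : TmLift} {m n : M2tm} {i j k : Fin 3}

lemma eq (hm : M2tm.IsLift p m) (hn : M2tm.IsLift p n) : m = n := by
  obtain ⟨x, hx, rfl⟩ := hm
  obtain ⟨y, hy, rfl⟩ := hn
  rw [hx.eq hy]

lemma normalForm (h : M2tm.IsLift p m) {s t : ℂ} (hs : s ≠ 0) (ht : t ≠ 0) {a : Fin 3 → ℂ}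
    (ha : ∀ i, a i ≠ 0) : M2tm.IsLift (QuadRat.normalForm fun i =>
      a i • ![s * wedge (p.2.1 i) (p.2.2 0), t * wedge (p.2.1 i) (p.2.2 1)]) m := by
  obtain ⟨x, hx, rfl⟩ := h
  obtain ⟨c, w, u⟩ := p
  have hD : wedge (u 0) (u 1) ≠ 0 := hx.critical.1
  have hD' : wedge (u 1) (u 0) ≠ 0 := by rwa [wedge_swap, neg_ne_zero]
  obtain ⟨g, hg⟩ := exists_mulVec_eq_wedge hD hs ht
  let b : Fin 2 → ℂ := ![(t * wedge (u 0) (u 1))⁻¹, (s * wedge (u 1) (u 0))⁻¹]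
  have hb : ∀ j, b j ≠ 0 := Fin.forall_fin_two.2
    ⟨inv_ne_zero (mul_ne_zero ht hD), inv_ne_zero (mul_ne_zero hs hD')⟩
  have hu : (fun j => b j • g.1.mulVec (u j)) = stdCrit := by
    ext j l
    fin_cases j <;> fin_cases l <;> simp [b, hg, stdCrit, wedge_self] <;> field_simp
  have hgx := (hx.mobius g).smul one_ne_zero ha hb
  simp only [hu] at hgx
  simp only [hg] at hgx
  exact ⟨_, hgx.normalForm_of_stdCrit, toModuli_tm_eq_iff.2 ⟨mobius g, rfl⟩⟩

lemma ratioDen_ne_zero (h : M2tm.IsLift p m) (hij : i ≠ j) : ratioDen p i j ≠ 0 := by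
  obtain ⟨x, hx, -⟩ := h.normalForm one_ne_zero one_ne_zero fun _ => one_ne_zero
  have hden := hx.ratioDen_normalForm_ne_zero hij
  rw [ratioDen_normalForm, neg_ne_zero] at hden
  simpa [ratioDen] using hden

/-- By pigeonhole: two fixed points cannot be the same critical point. -/
lemma exists_wedge_ne_zero (h : M2tm.IsLift p m) :
    ∃ i, wedge (p.2.1 i) (p.2.2 0) ≠ 0 ∧ wedge (p.2.1 i) (p.2.2 1) ≠ 0 := by
  by_contra! hcon
  have hcrit : ∀ i, ∃ j, wedge (p.2.1 i) (p.2.2 j) = 0 := fun i => by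
    rw [Fin.exists_fin_two]
    exact or_iff_not_imp_left.2 (hcon i)
  choose f hf using hcrit
  obtain ⟨i, j, hij, hfij⟩ := Fintype.exists_ne_map_eq_of_card_lt f (by simp)
  refine h.ratioDen_ne_zero hij ?_
  have hi := hf i
  have hj := hf j
  rw [← hfij] at hj
  rcases Fin.exists_fin_two.1 ⟨f i, rfl⟩ with hfi | hfi <;> rw [hfi] at hi hj <;>
    simp [ratioDen, hi, hj]

end M2tm.IsLift

section LiftRatio

variable {p q : TmLift} {m : M2tm}

lemma liftRatio_eq_of_wedge {a : Fin 3 → ℂ} (ha : ∀ i, a i ≠ 0) {b : Fin 2 → ℂ}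
    (hb : ∀ j, b j ≠ 0)
    (h : ∀ i j, wedge (p.2.1 i) (p.2.2 j) = a i * b j * wedge (q.2.1 i) (q.2.2 j)) :
    liftRatio p = liftRatio q := by
  ext i j
  have hk : a i * a j * (b 0 * b 1) ≠ 0 :=
    mul_ne_zero (mul_ne_zero (ha i) (ha j)) (mul_ne_zero (hb 0) (hb 1))
  rw [liftRatio, liftRatio, ← mul_div_mul_left (ratioNum q i j) _ hk]
  congr 1
  · simp only [ratioNum, h]; ring
  · simp only [ratioDen, h]; ring

lemma Rat2tm.IsLift.liftRatio_eq {x : Rat2tm} (hp : Rat2tm.IsLift p x) (hq : Rat2tm.IsLift q x) :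
    liftRatio p = liftRatio q := by
  have hstd : ∀ p, Rat2tm.IsLift p x → liftRatio p =
      liftRatio (p.1, fun i => hc (x.1.2.1 i), fun j => hc (x.1.2.2 j)) := fun p hp => by
    choose a ha hwa using fun i => (hp.2.1 i).exists_smul
    choose b hb hub using fun j => (hp.2.2 j).exists_smul
    exact liftRatio_eq_of_wedge ha hb fun i j => by rw [hwa, hub, wedge_smul_smul]
  rw [hstd p hp, hstd q hq]
  rfl

lemma M2tm.IsLift.liftRatio_eq (hp : M2tm.IsLift p m) (hq : M2tm.IsLift q m) :
    liftRatio p = liftRatio q := by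
  obtain ⟨x, hx, rfl⟩ := hp
  obtain ⟨y, hy, hyx⟩ := hq
  obtain ⟨g, rfl⟩ := toModuli_tm_eq_iff.1 hyx
  obtain ⟨A, rfl⟩ := surjective_mobius g
  rw [hy.liftRatio_eq (hx.mobius A)]
  exact (liftRatio_eq_of_wedge (a := fun _ => A.1.det) (fun _ => A.det_ne_zero) (b := 1)
    (fun _ => one_ne_zero) fun i j => by rw [wedge_mulVec, Pi.one_apply, mul_one]).symm

end LiftRatio

/-- The conjugacy invariants of `liftRatio`, as functions on the moduli space. -/
def M2tm.ratio (m : M2tm) : Fin 3 → Fin 3 → ℂ := liftRatio (isLiftSystem_m2tm.exists_lift m).choose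

namespace M2tm.IsLift

variable {p : TmLift} {m : M2tm} {i j k : Fin 3}

lemma ratio_eq (h : M2tm.IsLift p m) : liftRatio p = m.ratio :=
  h.liftRatio_eq (isLiftSystem_m2tm.exists_lift m).choose_spec

lemma analyticAt_liftRatio (h : M2tm.IsLift p m) (i j : Fin 3) :
    AnalyticAt ℂ (fun q => liftRatio q i j) p := by
  rcases eq_or_ne i j with rfl | hij
  · simp only [liftRatio, ratioNum, sub_self, zero_div]
    exact analyticAt_const
  · refine (analyticAt_of_contDiff ?_ p).div (analyticAt_of_contDiff ?_ p) (h.ratioDen_ne_zero hij)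
    · unfold ratioNum wedge; fun_prop
    · unfold ratioDen wedge; fun_prop

lemma ratio_mul_ratio_ne_one_iff (h : M2tm.IsLift p m) (hij : i ≠ j) (hik : i ≠ k) (hjk : j ≠ k) :
    m.ratio i j * m.ratio i k ≠ 1 ↔
      wedge (p.2.1 i) (p.2.2 0) ≠ 0 ∧ wedge (p.2.1 i) (p.2.2 1) ≠ 0 := by
  have hsub : ratioNum p i j * ratioNum p i k - ratioDen p i j * ratioDen p i k =
      -2 * (wedge (p.2.1 i) (p.2.2 0) * wedge (p.2.1 i) (p.2.2 1)) * ratioDen p j k := by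
    simp only [ratioNum, ratioDen]; ring
  have hden := mul_ne_zero (h.ratioDen_ne_zero hij) (h.ratioDen_ne_zero hik)
  rw [← h.ratio_eq, liftRatio, liftRatio, div_mul_div_comm, ne_eq, div_eq_one_iff_eq hden,
    ← sub_eq_zero, hsub]
  simp [h.ratioDen_ne_zero hjk]

end M2tm.IsLift

namespace M2tm

lemma ratio_self (m : M2tm) (i : Fin 3) : m.ratio i i = 0 := by
  rw [ratio, liftRatio, ratioNum, sub_self, zero_div]

lemma ratio_swap (x : Rat2tm) :
    (Equiv.swap (0 : Fin 2) 1 • x).toModuli.ratio = -x.toModuli.ratio := by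
  obtain ⟨p, hp⟩ := isLiftSystem_tm.exists_lift x
  have hswap : Rat2tm.IsLift (p.1, p.2.1, p.2.2 ∘ Equiv.swap 0 1) (Equiv.swap (0 : Fin 2) 1 • x) :=
    ⟨hp.1, hp.2.1, fun j => hp.2.2 _⟩
  rw [← IsLift.ratio_eq ⟨x, hp, rfl⟩, ← IsLift.ratio_eq ⟨_, hswap, rfl⟩]
  ext i j
  simp only [liftRatio, Pi.neg_apply, ← neg_div]
  congr 1
  · simp [ratioNum, mul_comm]
  · simp [ratioDen, mul_comm, add_comm]

lemma continuous_ratio (i j : Fin 3) : Continuous fun m : M2tm => m.ratio i j :=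
  continuous_iff_continuousAt.2 fun _ =>
    HasAnalyticLiftAt.continuousAt isLiftSystem_m2tm IsLiftSystem.eq <|
      .of_forall (Φ := fun q => liftRatio q i j) (fun _ _ hq => by rw [IsLift.ratio_eq hq])
        fun _ hq => IsLift.analyticAt_liftRatio hq i j

end M2tm

/-- The normal form of the maps with `m.ratio i = ρ`. -/
def ratioSection (ρ : Fin 3 → ℂ) : TmLift := normalForm fun l => ![1 - ρ l, 1 + ρ l]

lemma contDiff_coefOfFixed : ContDiff ℂ ω coefOfFixed := by
  refine contDiff_pi' fun i => contDiff_pi' fun j => ?_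
  fin_cases i <;> fin_cases j <;>
    simp only [coefOfFixed, Fin.zero_eta, Fin.mk_one, Fin.reduceFinMk, Matrix.cons_val] <;> fun_prop

lemma contDiff_ratioSection : ContDiff ℂ ω ratioSection := by
  have hw : ContDiff ℂ ω fun (ρ : Fin 3 → ℂ) (l : Fin 3) => ![1 - ρ l, 1 + ρ l] := by
    refine contDiff_pi' fun l => contDiff_pi' fun j => ?_
    fin_cases j <;> simp only [Fin.zero_eta, Fin.mk_one, Matrix.cons_val] <;> fun_prop
  exact (contDiff_coefOfFixed.comp hw).prodMk (hw.prodMk contDiff_const)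

lemma ratioDen_ratioSection (ρ : Fin 3 → ℂ) (i j : Fin 3) :
    ratioDen (ratioSection ρ) i j = -2 * (1 - ρ i * ρ j) := by
  simp only [ratioSection, ratioDen_normalForm, Matrix.cons_val]
  ring

lemma liftRatio_ratioSection (ρ : Fin 3 → ℂ) (i j : Fin 3) :
    liftRatio (ratioSection ρ) i j = (ρ j - ρ i) / (1 - ρ i * ρ j) := by
  have hnum : ratioNum (ratioSection ρ) i j = -2 * (ρ j - ρ i) := by
    simp only [ratioNum, ratioSection, normalForm, stdCrit, wedge, Matrix.cons_val]
    ring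
  rw [liftRatio, hnum, ratioDen_ratioSection, mul_div_mul_left _ _ (by norm_num)]

lemma exists_isLift_ratioSection {ρ : Fin 3 → ℂ} (h : ∀ i j, i ≠ j → ρ i * ρ j ≠ 1) :
    ∃ m, M2tm.IsLift (ratioSection ρ) m := by
  obtain ⟨x, hx⟩ := exists_isLift_normalForm (w := fun l => ![1 - ρ l, 1 + ρ l]) fun i j hij => by
    rw [← ratioSection, ratioDen_ratioSection]
    exact mul_ne_zero (by norm_num) (sub_ne_zero.2 (h i j hij).symm)
  exact ⟨_, x, hx, rfl⟩

lemma M2tm.IsLift.ratioSection {p : TmLift} {m : M2tm} (h : M2tm.IsLift p m) {i : Fin 3}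
    (h0 : wedge (p.2.1 i) (p.2.2 0) ≠ 0) (h1 : wedge (p.2.1 i) (p.2.2 1) ≠ 0) :
    M2tm.IsLift (ratioSection (m.ratio i)) m := by
  have hden : ∀ l, ratioDen p i l ≠ 0 := fun l => by
    rcases eq_or_ne i l with rfl | hl
    · rw [ratioDen, ← two_mul]
      exact mul_ne_zero two_ne_zero (mul_ne_zero h0 h1)
    · exact h.ratioDen_ne_zero hl
  have hw : (fun l => (2 / ratioDen p i l) •
      ![wedge (p.2.1 i) (p.2.2 1) * wedge (p.2.1 l) (p.2.2 0),
        wedge (p.2.1 i) (p.2.2 0) * wedge (p.2.1 l) (p.2.2 1)]) =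
      fun l => ![1 - m.ratio i l, 1 + m.ratio i l] := by
    ext l j
    have hl := hden l
    rw [← h.ratio_eq, liftRatio]
    fin_cases j <;>
      simp only [Fin.zero_eta, Fin.mk_one, Pi.smul_apply, smul_eq_mul, Matrix.cons_val] <;>
      field_simp <;> simp only [ratioDen, ratioNum] <;> ring
  rw [QuadRat.ratioSection, ← hw]
  exact h.normalForm h1 h0 fun l => div_ne_zero two_ne_zero (hden l)

namespace M2tm

/-- The conjugacy classes of maps whose `i`-th fixed point is not critical. -/
def ratioDomain (i : Fin 3) : Set M2tm :=
  {m | m.ratio i (i.succAbove 0) * m.ratio i (i.succAbove 1) ≠ 1}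

/-- The local coordinates `m.ratio i j`, for `j ≠ i`. -/
def ratioChart (i : Fin 3) (m : M2tm) : EuclideanSpace ℂ (Fin 2) :=
  WithLp.toLp 2 (i.removeNth (m.ratio i))

variable {m m' : M2tm} {i : Fin 3}

lemma IsLift.mem_ratioDomain_iff {p : TmLift} (h : M2tm.IsLift p m) :
    m ∈ ratioDomain i ↔ wedge (p.2.1 i) (p.2.2 0) ≠ 0 ∧ wedge (p.2.1 i) (p.2.2 1) ≠ 0 :=
  h.ratio_mul_ratio_ne_one_iff (Fin.succAbove_ne i 0).symm (Fin.succAbove_ne i 1).symm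
    fun h => zero_ne_one (Fin.succAbove_right_injective h)

lemma isOpen_ratioDomain (i : Fin 3) : IsOpen (ratioDomain i) :=
  isOpen_ne.preimage ((continuous_ratio _ _).mul (continuous_ratio _ _))

lemma exists_mem_ratioDomain (m : M2tm) : ∃ i, m ∈ ratioDomain i := by
  obtain ⟨p, hp⟩ := isLiftSystem_m2tm.exists_lift m
  obtain ⟨i, hi⟩ := hp.exists_wedge_ne_zero
  exact ⟨i, hp.mem_ratioDomain_iff.2 hi⟩

lemma isLift_ratioSection (hm : m ∈ ratioDomain i) : M2tm.IsLift (ratioSection (m.ratio i)) m := by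
  obtain ⟨p, hp⟩ := isLiftSystem_m2tm.exists_lift m
  obtain ⟨h0, h1⟩ := hp.mem_ratioDomain_iff.1 hm
  exact hp.ratioSection h0 h1

lemma insertNth_ratioChart (i : Fin 3) (m : M2tm) :
    i.insertNth 0 (ratioChart i m).ofLp = m.ratio i := by
  rw [← m.ratio_self i]
  exact Fin.insertNth_self_removeNth i (m.ratio i)

lemma injOn_ratioChart (i : Fin 3) : Set.InjOn (ratioChart i) (ratioDomain i) :=
  fun m hm m' hm' h => by
    have hm := isLift_ratioSection hm
    rw [← insertNth_ratioChart, h, insertNth_ratioChart] at hm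
    exact hm.eq (isLift_ratioSection hm')

lemma injective_ratio : Function.Injective ratio := fun m m' h => by
  obtain ⟨i, hm⟩ := m.exists_mem_ratioDomain
  have hm' : m' ∈ ratioDomain i := by rwa [ratioDomain, Set.mem_ofPred_eq, ← h]
  exact injOn_ratioChart i hm hm' (by rw [ratioChart, h, ratioChart])

instance : T2Space M2tm :=
  .of_injective_continuous injective_ratio
    (continuous_pi fun i => continuous_pi fun j => continuous_ratio i j)

instance : SecondCountableTopology M2tm := isLiftSystem_m2tm.secondCountableTopology

lemma hasAnalyticLiftAt_ratioChart (i : Fin 3) (m : M2tm) :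
    HasAnalyticLiftAt M2tm.IsLift Eq (ratioChart i) m :=
  .of_forall (Φ := fun q => WithLp.toLp 2 (i.removeNth (liftRatio q i)))
    (fun q y hq => by rw [hq.ratio_eq, ratioChart])
    fun q hq => ((EuclideanSpace.equiv (Fin 2) ℂ).symm.toContinuousLinearMap.analyticAt _).comp
      (.pi fun j => hq.analyticAt_liftRatio i (i.succAbove j))

lemma exists_ratioChart_eq (i : Fin 3) {t : EuclideanSpace ℂ (Fin 2)} (ht : t 0 * t 1 ≠ 1) :
    ∃ m ∈ ratioDomain i, M2tm.IsLift (ratioSection (i.insertNth 0 t.ofLp)) m ∧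
      ratioChart i m = t := by
  have hρ : ∀ j k, j ≠ k → (i.insertNth 0 t.ofLp : Fin 3 → ℂ) j *
      (i.insertNth 0 t.ofLp : Fin 3 → ℂ) k ≠ 1 := by
    simp [Fin.forall_iff_succAbove i, Fin.forall_fin_two, ht, mul_comm (t 1)]
  obtain ⟨m, hm⟩ := exists_isLift_ratioSection hρ
  have hratio : m.ratio i = i.insertNth 0 t.ofLp := by
    ext j
    rw [← hm.ratio_eq, liftRatio_ratioSection]
    simp
  refine ⟨m, ?_, hm, ?_⟩
  · simpa [ratioDomain, hratio] using ht
  · rw [ratioChart, hratio, Fin.removeNth_insertNth]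

lemma isAnalyticSectionAt_ratioSection (hm : m ∈ ratioDomain i) :
    IsAnalyticSectionAt M2tm.IsLift (ratioChart i) (ratioDomain i)
      (fun t => ratioSection (i.insertNth 0 t.ofLp)) (ratioChart i m) := by
  constructor
  · have hins : ContDiff ℂ ω fun t : EuclideanSpace ℂ (Fin 2) =>
        (i.insertNth 0 t.ofLp : Fin 3 → ℂ) := by
      simp only [contDiff_pi, Fin.forall_iff_succAbove i, Fin.insertNth_apply_same,
        Fin.insertNth_apply_succAbove]
      exact ⟨contDiff_const, fun j => by fun_prop⟩
    exact analyticAt_of_contDiff (contDiff_ratioSection.comp hins) _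
  · have hT : IsOpen {t : EuclideanSpace ℂ (Fin 2) | t 0 * t 1 ≠ 1} :=
      isOpen_ne.preimage (by fun_prop)
    filter_upwards [hT.mem_nhds hm] with t ht
    exact exists_ratioChart_eq i ht

end M2tm

lemma exists_chart_m2tm (i : Fin 3) :
    ∃ e : OpenPartialHomeomorph M2tm (EuclideanSpace ℂ (Fin 2)), e.source = M2tm.ratioDomain i ∧
      ⇑e = M2tm.ratioChart i ∧ IsBiholomorphic M2tm.HolAt (fun g y => AnalyticAt ℂ g y) e := by
  have : Nonempty M2tm := ⟨(surjective_forget tripleFixed).choose.toModuli⟩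
  rw [m2tm_holAt_eq]
  exact exists_chart_of_section isLiftSystem_m2tm (M2tm.isOpen_ratioDomain i)
    (M2tm.injOn_ratioChart i) (fun m _ => M2tm.hasAnalyticLiftAt_ratioChart i m)
    fun m hm => ⟨_, M2tm.isAnalyticSectionAt_ratioSection hm⟩

lemma isSmoothPoint_m2tm (m : M2tm) : IsSmoothPoint 2 M2tm.HolAt m := by
  obtain ⟨i, hi⟩ := m.exists_mem_ratioDomain
  obtain ⟨e, hes, -, he⟩ := exists_chart_m2tm i
  exact ⟨e, hes ▸ hi, he⟩

lemma dependsOnGerm_m2tm : DependsOnGerm M2tm.HolAt :=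
  m2tm_holAt_eq ▸ isLiftSystem_m2tm.dependsOnGerm

lemma isComplexManifold_m2tm : IsComplexManifold 2 M2tm.HolAt :=
  isComplexManifold_of_isSmoothPoint dependsOnGerm_m2tm isSmoothPoint_m2tm

/-! ### Freeness of the action -/

section FixedPoints

variable {A : GL (Fin 2) ℂ}

lemma exists_mulVec_eq_smul {z : OnePoint ℂ} (h : A • z = z) :
    ∃ a : ℂ, a ≠ 0 ∧ A.1.mulVec (hc z) = a • hc z := by
  have hz := (isHom_hc z).mulVec A
  rw [h] at hz
  exact hz.exists_smul

lemma mul_eq_det_of_mulVec_eq_smul {z z' : OnePoint ℂ} (hz : z ≠ z') {a a' : ℂ}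
    (ha : A.1.mulVec (hc z) = a • hc z) (ha' : A.1.mulVec (hc z') = a' • hc z') :
    a * a' = A.1.det := by
  have hw : wedge (hc z) (hc z') ≠ 0 := mt ((isHom_hc z).eq_iff_wedge (isHom_hc z')).2 hz
  have h := wedge_mulVec A.1 (hc z) (hc z')
  rw [ha, ha', wedge_smul_smul] at h
  exact mul_right_cancel₀ hw h

lemma eq_of_wedge_eq {u : Fin 2 → Fin 2 → ℂ} (hu : wedge (u 0) (u 1) ≠ 0) {v w : Fin 2 → ℂ}
    (h : ∀ j, wedge v (u j) = wedge w (u j)) : v = w := by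
  have h0 := h 0
  have h1 := h 1
  simp only [wedge] at h0 h1 hu
  ext i
  refine mul_right_cancel₀ hu ?_
  fin_cases i <;> simp only [Fin.zero_eta, Fin.mk_one]
  · linear_combination u 0 0 * h1 - u 1 0 * h0
  · linear_combination u 0 1 * h1 - u 1 1 * h0

lemma mobius_eq_one_of_fixed {z : Fin 3 → OnePoint ℂ} (hz : Function.Injective z)
    (h : ∀ i, A • z i = z i) : mobius A = 1 := by
  choose a ha haz using fun i => exists_mulVec_eq_smul (h i)
  have hdet : ∀ i j, i ≠ j → a i * a j = A.1.det := fun i j hij =>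
    mul_eq_det_of_mulVec_eq_smul (hz.ne hij) (haz i) (haz j)
  have h01 : a 0 = a 1 := mul_right_cancel₀ (ha 2)
    ((hdet 0 2 (by decide)).trans (hdet 1 2 (by decide)).symm)
  have hw : wedge (hc (z 0)) (hc (z 1)) ≠ 0 :=
    mt ((isHom_hc _).eq_iff_wedge (isHom_hc _)).2 (hz.ne (by decide))
  have hscalar : ∀ v, A.1.mulVec v = a 0 • v := fun v => by
    refine eq_of_wedge_eq (u := ![hc (z 0), hc (z 1)]) hw fun j => mul_left_cancel₀ (ha 0) ?_
    have hAj : A.1.mulVec (![hc (z 0), hc (z 1)] j) = a 0 • ![hc (z 0), hc (z 1)] j := by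
      fin_cases j
      · exact haz 0
      · exact h01 ▸ haz 1
    calc a 0 * wedge (A.1.mulVec v) (![hc (z 0), hc (z 1)] j)
        = wedge (A.1.mulVec v) (A.1.mulVec (![hc (z 0), hc (z 1)] j)) := by
          rw [hAj]
          simp only [wedge, Pi.smul_apply, smul_eq_mul]
          ring
      _ = a 0 * wedge (a 0 • v) (![hc (z 0), hc (z 1)] j) := by
          rw [wedge_mulVec, ← hdet 0 1 (by decide), ← h01]
          simp only [wedge, Pi.smul_apply, smul_eq_mul]
          ring
  refine Subtype.ext (Equiv.ext fun z => ?_)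
  change A • z = z
  rw [smul_eq_proj, hscalar, proj_smul (ha 0), proj_hc]

end FixedPoints

lemma free_tm (g : Rat1) (x : Rat2tm) (h : g • x = x) : g = 1 := by
  obtain ⟨A, rfl⟩ := surjective_mobius g
  obtain ⟨p, hp⟩ := isLiftSystem_tm.exists_lift x
  obtain ⟨i, hi0, hi1⟩ := M2tm.IsLift.exists_wedge_ne_zero ⟨x, hp, rfl⟩
  have hz0 : x.1.2.1 i ≠ x.1.2.2 0 := mt ((hp.2.1 i).eq_iff_wedge (hp.2.2 0)).1 hi0
  have hz1 : x.1.2.1 i ≠ x.1.2.2 1 := mt ((hp.2.1 i).eq_iff_wedge (hp.2.2 1)).1 hi1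
  refine mobius_eq_one_of_fixed (z := ![x.1.2.1 i, x.1.2.2 0, x.1.2.2 1]) ?_ ?_
  · simp [Function.Injective, Fin.forall_fin_succ, hz0, hz1, hz0.symm, hz1.symm, x.2.2.1,
      x.2.2.1.symm]
  · have hz : ∀ k, A • x.1.2.1 k = x.1.2.1 k :=
      congrFun (congrArg (fun y : Rat2tm => y.1.2.1) h)
    have hω : ∀ j, A • x.1.2.2 j = x.1.2.2 j :=
      congrFun (congrArg (fun y : Rat2tm => y.1.2.2) h)
    intro k
    fin_cases k
    exacts [hz i, hω 0, hω 1]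

section Swap

variable {x : Rat2tm}

lemma ratio_eq_zero_of_forget_eq (h : forget x = tripleFixed) : x.toModuli.ratio = 0 := by
  obtain ⟨p, hp⟩ := isLiftSystem_tm.exists_lift x
  have hz : x.1.2.1 = fun _ => OnePoint.infty := congrArg (fun t : Rat2fm => t.1.2) h
  have hl : Rat2tm.IsLift (p.1, fun i => hc (x.1.2.1 i), p.2.2) x :=
    ⟨hp.1, fun i => isHom_hc _, hp.2.2⟩
  rw [← M2tm.IsLift.ratio_eq ⟨x, hl, rfl⟩]
  ext i j
  simp [liftRatio, ratioNum, hz]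

lemma forget_smul (g : Rat1) (x : Rat2tm) : forget (g • x) = g • forget x := rfl

lemma ratio_eq_zero_iff_forget_mem_orbit :
    x.toModuli.ratio = 0 ↔ forget x ∈ MulAction.orbit Rat1 tripleFixed := by
  obtain ⟨x₀, hx₀⟩ := surjective_forget tripleFixed
  constructor
  · intro h
    rw [← ratio_eq_zero_of_forget_eq hx₀] at h
    obtain ⟨g, rfl⟩ := toModuli_tm_eq_iff.1 (M2tm.injective_ratio h)
    exact ⟨g, by rw [forget_smul, hx₀]⟩
  · rintro ⟨g, hg⟩
    have hx : forget (g⁻¹ • x) = tripleFixed := by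
      rw [forget_smul, ← hg]
      exact inv_smul_smul g tripleFixed
    rw [← ratio_eq_zero_of_forget_eq hx, toModuli_tm_eq_iff.2 ⟨g⁻¹, rfl⟩]

lemma exists_smul_eq_swap_smul_iff :
    (∃ g : Rat1, g • x = Equiv.swap (0 : Fin 2) 1 • x) ↔ x.toModuli.ratio = 0 := by
  rw [← toModuli_tm_eq_iff, ← M2tm.injective_ratio.eq_iff, M2tm.ratio_swap, neg_eq_self]

lemma swap_smul_ne (x : Rat2tm) : Equiv.swap (0 : Fin 2) 1 • x ≠ x := fun h =>
  x.2.2.1 (congrFun (congrArg (fun y : Rat2tm => y.1.2.2) h) 1)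

lemma exists_ne_one_smul_forget_eq_iff :
    (∃ g : Rat1, g ≠ 1 ∧ g • forget x = forget x) ↔
      ∃ g : Rat1, g • x = Equiv.swap (0 : Fin 2) 1 • x := by
  constructor
  · rintro ⟨g, hg, hgx⟩
    rw [← forget_smul, forget_eq_iff] at hgx
    obtain ⟨σ, hσ⟩ := hgx
    rcases eq_one_or_eq_swap σ with rfl | rfl
    · exact absurd (free_tm g x (hσ.symm.trans (one_smul _ x))) hg
    · exact ⟨g, hσ.symm⟩
  · rintro ⟨g, hg⟩
    refine ⟨g, ?_, ?_⟩
    · rintro rfl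
      exact swap_smul_ne x (hg.symm.trans (one_smul _ x))
    · rw [← forget_smul, hg]
      rfl

lemma exists_ne_one_smul_eq_iff_mem_orbit (x : Rat2fm) :
    (∃ g : Rat1, g ≠ 1 ∧ g • x = x) ↔ x ∈ MulAction.orbit Rat1 tripleFixed := by
  obtain ⟨x, rfl⟩ := surjective_forget x
  rw [exists_ne_one_smul_forget_eq_iff, exists_smul_eq_swap_smul_iff,
    ratio_eq_zero_iff_forget_mem_orbit]

end Swap

/-! ### Even analytic functions -/

section Even

variable {n : ℕ}

/-- The monomials `v_i v_j` of degree two in the coordinates of `v`. -/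
def quadMonomials (v : EuclideanSpace ℂ (Fin n)) : (Fin 2 → Fin n) → ℂ := fun k => ∏ b, v (k b)

/-- The standard basis vectors whose indices are the entries of a sequence of pairs. -/
def basisSeq {m : ℕ} (k : Fin m → Fin 2 → Fin n) (l : Fin (m * 2)) : EuclideanSpace ℂ (Fin n) :=
  EuclideanSpace.single (k (finProdFinEquiv.symm l).1 (finProdFinEquiv.symm l).2) 1

/-- The even part of a power series, rewritten as a power series in the monomials of degree
two: the term of degree `2m` is expanded in the standard basis, and its `2m` variables are grouped
into `m` pairs. -/
def evenSeries (p : FormalMultilinearSeries ℂ (EuclideanSpace ℂ (Fin n)) ℂ) :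
    FormalMultilinearSeries ℂ ((Fin 2 → Fin n) → ℂ) ℂ := fun m =>
  ∑ k : Fin m → Fin 2 → Fin n, p (m * 2) (basisSeq k) •
    (ContinuousMultilinearMap.mkPiAlgebra ℂ (Fin m) ℂ).compContinuousLinearMap
      fun l => ContinuousLinearMap.proj (k l)

variable (p : FormalMultilinearSeries ℂ (EuclideanSpace ℂ (Fin n)) ℂ)

lemma apply_eq_sum_basisSeq (m : ℕ) (v : EuclideanSpace ℂ (Fin n)) :
    (p (m * 2) fun _ => v) =
      ∑ k : Fin m → Fin 2 → Fin n, (∏ l, quadMonomials v (k l)) * p (m * 2) (basisSeq k) := by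
  let E : (Fin m → Fin 2 → Fin n) ≃ (Fin (m * 2) → Fin n) :=
    (Equiv.curry (Fin m) (Fin 2) (Fin n)).symm.trans
      (Equiv.arrowCongr finProdFinEquiv (Equiv.refl _))
  have hv : v = ∑ i, v i • EuclideanSpace.single i (1 : ℂ) := by
    simpa using ((EuclideanSpace.basisFun (Fin n) ℂ).sum_repr v).symm
  calc (p (m * 2) fun _ => v)
      = ∑ r : Fin (m * 2) → Fin n,
          (∏ l, v (r l)) • p (m * 2) fun l => EuclideanSpace.single (r l) (1 : ℂ) := by
        conv_lhs => rw [hv]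
        simp only [ContinuousMultilinearMap.map_sum, ContinuousMultilinearMap.map_smul_univ]
    _ = ∑ k, (∏ l, v (E k l)) • p (m * 2) fun l => EuclideanSpace.single (E k l) (1 : ℂ) :=
        (E.sum_comp _).symm
    _ = _ := by
        refine Finset.sum_congr rfl fun k _ => congrArg (· * p (m * 2) (basisSeq k)) ?_
        rw [← finProdFinEquiv.prod_comp, Fintype.prod_prod_type]
        simp [E, quadMonomials, Function.uncurry]

lemma evenSeries_apply (m : ℕ) (v : EuclideanSpace ℂ (Fin n)) :
    (evenSeries p m fun _ => quadMonomials v) = p (m * 2) fun _ => v := by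
  rw [apply_eq_sum_basisSeq]
  simp only [evenSeries, sum_apply, smul_apply,
    ContinuousMultilinearMap.compContinuousLinearMap_apply,
    ContinuousMultilinearMap.mkPiAlgebra_apply, ContinuousLinearMap.proj_apply, smul_eq_mul,
    mul_comm]

lemma norm_evenSeries_le (m : ℕ) : ‖evenSeries p m‖ ≤ (n ^ 2) ^ m * ‖p (m * 2)‖ := by
  have hterm : ∀ k : Fin m → Fin 2 → Fin n, ‖p (m * 2) (basisSeq k) •
      (ContinuousMultilinearMap.mkPiAlgebra ℂ (Fin m) ℂ).compContinuousLinearMap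
        fun l => (ContinuousLinearMap.proj (k l) : ((Fin 2 → Fin n) → ℂ) →L[ℂ] ℂ)‖ ≤
      ‖p (m * 2)‖ := by
    intro k
    refine ContinuousMultilinearMap.opNorm_le_bound (norm_nonneg _) fun M => ?_
    simp only [smul_apply,
      ContinuousMultilinearMap.compContinuousLinearMap_apply,
      ContinuousMultilinearMap.mkPiAlgebra_apply, ContinuousLinearMap.proj_apply, norm_smul]
    gcongr
    · refine ((p (m * 2)).le_opNorm _).trans ?_
      simp [basisSeq]
    · rw [norm_prod]
      gcongr with l
      exact norm_le_pi_norm (M l) (k l)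
  refine (norm_sum_le _ _).trans ((Finset.sum_le_sum fun k _ => hterm k).trans ?_)
  simp

variable {p} in
lemma evenSeries_radius_pos (hp : 0 < p.radius) : 0 < (evenSeries p).radius := by
  obtain ⟨r, hr0, hr⟩ := ENNReal.lt_iff_exists_nnreal_btwn.1 hp
  have hr0' : 0 < r := ENNReal.coe_pos.1 hr0
  obtain ⟨C, hC, hpC⟩ := p.norm_le_div_pow_of_pos_of_lt_radius hr0' hr
  have hle : ((r ^ 2 / (n ^ 2 + 1) : NNReal) : ENNReal) ≤ (evenSeries p).radius := by
    refine FormalMultilinearSeries.le_radius_of_bound _ C fun m => ?_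
    have hr1 : ((r : ℝ) ^ 2) ^ m ≠ 0 := by positivity
    calc ‖evenSeries p m‖ * ((r ^ 2 / (n ^ 2 + 1) : NNReal) : ℝ) ^ m
        ≤ ((n : ℝ) ^ 2 + 1) ^ m * (C / (r : ℝ) ^ (m * 2)) *
            ((r ^ 2 / (n ^ 2 + 1) : NNReal) : ℝ) ^ m := by
          gcongr
          refine (norm_evenSeries_le p m).trans ?_
          gcongr
          · linarith
          · exact hpC (m * 2)
      _ = C := by
          push_cast
          rw [div_pow, mul_comm m 2, pow_mul]
          field_simp
  refine lt_of_lt_of_le (ENNReal.coe_pos.2 ?_) hle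
  positivity

variable {p} in
lemma hasSum_even_terms {f : EuclideanSpace ℂ (Fin n) → ℂ} (heven : ∀ v, f (-v) = f v)
    {r : ENNReal} (hp : HasFPowerSeriesOnBall f p 0 r) {v : EuclideanSpace ℂ (Fin n)}
    (hv : v ∈ Metric.eball 0 r) : HasSum (fun m : ℕ => p (m * 2) fun _ => v) (f v) := by
  have hneg : ∀ k, (p k fun _ => -v) = (-1) ^ k * p k fun _ => v := fun k => by
    simpa using (p k).map_smul_univ (fun _ => (-1 : ℂ)) fun _ => v
  have hsum : HasSum (fun k => (1 / 2 : ℂ) * ((p k fun _ => v) + (p k fun _ => -v))) (f v) := by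
    have h₁ := hp.hasSum hv
    have h₂ := hp.hasSum (show -v ∈ Metric.eball 0 r by simpa using hv)
    simp only [zero_add, heven] at h₁ h₂
    simpa [← two_mul] using (h₁.add h₂).mul_left (1 / 2 : ℂ)
  have hinj : Function.Injective fun m : ℕ => m * 2 := mul_left_injective₀ two_ne_zero
  rw [← hinj.hasSum_iff] at hsum
  · convert hsum using 2 with m
    rw [Function.comp_apply, hneg, (even_two.mul_left m).neg_one_pow]
    ring
  · intro k hk
    have hodd : Odd k := by
      rw [← Nat.not_even_iff_odd]
      rintro ⟨l, hl⟩
      exact hk ⟨l, by simp only; omega⟩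
    rw [hneg, hodd.neg_one_pow]
    ring

lemma exists_analyticAt_quadMonomials {f : EuclideanSpace ℂ (Fin n) → ℂ} (hf : AnalyticAt ℂ f 0)
    (heven : ∀ v, f (-v) = f v) : ∃ G : ((Fin 2 → Fin n) → ℂ) → ℂ, AnalyticAt ℂ G 0 ∧
      ∀ᶠ v in 𝓝 0, f v = G (quadMonomials v) := by
  obtain ⟨p, r, hp⟩ := hf
  have hpos : 0 < p.radius := hp.r_pos.trans_le hp.r_le
  refine ⟨(evenSeries p).sum,
    ((evenSeries p).hasFPowerSeriesOnBall (evenSeries_radius_pos hpos)).analyticAt, ?_⟩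
  filter_upwards [Metric.eball_mem_nhds (0 : EuclideanSpace ℂ (Fin n)) hp.r_pos] with v hv
  rw [← (hasSum_even_terms heven hp hv).tsum_eq, FormalMultilinearSeries.sum]
  exact tsum_congr fun m => (evenSeries_apply p m v).symm

lemma eq_or_eq_neg_of_mul_eq {ι : Type*} {r s : ι → ℂ} (h : ∀ i j, r i * r j = s i * s j) :
    r = s ∨ r = -s := by
  by_cases hs : s = 0
  · refine Or.inl (funext fun i => ?_)
    simpa [hs] using h i i
  · obtain ⟨p, hp⟩ := Function.ne_iff.1 hs
    refine (mul_self_eq_mul_self_iff.1 (h p p)).imp (fun hpp => ?_) fun hpp => ?_ <;>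
      refine funext fun i => mul_right_cancel₀ hp ?_
    · rw [← h i p, hpp]
    · rw [Pi.neg_apply, neg_mul, ← h i p, hpp, mul_neg, neg_neg]

lemma quadMonomials_eq_iff {v w : EuclideanSpace ℂ (Fin n)} :
    quadMonomials v = quadMonomials w ↔ v = w ∨ v = -w := by
  constructor
  · intro h
    refine (eq_or_eq_neg_of_mul_eq fun i j => ?_).imp (WithLp.ofLp_injective 2 ·)
      (WithLp.ofLp_injective 2 ·)
    simpa [quadMonomials] using congrFun h ![i, j]
  · rintro (rfl | rfl)
    · rfl
    · ext k
      simp [quadMonomials, Fin.prod_univ_two]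

end Even

/-! ### The quadratic cone as a quotient of the plane -/

/-- The parametrization `(s, t) ↦ (s² - t², 2 s t, i (s² + t²))` of the cone
`z₁² + z₂² + z₃² = 0`, which identifies it with the quotient of the plane by `±1`. -/
def coneMap (v : EuclideanSpace ℂ (Fin 2)) : Brieskorn 2 2 2 :=
  ⟨![v 0 ^ 2 - v 1 ^ 2, 2 * (v 0 * v 1), Complex.I * (v 0 ^ 2 + v 1 ^ 2)], by
    simp only [Matrix.cons_val_zero, Matrix.cons_val_one, Matrix.cons_val]
    linear_combination (v 0 ^ 2 + v 1 ^ 2) ^ 2 * Complex.I_sq⟩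

/-- The monomials of degree two in `(s, t)` in terms of the coordinates of the cone, inverting the
linear relations of `coneMap`. -/
def coneMonomials (z : Fin 3 → ℂ) : (Fin 2 → Fin 2) → ℂ := fun k =>
  !![(z 0 - Complex.I * z 2) / 2, z 1 / 2; z 1 / 2, (-z 0 - Complex.I * z 2) / 2] (k 0) (k 1)

lemma contDiff_coneMap : ContDiff ℂ ω fun v => (coneMap v).1 := by
  refine contDiff_pi.2 fun i => ?_
  fin_cases i <;> simp only [coneMap, Fin.zero_eta, Fin.mk_one, Fin.reduceFinMk,
    Matrix.cons_val] <;> fun_prop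

lemma continuous_coneMap : Continuous coneMap :=
  Continuous.subtype_mk contDiff_coneMap.continuous _

lemma contDiff_coneMonomials : ContDiff ℂ ω coneMonomials := by
  refine contDiff_pi.2 fun k => ?_
  simp only [coneMonomials]
  generalize k 0 = i, k 1 = j
  fin_cases i <;> fin_cases j <;> simp only [Fin.zero_eta, Fin.mk_one, Fin.isValue,
    Matrix.of_apply, Matrix.cons_val] <;> fun_prop

lemma coneMonomials_coneMap (v : EuclideanSpace ℂ (Fin 2)) :
    coneMonomials (coneMap v).1 = quadMonomials v := by
  ext k
  simp only [coneMonomials, quadMonomials, Fin.prod_univ_two, coneMap]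
  generalize k 0 = i, k 1 = j
  fin_cases i <;> fin_cases j <;> simp only [Fin.zero_eta, Fin.mk_one, Fin.isValue,
    Matrix.of_apply, Matrix.cons_val]
  · linear_combination (-(v 0 ^ 2 + v 1 ^ 2) / 2) * Complex.I_sq
  · ring
  · ring
  · linear_combination (-(v 0 ^ 2 + v 1 ^ 2) / 2) * Complex.I_sq

lemma injective_coneMonomials : Function.Injective coneMonomials := by
  intro z w h
  have h00 := congrFun h ![0, 0]
  have h01 := congrFun h ![0, 1]
  have h11 := congrFun h ![1, 1]
  simp only [coneMonomials, Matrix.of_apply, Matrix.cons_val] at h00 h01 h11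
  ext i
  fin_cases i <;> simp only [Fin.zero_eta, Fin.mk_one, Fin.reduceFinMk]
  · linear_combination h00 - h11
  · linear_combination 2 * h01
  · linear_combination Complex.I * (h00 + h11) + (z 2 - w 2) * Complex.I_sq

lemma coneMap_eq_iff {v w : EuclideanSpace ℂ (Fin 2)} :
    coneMap v = coneMap w ↔ v = w ∨ v = -w := by
  rw [← quadMonomials_eq_iff, ← coneMonomials_coneMap, ← coneMonomials_coneMap,
    injective_coneMonomials.eq_iff, Subtype.ext_iff]

lemma coneMap_neg (v : EuclideanSpace ℂ (Fin 2)) : coneMap (-v) = coneMap v :=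
  coneMap_eq_iff.2 (Or.inr rfl)

lemma surjective_coneMap : Function.Surjective coneMap := by
  intro z
  obtain ⟨s, hs⟩ := IsAlgClosed.exists_pow_nat_eq ((z.1 0 - Complex.I * z.1 2) / 2) two_pos
  obtain ⟨t, ht⟩ := IsAlgClosed.exists_pow_nat_eq ((-z.1 0 - Complex.I * z.1 2) / 2) two_pos
  have hcone : ∀ u, u ^ 2 = t ^ 2 → s * u = z.1 1 / 2 → coneMap !₂[s, u] = z := by
    intro u hu hsu
    refine Subtype.ext (injective_coneMonomials ?_)
    rw [coneMonomials_coneMap]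
    ext k
    simp only [coneMonomials, quadMonomials, Fin.prod_univ_two]
    generalize k 0 = i, k 1 = j
    fin_cases i <;> fin_cases j <;> simp only [Fin.zero_eta, Fin.mk_one, Fin.isValue,
      Matrix.of_apply, Matrix.cons_val]
    · rw [← hs, sq]
    · exact hsu
    · rw [mul_comm, hsu]
    · rw [← ht, ← hu, sq]
  have hst : (s * t) ^ 2 = (z.1 1 / 2) ^ 2 := by
    rw [mul_pow, hs, ht]
    linear_combination (-1 / 4 : ℂ) * z.2 + (z.1 2 ^ 2 / 4) * Complex.I_sq
  rcases sq_eq_sq_iff_eq_or_eq_neg.1 hst with h | h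
  · exact ⟨_, hcone t rfl h⟩
  · exact ⟨_, hcone (-t) (neg_sq t) (by rw [mul_neg, h, neg_neg])⟩

lemma norm_coneMonomials_le (z : Fin 3 → ℂ) (k : Fin 2 → Fin 2) : ‖coneMonomials z k‖ ≤ ‖z‖ := by
  have hz : ∀ i, ‖z i‖ ≤ ‖z‖ := norm_le_pi_norm z
  have hdiag : ∀ a b : ℂ, ‖a‖ ≤ ‖z‖ → ‖b‖ ≤ ‖z‖ → ‖(a - Complex.I * b) / 2‖ ≤ ‖z‖ := by
    intro a b ha hb
    have := norm_sub_le a (Complex.I * b)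
    rw [norm_mul, Complex.norm_I, one_mul] at this
    rw [norm_div, Complex.norm_ofNat]
    linarith
  have hhalf : ‖z 1 / 2‖ ≤ ‖z‖ := by
    rw [norm_div, Complex.norm_ofNat]
    linarith [hz 1, norm_nonneg z]
  simp only [coneMonomials]
  generalize k 0 = i, k 1 = j
  fin_cases i <;> fin_cases j <;> simp only [Fin.zero_eta, Fin.mk_one, Fin.isValue,
    Matrix.of_apply, Matrix.cons_val]
  · exact hdiag _ _ (hz 0) (hz 2)
  · exact hhalf
  · exact hhalf
  · exact hdiag _ _ ((norm_neg _).trans_le (hz 0)) (hz 2)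

lemma norm_sq_le_coneMap (v : EuclideanSpace ℂ (Fin 2)) : ‖v‖ ^ 2 ≤ 2 * ‖(coneMap v).1‖ := by
  have hv : ∀ i, ‖v i‖ ^ 2 ≤ ‖(coneMap v).1‖ := fun i => by
    have h := norm_coneMonomials_le (coneMap v).1 fun _ => i
    rwa [coneMonomials_coneMap, quadMonomials, Fin.prod_univ_two, ← sq, norm_pow] at h
  rw [EuclideanSpace.norm_sq_eq, Fin.sum_univ_two]
  linarith [hv 0, hv 1]

lemma isClosedMap_coneMap : IsClosedMap coneMap := by
  have hproper : IsProperMap fun v => (coneMap v).1 := by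
    rw [isProperMap_iff_tendsto_cocompact, ← Metric.cobounded_eq_cocompact,
      ← Metric.cobounded_eq_cocompact, ← tendsto_norm_atTop_iff_cobounded]
    have h : Filter.Tendsto (fun v : EuclideanSpace ℂ (Fin 2) => ‖v‖ ^ 2 / 2)
        (Bornology.cobounded _) Filter.atTop :=
      ((Filter.tendsto_pow_atTop two_ne_zero).comp tendsto_norm_cobounded_atTop).atTop_div_const
        two_pos
    exact ⟨contDiff_coneMap.continuous, Filter.tendsto_atTop_mono
      (fun v => by linarith [norm_sq_le_coneMap v]) h⟩
  exact (isProperMap_of_comp_of_inj continuous_coneMap continuous_subtype_val hproper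
    Subtype.val_injective).isClosedMap

lemma isOpenMap_coneMap : IsOpenMap coneMap := by
  intro U hU
  have hquot := isClosedMap_coneMap.isQuotientMap continuous_coneMap surjective_coneMap
  have hpre : coneMap ⁻¹' (coneMap '' U) = U ∪ -U := by
    ext v
    constructor
    · rintro ⟨w, hw, h⟩
      rcases coneMap_eq_iff.1 h with rfl | rfl
      · exact Or.inl hw
      · exact Or.inr hw
    · rintro (hv | hv)
      · exact ⟨v, hv, rfl⟩
      · exact ⟨-v, hv, coneMap_neg v⟩
  rw [← hquot.isOpen_preimage, hpre]
  exact hU.union hU.neg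

/-! ### Holomorphic functions on the cone -/

lemma exists_analyticAt_sqrt {b : ℂ} (hb : b ≠ 0) :
    ∃ s : ℂ → ℂ, AnalyticAt ℂ s (b ^ 2) ∧ s (b ^ 2) = b ∧ ∀ d, s d ^ 2 = d := by
  have hb2 : b ^ 2 ≠ 0 := pow_ne_zero 2 hb
  refine ⟨fun d => b * (d / b ^ 2) ^ ((2 : ℕ) : ℂ)⁻¹, ?_, ?_, fun d => ?_⟩
  · have hdiv : AnalyticAt ℂ (fun d : ℂ => d / b ^ 2) (b ^ 2) :=
      analyticAt_id.fun_div analyticAt_const hb2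
    refine analyticAt_const.mul (hdiv.cpow analyticAt_const ?_)
    rw [div_self hb2]
    exact Complex.one_mem_slitPlane
  · simp only [div_self hb2, Complex.one_cpow, mul_one]
  · rw [mul_pow, Complex.cpow_nat_inv_pow _ two_ne_zero, mul_div_cancel₀ _ hb2]

lemma exists_analyticAt_cone_section {v : EuclideanSpace ℂ (Fin 2)} (hv : v ≠ 0) :
    ∃ ψ : (Fin 3 → ℂ) → EuclideanSpace ℂ (Fin 2), AnalyticAt ℂ ψ (coneMap v).1 ∧
      ψ (coneMap v).1 = v ∧ ∀ᶠ z : Brieskorn 2 2 2 in 𝓝 (coneMap v), coneMap (ψ z.1) = z := by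
  obtain ⟨i, hi⟩ : ∃ i, v i ≠ 0 := by
    by_contra! h
    exact hv (PiLp.ext h)
  obtain ⟨s, hs, hsv, hs2⟩ := exists_analyticAt_sqrt hi
  have hmon : ∀ w : EuclideanSpace ℂ (Fin 2), ∀ j,
      coneMonomials (coneMap w).1 ![i, j] = w i * w j := fun w j => by
    simp [coneMonomials_coneMap, quadMonomials]
  have hcoord : ∀ k, AnalyticAt ℂ (fun z => coneMonomials z k) (coneMap v).1 := fun k =>
    analyticAt_of_contDiff (contDiff_pi.1 contDiff_coneMonomials k) _
  have ht : AnalyticAt ℂ (fun z => s (coneMonomials z ![i, i])) (coneMap v).1 :=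
    AnalyticAt.fun_comp (by rwa [hmon, ← sq]) (hcoord _)
  have htv : s (coneMonomials (coneMap v).1 ![i, i]) = v i := by rw [hmon, ← sq, hsv]
  refine ⟨fun z => WithLp.toLp 2 fun j =>
    coneMonomials z ![i, j] / s (coneMonomials z ![i, i]), ?_, ?_, ?_⟩
  · have hpi := AnalyticAt.pi fun j => (hcoord ![i, j]).fun_div ht (by rwa [htv])
    exact ((EuclideanSpace.equiv (Fin 2) ℂ).symm.toContinuousLinearMap.analyticAt _).comp hpi
  · ext j
    exact (congrArg₂ (· / ·) (hmon v j) htv).trans (mul_div_cancel_left₀ _ hi)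
  · have hne : ∀ᶠ z in 𝓝 (coneMap v).1, s (coneMonomials z ![i, i]) ≠ 0 :=
      ht.continuousAt.eventually_ne (by rwa [htv])
    filter_upwards [continuous_subtype_val.continuousAt.eventually hne] with z hz
    obtain ⟨w, rfl⟩ := surjective_coneMap z
    refine coneMap_eq_iff.2 ?_
    have hsq : s (coneMonomials (coneMap w).1 ![i, i]) ^ 2 = w i ^ 2 := by rw [hs2, hmon, sq]
    refine (sq_eq_sq_iff_eq_or_eq_neg.1 hsq).imp (fun h => ?_) fun h => ?_ <;>
      rw [h] at hz ⊢ <;> ext j <;> simp only [hmon, PiLp.neg_apply]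
    · exact mul_div_cancel_left₀ _ hz
    · rw [div_neg, mul_div_cancel_left₀ _ (neg_ne_zero.1 hz)]

lemma cone_holAt_zero {g : Brieskorn 2 2 2 → ℂ} (hg : AnalyticAt ℂ (g ∘ coneMap) 0) :
    Brieskorn.HolAt 2 2 2 g (coneMap 0) := by
  obtain ⟨G, hG, h⟩ := exists_analyticAt_quadMonomials hg fun v => by
    simp only [Function.comp_apply, coneMap_neg]
  have hz : coneMonomials (coneMap 0).1 = 0 := by
    rw [coneMonomials_coneMap]
    ext k
    simp [quadMonomials]
  refine ⟨G ∘ coneMonomials,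
    AnalyticAt.comp (by rwa [hz]) (analyticAt_of_contDiff contDiff_coneMonomials _), ?_⟩
  filter_upwards [isOpenMap_coneMap.image_mem_nhds h]
  rintro _ ⟨w, hw, rfl⟩
  rw [Function.comp_apply, coneMonomials_coneMap]
  exact hw

lemma cone_holAt_iff (g : Brieskorn 2 2 2 → ℂ) (v : EuclideanSpace ℂ (Fin 2)) :
    Brieskorn.HolAt 2 2 2 g (coneMap v) ↔ AnalyticAt ℂ (g ∘ coneMap) v := by
  constructor
  · rintro ⟨G, hG, h⟩
    refine (AnalyticAt.fun_comp (f := fun w => (coneMap w).1) hG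
      (analyticAt_of_contDiff contDiff_coneMap v)).congr ?_
    filter_upwards [continuous_coneMap.continuousAt.eventually h] with w hw
    exact hw.symm
  · intro hg
    obtain rfl | hv := eq_or_ne v 0
    · exact cone_holAt_zero hg
    · obtain ⟨ψ, hψ, hψv, h⟩ := exists_analyticAt_cone_section hv
      refine ⟨(g ∘ coneMap) ∘ ψ, AnalyticAt.comp (by rwa [hψv]) hψ, ?_⟩
      filter_upwards [h] with z hz
      simp only [Function.comp_apply, hz]

/-! ### The cone is singular at the origin -/

section Singular

variable {E : Type*} [NormedAddCommGroup E] [NormedSpace ℂ E]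

lemma exists_ne_zero_of_mul_eq_neg_sq {K V : Type*} [Field K] [AddCommGroup V] [Module K V]
    [FiniteDimensional K V] (hV : 1 < Module.finrank K V) {a b c : V →ₗ[K] K}
    (h : ∀ w, a w * b w = -c w ^ 2) : ∃ w ≠ 0, a w = 0 ∧ b w = 0 ∧ c w = 0 := by
  have hker : ∀ l : V →ₗ[K] K, ∃ w ≠ 0, l w = 0 := fun l => by
    have hl : l.ker ≠ ⊥ := l.ker_ne_bot_of_finrank_lt (by rwa [Module.finrank_self])
    obtain ⟨w, hw, hw0⟩ := l.ker.ne_bot_iff.1 hl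
    exact ⟨w, hw0, hw⟩
  have hc : ∀ w, a w = 0 → c w = 0 := fun w hw => by simpa [hw] using h w
  by_cases ha : a = 0
  · obtain ⟨w, hw0, hw⟩ := hker b
    have haw : a w = 0 := by rw [ha, LinearMap.zero_apply]
    exact ⟨w, hw0, haw, hw, hc w haw⟩
  · obtain ⟨u, hu⟩ := DFunLike.ne_iff.1 ha
    obtain ⟨w, hw0, hw⟩ := hker a
    have huw := h (u + w)
    simp only [map_add, hw, hc w hw, add_zero] at huw
    refine ⟨w, hw0, hw, mul_left_cancel₀ hu ?_, hc w hw⟩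
    linear_combination huw - h u

lemma fderiv_mem_cone {ψ : E → Fin 3 → ℂ} {L : E →L[ℂ] Fin 3 → ℂ} {y : E}
    (hL : HasFDerivAt ψ L y) (hy : ψ y = 0)
    (hψ : ∀ x, ψ x 0 ^ 2 + ψ x 1 ^ 2 + ψ x 2 ^ 2 = 0) (w : E) :
    L w 0 ^ 2 + L w 1 ^ 2 + L w 2 ^ 2 = 0 := by
  have hslope := (hL.hasLineDerivAt w).tendsto_slope_zero
  have hclosed : IsClosed {z : Fin 3 → ℂ | z 0 ^ 2 + z 1 ^ 2 + z 2 ^ 2 = 0} :=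
    isClosed_eq (by fun_prop) continuous_const
  refine hclosed.mem_of_tendsto hslope (Filter.Eventually.of_forall fun t => ?_)
  have h := hψ (y + t • w)
  simp only [hy, sub_zero, Set.mem_ofPred_eq, Pi.smul_apply, smul_eq_mul]
  linear_combination t⁻¹ ^ 2 * h

lemma not_hasFDerivAt_cone_of_leftInverse [FiniteDimensional ℂ E]
    (hE : 1 < Module.finrank ℂ E) {ψ : E → Fin 3 → ℂ} {G : (Fin 3 → ℂ) → E} {y : E}
    (hψd : DifferentiableAt ℂ ψ y) (hG : DifferentiableAt ℂ G (ψ y)) (hy : ψ y = 0)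
    (hψ : ∀ x, ψ x 0 ^ 2 + ψ x 1 ^ 2 + ψ x 2 ^ 2 = 0) : ¬ ∀ᶠ x in 𝓝 y, G (ψ x) = x := by
  intro hleft
  set L := fderiv ℂ ψ y
  have hcone := fderiv_mem_cone hψd.hasFDerivAt hy hψ
  have hid : (fderiv ℂ G (ψ y)).comp L = ContinuousLinearMap.id ℂ E :=
    (hG.hasFDerivAt.comp y hψd.hasFDerivAt).unique ((hasFDerivAt_id y).congr_of_eventuallyEq hleft)
  let Z : Fin 3 → E →ₗ[ℂ] ℂ := fun j => LinearMap.proj j ∘ₗ (L : E →ₗ[ℂ] Fin 3 → ℂ)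
  obtain ⟨w, hw0, ha, hb, hc⟩ := exists_ne_zero_of_mul_eq_neg_sq hE
    (a := Z 0 + Complex.I • Z 1) (b := Z 0 - Complex.I • Z 1) (c := Z 2) fun w => by
      simp only [Z, LinearMap.add_apply, LinearMap.sub_apply, LinearMap.smul_apply,
        LinearMap.comp_apply, LinearMap.proj_apply, ContinuousLinearMap.coe_coe, smul_eq_mul]
      linear_combination hcone w - L w 1 ^ 2 * Complex.I_sq
  refine hw0 ?_
  have hZ : ∀ j, L w j = 0 := by
    have h0 : Z 0 w = 0 := by
      simp only [LinearMap.add_apply, LinearMap.sub_apply] at ha hb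
      linear_combination (ha + hb) / 2
    have h1 : Z 1 w = 0 := by
      rw [LinearMap.add_apply, h0, zero_add, LinearMap.smul_apply, smul_eq_mul] at ha
      exact (mul_eq_zero.1 ha).resolve_left Complex.I_ne_zero
    intro j
    fin_cases j
    exacts [h0, h1, hc]
  calc w = fderiv ℂ G (ψ y) (L w) := (DFunLike.congr_fun hid w).symm
    _ = 0 := by rw [show L w = 0 from funext hZ, map_zero]

lemma not_isSmoothPoint_cone {z : Brieskorn 2 2 2} (hz : z.1 = 0) :
    ¬ IsSmoothPoint 2 (Brieskorn.HolAt 2 2 2) z := by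
  rintro ⟨e, hx, he⟩
  have hy := e.map_source hx
  have hez : e.symm (e z) = z := e.left_inv hx
  have hG : ∀ i : Fin 2, ∃ G : (Fin 3 → ℂ) → ℂ, AnalyticAt ℂ G z.1 ∧
      ∀ᶠ x in 𝓝 z, e x i = G x.1 := fun i =>
    (he z hx fun y => y i).1 (analyticAt_of_contDiff (by fun_prop) _)
  have hψ : AnalyticAt ℂ (fun y => (e.symm y).1) (e z) := AnalyticAt.pi fun j => by
    refine (he z hx fun y => (e.symm y).1 j).2
      ⟨fun x => x j, analyticAt_of_contDiff (by fun_prop) _, ?_⟩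
    filter_upwards [e.open_source.mem_nhds hx] with x hx
    simp only [Function.comp_apply, e.left_inv hx]
  choose G hGa hGe using hG
  refine not_hasFDerivAt_cone_of_leftInverse (G := fun x => WithLp.toLp 2 fun i => G i x)
    (by simp) hψ.differentiableAt ?_ (by rw [hez, hz]) (fun y => (e.symm y).2) ?_
  · rw [hez]
    exact (((EuclideanSpace.equiv (Fin 2) ℂ).symm.toContinuousLinearMap.analyticAt _).comp
      (AnalyticAt.pi hGa)).differentiableAt
  · have hGe' : ∀ᶠ x in 𝓝 (e.symm (e z)), ∀ i, e x i = G i x.1 := by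
      rwa [hez, Filter.eventually_all]
    filter_upwards [(e.continuousAt_symm hy).eventually hGe', e.open_target.mem_nhds hy]
      with y h₁ h₂
    rw [e.right_inv h₂] at h₁
    exact PiLp.ext fun i => (h₁ i).symm

end Singular

/-! ### The moduli space of fixed point marked maps -/

/-- The map between moduli spaces forgetting the critical points. -/
def forgetM : M2tm → M2fm := Quotient.map forget fun _ _ ⟨g, h⟩ => ⟨g, congrArg forget h⟩

lemma surjective_forgetM : Function.Surjective forgetM := by
  intro m
  obtain ⟨y, rfl⟩ := isOpenQuotientMap_toModuli_fm.surjective m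
  obtain ⟨x, rfl⟩ := surjective_forget y
  exact ⟨x.toModuli, rfl⟩

lemma isOpenQuotientMap_forgetM : IsOpenQuotientMap forgetM := by
  have hcomp : IsOpenQuotientMap (forgetM ∘ Rat2tm.toModuli) :=
    isOpenQuotientMap_toModuli_fm.comp ⟨surjective_forget, continuous_forget, isOpenMap_forget⟩
  refine ⟨surjective_forgetM,
    isOpenQuotientMap_toModuli_tm.isQuotientMap.continuous_iff.2 hcomp.continuous, fun U hU => ?_⟩
  rw [← Set.image_preimage_eq U isOpenQuotientMap_toModuli_tm.surjective, ← Set.image_comp]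
  exact hcomp.isOpenMap _ (hU.preimage isOpenQuotientMap_toModuli_tm.continuous)

lemma exists_toModuli_eq {x : Rat2fm} {m : M2tm} (h : x.toModuli = forgetM m) :
    ∃ y : Rat2tm, forget y = x ∧ y.toModuli = m := by
  obtain ⟨y, rfl⟩ := isOpenQuotientMap_toModuli_tm.surjective m
  obtain ⟨g, hg⟩ := Quotient.exact h
  exact ⟨g • y, hg, toModuli_tm_eq_iff.2 ⟨g, rfl⟩⟩

lemma dependsOnGerm_m2fm : DependsOnGerm M2fm.HolAt := by
  have hL := isLiftSystem_fm.quotient isOpenQuotientMap_toModuli_fm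
  rw [show M2fm.HolAt = LiftHolAt _ from funext₂ fun _ _ => propext liftHolAt_quotient.symm]
  exact hL.dependsOnGerm

lemma holAt_forgetM_iff (g : M2fm → ℂ) (m : M2tm) :
    M2fm.HolAt g (forgetM m) ↔ M2tm.HolAt (g ∘ forgetM) m := by
  constructor
  · rintro h x rfl
    exact (holAt_forget_iff (g ∘ Rat2fm.toModuli) x).1 (h (forget x) rfl)
  · intro h x hx
    obtain ⟨y, rfl, rfl⟩ := exists_toModuli_eq hx
    exact (holAt_forget_iff (g ∘ Rat2fm.toModuli) y).2 (h y rfl)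

section Fibres

variable {m m' : M2tm}

lemma exists_ratio_eq_neg (m : M2tm) :
    ∃ m' : M2tm, forgetM m' = forgetM m ∧ m'.ratio = -m.ratio := by
  obtain ⟨x, rfl⟩ := isOpenQuotientMap_toModuli_tm.surjective m
  exact ⟨(Equiv.swap (0 : Fin 2) 1 • x).toModuli, rfl, M2tm.ratio_swap x⟩

lemma forgetM_eq_iff : forgetM m = forgetM m' ↔ m.ratio = m'.ratio ∨ m.ratio = -m'.ratio := by
  constructor
  · intro h
    obtain ⟨x, rfl⟩ := isOpenQuotientMap_toModuli_tm.surjective m'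
    obtain ⟨y, hy, rfl⟩ := exists_toModuli_eq (x := forget x) h.symm
    obtain ⟨σ, rfl⟩ := forget_eq_iff.1 hy
    rcases eq_one_or_eq_swap σ with rfl | rfl
    · exact Or.inl (by rw [one_smul])
    · exact Or.inr (M2tm.ratio_swap x)
  · rintro (h | h)
    · rw [M2tm.injective_ratio h]
    · obtain ⟨n, hn, hn'⟩ := exists_ratio_eq_neg m'
      rw [← hn, M2tm.injective_ratio (h.trans hn'.symm)]

lemma forgetM_eq_tripleFixed_iff : forgetM m = Rat2fm.toModuli tripleFixed ↔ m.ratio = 0 := by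
  obtain ⟨x, rfl⟩ := isOpenQuotientMap_toModuli_tm.surjective m
  rw [ratio_eq_zero_iff_forget_mem_orbit]
  exact Quotient.eq

end Fibres

instance : T2Space M2fm := by
  have hratio : Continuous M2tm.ratio :=
    continuous_pi fun i => continuous_pi fun j => M2tm.continuous_ratio i j
  rw [t2Space_iff_of_isOpenQuotientMap isOpenQuotientMap_forgetM]
  simp only [forgetM_eq_iff]
  exact (isClosed_eq (hratio.comp continuous_fst) (hratio.comp continuous_snd)).union
    (isClosed_eq (hratio.comp continuous_fst) (hratio.comp continuous_snd).neg)

instance : SecondCountableTopology M2fm := ContinuousConstSMul.secondCountableTopology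

lemma injOn_forgetM_ball (c : ℂ) (i j : Fin 3) :
    Set.InjOn forgetM {m | m.ratio i j ∈ Metric.ball c ‖c‖} := by
  intro m hm m' hm' h
  rcases forgetM_eq_iff.1 h with h | h
  · exact M2tm.injective_ratio h
  · have hneg : -m'.ratio i j ∈ Metric.ball c ‖c‖ := by
      rw [← Pi.neg_apply, ← Pi.neg_apply, ← h]
      exact hm
    have h0 : (0 : ℂ) ∈ Metric.ball c ‖c‖ := by
      simpa using (convex_ball c ‖c‖).midpoint_mem hm' hneg
    simp at h0

lemma isSmoothPoint_m2fm {m : M2tm} (hm : m.ratio ≠ 0) :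
    IsSmoothPoint 2 M2fm.HolAt (forgetM m) := by
  obtain ⟨i, hi⟩ := Function.ne_iff.1 hm
  obtain ⟨j, hij⟩ := Function.ne_iff.1 hi
  have : Nonempty M2tm := ⟨m⟩
  obtain ⟨e, he, hef⟩ := exists_openPartialHomeomorph
    (Metric.isOpen_ball.preimage (M2tm.continuous_ratio i j))
    isOpenQuotientMap_forgetM.continuous.continuousOn (injOn_forgetM_ball (m.ratio i j) i j)
    fun U _ hU => isOpenQuotientMap_forgetM.isOpenMap U hU
  have hme : m ∈ e.source := he ▸ Metric.mem_ball_self (norm_pos_iff.2 hij)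
  have hbi : IsBiholomorphic M2tm.HolAt M2fm.HolAt e := fun x _ g => by
    rw [hef]
    exact holAt_forgetM_iff g x
  rw [← hef]
  refine .of_isBiholomorphic (hbi.symm dependsOnGerm_m2tm) (e.map_source hme) ?_
  exact isSmoothPoint_m2tm _

/-! ### The singular point -/

lemma ratioChart_eq_neg {m m' : M2tm} (h : m.ratio = -m'.ratio) (i : Fin 3) :
    M2tm.ratioChart i m = -M2tm.ratioChart i m' := by
  simp only [M2tm.ratioChart, h]
  rfl

lemma continuous_ratioChart (i : Fin 3) : Continuous (M2tm.ratioChart i) :=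
  (PiLp.continuous_toLp 2 _).comp (continuous_pi fun j => M2tm.continuous_ratio i (i.succAbove j))

lemma factorsThrough_forgetM_coneMap :
    Function.FactorsThrough (coneMap ∘ M2tm.ratioChart 0) forgetM := fun m m' h => by
  rcases forgetM_eq_iff.1 h with h | h
  · rw [M2tm.injective_ratio h]
  · exact (congrArg coneMap (ratioChart_eq_neg h 0)).trans (coneMap_neg _)

/-- The map from the moduli space of fixed point marked maps to the quadratic cone induced by the
coordinates `M2tm.ratioChart 0`. -/
def toCone : C(M2fm, Brieskorn 2 2 2) :=
  Topology.IsQuotientMap.lift (f := ⟨forgetM, isOpenQuotientMap_forgetM.continuous⟩)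
    isOpenQuotientMap_forgetM.isQuotientMap
    ⟨_, continuous_coneMap.comp (continuous_ratioChart 0)⟩ factorsThrough_forgetM_coneMap

lemma toCone_comp_forgetM : toCone ∘ forgetM = coneMap ∘ M2tm.ratioChart 0 :=
  congrArg DFunLike.coe (Topology.IsQuotientMap.lift_comp
    (f := ⟨forgetM, isOpenQuotientMap_forgetM.continuous⟩) isOpenQuotientMap_forgetM.isQuotientMap
    ⟨_, continuous_coneMap.comp (continuous_ratioChart 0)⟩ factorsThrough_forgetM_coneMap)

lemma toCone_forgetM (m : M2tm) : toCone (forgetM m) = coneMap (M2tm.ratioChart 0 m) :=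
  congrFun toCone_comp_forgetM m

/-- The classes of the maps whose first fixed point is not critical. -/
def coneDomain : Set M2fm := forgetM '' M2tm.ratioDomain 0

lemma forgetM_mem_coneDomain_iff {m : M2tm} :
    forgetM m ∈ coneDomain ↔ m ∈ M2tm.ratioDomain 0 := by
  refine ⟨?_, Set.mem_image_of_mem _⟩
  rintro ⟨m', hm', h⟩
  rcases forgetM_eq_iff.1 h with h | h
  · rwa [← M2tm.injective_ratio h]
  · simpa [M2tm.ratioDomain, h] using hm'

lemma isOpen_coneDomain : IsOpen coneDomain :=
  isOpenQuotientMap_forgetM.isOpenMap _ (M2tm.isOpen_ratioDomain 0)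

lemma injOn_toCone : Set.InjOn toCone coneDomain := by
  rintro _ ⟨m, hm, rfl⟩ _ ⟨m', hm', rfl⟩ h
  rw [toCone_forgetM, toCone_forgetM, coneMap_eq_iff] at h
  rcases h with h | h
  · rw [M2tm.injOn_ratioChart 0 hm hm' h]
  · obtain ⟨n, hn, hneg⟩ := exists_ratio_eq_neg m'
    rw [← forgetM_mem_coneDomain_iff, ← hn, forgetM_mem_coneDomain_iff] at hm'
    rw [← ratioChart_eq_neg hneg] at h
    rw [← hn, M2tm.injOn_ratioChart 0 hm hm' h]

lemma isOpen_image_toCone {U : Set M2fm} (hUS : U ⊆ coneDomain) (hU : IsOpen U) :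
    IsOpen (toCone '' U) := by
  obtain ⟨e, hes, hef, -⟩ := exists_chart_m2tm 0
  have himage : toCone '' U = coneMap '' (e '' (forgetM ⁻¹' U)) := by
    rw [hef, ← Set.image_comp, ← toCone_comp_forgetM, Set.image_comp,
      Set.image_preimage_eq _ surjective_forgetM]
  rw [himage]
  refine isOpenMap_coneMap _ (e.isOpen_image_of_subset_source
    (hU.preimage isOpenQuotientMap_forgetM.continuous) fun m hm => ?_)
  rw [hes, ← forgetM_mem_coneDomain_iff]
  exact hUS hm

lemma toCone_holAt_iff {m : M2fm} (hm : m ∈ coneDomain) (g : Brieskorn 2 2 2 → ℂ) :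
    Brieskorn.HolAt 2 2 2 g (toCone m) ↔ M2fm.HolAt (g ∘ toCone) m := by
  obtain ⟨m, hm, rfl⟩ := hm
  obtain ⟨e, hes, hef, he⟩ := exists_chart_m2tm 0
  rw [toCone_forgetM, cone_holAt_iff, holAt_forgetM_iff, Function.comp_assoc, toCone_comp_forgetM,
    ← hef]
  exact he m (hes ▸ hm) (g ∘ coneMap)

lemma hasSingularityType_m2fm :
    HasSingularityType 2 2 2 M2fm.HolAt (Rat2fm.toModuli tripleFixed) := by
  obtain ⟨m, hm⟩ := surjective_forgetM (Rat2fm.toModuli tripleFixed)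
  have hratio : m.ratio = 0 := forgetM_eq_tripleFixed_iff.1 hm
  have : Nonempty M2fm := ⟨forgetM m⟩
  have hchart : M2tm.ratioChart 0 m = 0 := by
    rw [M2tm.ratioChart, hratio]
    rfl
  obtain ⟨e, hes, hef⟩ := exists_openPartialHomeomorph isOpen_coneDomain
    toCone.continuous.continuousOn injOn_toCone fun U => isOpen_image_toCone
  rw [← hm]
  refine ⟨e, ?_, ?_, fun m' hm' g => ?_⟩
  · rw [hes, coneDomain]
    exact Set.mem_image_of_mem _ (by simp [M2tm.ratioDomain, hratio])
  · rw [hef, toCone_forgetM]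
    ext i
    fin_cases i <;> simp [coneMap, hchart]
  · rw [hef]
    exact toCone_holAt_iff (hes ▸ hm') g

lemma not_isSmoothPoint_m2fm_iff (m : M2fm) :
    ¬ IsSmoothPoint 2 M2fm.HolAt m ↔ m = Rat2fm.toModuli tripleFixed := by
  constructor
  · obtain ⟨n, rfl⟩ := surjective_forgetM m
    rw [forgetM_eq_tripleFixed_iff]
    exact not_imp_comm.1 isSmoothPoint_m2fm
  · rintro rfl h
    obtain ⟨e, hx, h0, he⟩ := hasSingularityType_m2fm
    refine not_isSmoothPoint_cone h0
      (.of_isBiholomorphic (he.symm dependsOnGerm_m2fm) (e.map_source hx) ?_)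
    rwa [e.left_inv hx]

end QuadRat

end

open QuadRat

theorem lemma6p6 :
    -- the two spaces of marked maps
    IsComplexManifold 5 Rat2fm.HolAt ∧
    IsComplexManifold 5 Rat2tm.HolAt ∧
    IsUnramifiedCover 2 Rat2tm.HolAt Rat2fm.HolAt forget ∧
    -- the action on totally marked maps is free, and the quotient is a complex surface
    (∀ (g : Rat1) (x : Rat2tm), g • x = x → g = 1) ∧
    IsComplexManifold 2 M2tm.HolAt ∧
    -- the orbit of `z + 1/z` is the only non-free orbit on fixed point marked maps
    (∀ x : Rat2fm, (∃ g : Rat1, g ≠ 1 ∧ g • x = x) ↔ x ∈ MulAction.orbit Rat1 tripleFixed) ∧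
    -- its class is the only singular point of the moduli space, and is of type (2,2,2)
    T2Space M2fm ∧ SecondCountableTopology M2fm ∧
    (∀ m : M2fm, ¬ IsSmoothPoint 2 M2fm.HolAt m ↔ m = Rat2fm.toModuli tripleFixed) ∧
    HasSingularityType 2 2 2 M2fm.HolAt (Rat2fm.toModuli tripleFixed) := by
  exact ⟨isComplexManifold_fm, isComplexManifold_tm, isUnramifiedCover_forget, free_tm,
    isComplexManifold_m2tm, exists_ne_one_smul_eq_iff_mem_orbit, inferInstance, inferInstance,
    not_isSmoothPoint_m2fm_iff, hasSingularityType_m2fm⟩
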